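/- Let $K$ be a field of arbitrary characteristic $p\ge 0$. An $\mathbb S$-module $M$ is a sequence of ($\mathbb Z$-graded, homological) chain complexes $M(n)$, $n\ge 0$, of $K$-vector spaces with actions of the symmetric groups $\mathbb S_n$ by chain maps; it is connected if $M(0)=0$ and $M(1)=K$. Let $\mathcal C$ be a symmetric differential graded cooperad and $\mathcal P$ a symmetric differential graded operad over $K$, both connected. Let $\alpha:\mathcal C\to\mathcal P$ be an operadic twisting morphism, i.e. an $\mathbb S$-equivariant map of degree $-1$ with $\partial\alpha+\alpha\star\alpha=0$, where $\alpha\star\alpha=\gamma_{(1)}\circ(\alpha\circ_{(1)}\alpha)\circ\Delta_{(1)}$, $\Delta_{(1)}$ is the infinitesimal decomposition of $\mathcal C$ and $\gamma_{(1)}$ the infinitesimal composition of $\mathcal P$. For a $\mathcal P$-algebra $A$, the bar construction relative to $\alpha$ is the chain complex $$B_\alpha A=\Big(\mathcal C\circ A=\bigoplus_{n\ge 0}\big(\mathcal C(n)\otimes A^{\otimes n}\big)_{\mathbb S_n},\ d_B=d_1+d_2+d_3\Big),$$ where $d_1$ is induced by $d_A$, $d_3$ is induced by $d_{\mathcal C}$,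 and $d_2$ is the composite $$\mathcal C\circ A\xrightarrow{\Delta_{(1)}\circ \mathrm{id}}(\mathcal C\circ_{(1)}\mathcal C)\circ A\xrightarrow{(\mathrm{id}\circ_{(1)}\alpha)\circ \mathrm{id}}(\mathcal C\circ_{(1)}\mathcal P)\circ A\xrightarrow{\mathrm{id}\circ\gamma_A}\mathcal C\circ A .$$ A morphism $f:A\to A'$ of $\mathcal P$-algebras induces a chain map $B_\alpha f=\mathcal C\circ f:B_\alpha A\to B_\alpha A'$. Assume that for all $n$ and $d$ the $K[\mathbb S_n]$-modules $\mathcal C(n)_d$ and $\mathcal P(n)_d$ are projective, and that $\mathcal C$ and $\mathcal P$ are concentrated in non-negative degrees. If $f:A\to A'$ is a morphism of $\mathcal P$-algebras (which need not be bounded) and a quasi-isomorphism, then $B_\alpha f:B_\alpha A\to B_\alpha A'$ is a quasi-isomorphism. -/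

import Mathlib

open CategoryTheory TensorProduct DirectSum

universe u

noncomputable section

namespace OperadicBar

/-- A sign `±1`, as an element of the field. -/
def usign (K : Type u) [Field K] : ℤˣ →* K :=
  (Int.castRingHom K).toMonoidHom.comp (Units.coeHom ℤ)

/-! ### Graded vector spaces underlying chain complexes -/

/-- The total graded vector space `⨁ i, A i` underlying a chain complex `A`. -/
abbrev Tot {K : Type u} [Field K] (A : ChainComplex (ModuleCat.{u} K) ℤ) : Type u :=
  ⨁ i : ℤ, A.X i

section Tot
variable {K : Type u} [Field K] {A B : ChainComplex (ModuleCat.{u} K) ℤ}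

/-- The homogeneous elements of degree `q`. -/
def gr (A : ChainComplex (ModuleCat.{u} K) ℤ) (q : ℤ) : Submodule K (Tot A) :=
  LinearMap.range (lof K ℤ (fun i => A.X i) q)

/-- The differential on the total space. -/
def totD (A : ChainComplex (ModuleCat.{u} K) ℤ) : Tot A →ₗ[K] Tot A :=
  toModule K ℤ (Tot A) fun i => lof K ℤ (fun i => A.X i) (i - 1) ∘ₗ (A.d i (i - 1)).hom

/-- The Koszul sign operator `x ↦ (-1)^|x| x`. -/
def sgn (A : ChainComplex (ModuleCat.{u} K) ℤ) : Tot A →ₗ[K] Tot A :=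
  toModule K ℤ (Tot A) fun i => usign K i.negOnePow • lof K ℤ (fun i => A.X i) i

/-- The map induced by a chain map on total spaces. -/
def totMap (f : A ⟶ B) : Tot A →ₗ[K] Tot B :=
  DirectSum.lmap fun i => (f.f i).hom

/-- The elements of degree `q` of the tensor product. -/
def tensorGr (A B : ChainComplex (ModuleCat.{u} K) ℤ) (q : ℤ) :
    Submodule K (Tot A ⊗[K] Tot B) :=
  Submodule.span K {z | ∃ i j x y, i + j = q ∧ x ∈ gr A i ∧ y ∈ gr B j ∧ z = x ⊗ₜ[K] y}

/-- The symmetry `x ⊗ y ↦ (-1)^{|x||y|} y ⊗ x`. -/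
def swap (A B : ChainComplex (ModuleCat.{u} K) ℤ) :
    Tot A ⊗[K] Tot B →ₗ[K] Tot B ⊗[K] Tot A :=
  TensorProduct.lift <| toModule K ℤ _ fun i => LinearMap.flip <| toModule K ℤ _ fun j =>
    (usign K (i * j).negOnePow • (TensorProduct.mk K (Tot B) (Tot A)).compl₂
      (lof K ℤ (fun i => A.X i) i)) ∘ₗ lof K ℤ (fun i => B.X i) j

/-- The tensor power `A^{⊗n}`. -/
abbrev TPow (A : ChainComplex (ModuleCat.{u} K) ℤ) (n : ℕ) : Type u :=
  ⨂[K] _ : Fin n, Tot A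

/-- The differential of `A^{⊗n}`:
`a₁ ⊗ ⋯ ⊗ aₙ ↦ ∑ⱼ (-1)^{|a₁| + ⋯ + |aⱼ₋₁|} a₁ ⊗ ⋯ ⊗ d aⱼ ⊗ ⋯ ⊗ aₙ`. -/
def tpowD (A : ChainComplex (ModuleCat.{u} K) ℤ) (n : ℕ) : TPow A n →ₗ[K] TPow A n :=
  ∑ j : Fin n, PiTensorProduct.map fun i =>
    if i < j then sgn A else if i = j then totD A else LinearMap.id

/-- `x ⊗ (a₁ ⊗ ⋯ ⊗ aₙ) ↦ x ⊗ a₁ ⊗ ⋯ ⊗ aₙ`. -/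
def consMap (A : ChainComplex (ModuleCat.{u} K) ℤ) (n : ℕ) :
    Tot A ⊗[K] TPow A n →ₗ[K] TPow A (n + 1) :=
  TensorProduct.lift <| PiTensorProduct.lift.toLinearMap ∘ₗ
    (PiTensorProduct.tprod K (s := fun _ : Fin (n + 1) => Tot A)).curryLeft

end Tot

/-! ### Koszul signs of reorderings -/

/-- The Koszul sign of reordering a family of graded elements, with degrees `p i`, from the order
given by the positions `r i` to the order given by the positions `s i`. -/
def koszulSign {ι : Type} [Fintype ι] (r s : ι → ℕ) (p : ι → ℤ) : ℤˣ :=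
  ∏ i, ∏ j, if r i < r j ∧ s j < s i then (p i * p j).negOnePow else 1

theorem prod_pairs {ι : Type} [Fintype ι] {r : ι → ℕ} (hr : Function.Injective r)
    (F : ι → ι → ℤˣ) (hF : ∀ i, F i i = 1) :
    ∏ i, ∏ j, F i j = ∏ i, ∏ j, if r i < r j then F i j * F j i else 1 := by
  have h : ∀ i j, F i j = (if r i < r j then F i j else 1) * (if r j < r i then F i j else 1) := by
    intro i j
    rcases lt_trichotomy (r i) (r j) with h | h | h
    · simp [h, not_lt.2 h.le]
    · obtain rfl := hr h; simp [hF]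
    · simp [h, not_lt.2 h.le]
  calc _ = ∏ i, ∏ j, (if r i < r j then F i j else 1) * (if r j < r i then F i j else 1) := by
        simp_rw [← h]
    _ = (∏ i, ∏ j, if r i < r j then F i j else 1) *
        ∏ i, ∏ j, if r i < r j then F j i else 1 := by
        simp_rw [Finset.prod_mul_distrib]
        congr 1
        rw [Finset.prod_comm]
    _ = _ := by
        simp_rw [← Finset.prod_mul_distrib]
        refine Finset.prod_congr rfl fun i _ => Finset.prod_congr rfl fun j _ => ?_
        split_ifs <;> simp

theorem koszulSign_trans {ι : Type} [Fintype ι] {r s t : ι → ℕ} (hr : Function.Injective r)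
    (hs : Function.Injective s) (ht : Function.Injective t) (p : ι → ℤ) :
    koszulSign r s p * koszulSign s t p = koszulSign r t p := by
  unfold koszulSign
  simp_rw [← Finset.prod_mul_distrib]
  refine (prod_pairs hr _ (by simp)).trans (Eq.trans ?_ (prod_pairs hr _ (by simp)).symm)
  refine Finset.prod_congr rfl fun i _ => Finset.prod_congr rfl fun j _ => ?_
  by_cases h : r i < r j
  swap; · rw [if_neg h, if_neg h]
  rw [if_pos h, if_pos h]
  have hij : i ≠ j := by rintro rfl; simp at h
  have h1 := hs.ne hij
  have h2 := ht.ne hij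
  rw [mul_comm (p j) (p i)]
  rcases lt_or_gt_of_ne h1 with a | a <;> rcases lt_or_gt_of_ne h2 with b | b <;>
    simp [h, a, b, not_lt.2 h.le, not_lt.2 a.le, not_lt.2 b.le, Int.units_mul_self]

theorem koszulSign_self {ι : Type} [Fintype ι] (r : ι → ℕ) (p : ι → ℤ) :
    koszulSign r r p = 1 := by
  unfold koszulSign
  refine Finset.prod_eq_one fun i _ => Finset.prod_eq_one fun j _ => ?_
  rw [if_neg]; omega

theorem koszulSign_equiv {ι κ : Type} [Fintype ι] [Fintype κ] (e : ι ≃ κ) (r s : κ → ℕ)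
    (p : κ → ℤ) : koszulSign (fun i => r (e i)) (fun i => s (e i)) (fun i => p (e i)) =
      koszulSign r s p := by
  unfold koszulSign
  rw [← e.prod_comp]
  refine Finset.prod_congr rfl fun i _ => ?_
  rw [← e.prod_comp]

theorem koszulSign_congr {ι : Type} [Fintype ι] {r s r' s' : ι → ℕ} (p : ι → ℤ)
    (hr : ∀ i j, r i < r j ↔ r' i < r' j) (hs : ∀ i j, s i < s j ↔ s' i < s' j) :
    koszulSign r s p = koszulSign r' s' p := by
  unfold koszulSign
  simp_rw [hr, hs]

theorem koszulSign_sum {ι κ : Type} [Fintype ι] [Fintype κ] (r s : ι ⊕ κ → ℕ) (p : ι ⊕ κ → ℤ)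
    (hr : ∀ i j, r (.inl i) < r (.inr j)) (hs : ∀ i j, s (.inl i) < s (.inr j)) :
    koszulSign r s p =
      koszulSign (fun i => r (.inl i)) (fun i => s (.inl i)) (fun i => p (.inl i)) *
      koszulSign (fun i => r (.inr i)) (fun i => s (.inr i)) (fun i => p (.inr i)) := by
  unfold koszulSign
  rw [Fintype.prod_sum_type]
  simp_rw [Fintype.prod_sum_type]
  congr 1
  · refine Finset.prod_congr rfl fun i _ => ?_
    rw [mul_eq_left]
    exact Finset.prod_eq_one fun j _ => by rw [if_neg]; have := hs i j; omega
  · refine Finset.prod_congr rfl fun i _ => ?_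
    rw [mul_eq_right]
    exact Finset.prod_eq_one fun j _ => by rw [if_neg]; have := hr j i; omega

theorem koszulSign_update {ι : Type} [Fintype ι] [DecidableEq ι] {r s : ι → ℕ}
    (hr : Function.Injective r) (hs : Function.Injective s) (p : ι → ℤ) (k : ι) :
    (∏ i, if s i < s k then (p i).negOnePow else 1) * koszulSign r s p =
    (∏ i, if r i < r k then (p i).negOnePow else 1) *
      koszulSign r s (Function.update p k (p k - 1)) := by
  have key : koszulSign r s p * koszulSign r s (Function.update p k (p k - 1)) =
      (∏ i, if s i < s k then (p i).negOnePow else 1) *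
        (∏ i, if r i < r k then (p i).negOnePow else 1) := by
    unfold koszulSign
    simp_rw [← Finset.prod_mul_distrib]
    have h : ∀ i j, ((if r i < r j ∧ s j < s i then (p i * p j).negOnePow else 1) *
        if r i < r j ∧ s j < s i then (Function.update p k (p k - 1) i *
          Function.update p k (p k - 1) j).negOnePow else 1) =
        (if i = k then if r k < r j ∧ s j < s k then (p j).negOnePow else 1 else 1) *
        (if j = k then if r i < r k ∧ s k < s i then (p i).negOnePow else 1 else 1) := by
      intro i j
      by_cases hi : i = k <;> by_cases hj : j = k
      · subst hi hj; simp
      · subst hi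
        simp only [if_true, hj, if_false, mul_one, Function.update_self,
          Function.update_of_ne hj, sub_mul, one_mul, Int.negOnePow_sub]
        split_ifs <;> simp [← mul_assoc, Int.units_mul_self]
      · subst hj
        simp only [if_true, hi, if_false, one_mul, Function.update_self,
          Function.update_of_ne hi, mul_sub, mul_one, Int.negOnePow_sub]
        split_ifs <;> simp [← mul_assoc, Int.units_mul_self]
      · simp only [hi, hj, if_false, mul_one, Function.update_of_ne hi, Function.update_of_ne hj]
        split_ifs <;> simp [Int.units_mul_self]
    simp_rw [h, Finset.prod_mul_distrib]
    rw [Finset.prod_comm]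
    simp only [Finset.prod_ite_eq', Finset.mem_univ, if_true]
    rw [← Finset.prod_mul_distrib, ← Finset.prod_mul_distrib]
    refine Finset.prod_congr rfl fun i _ => ?_
    by_cases hij : i = k
    · subst hij; simp
    · have h1 := hr.ne hij
      have h2 := hs.ne hij
      rcases lt_or_gt_of_ne h1 with a | a <;> rcases lt_or_gt_of_ne h2 with b | b <;>
        simp [a, b, not_lt.2 a.le, not_lt.2 b.le, Int.units_mul_self]
  have h2 : koszulSign r s (Function.update p k (p k - 1)) *
    koszulSign r s (Function.update p k (p k - 1)) = 1 := Int.units_mul_self _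
  have h3 : ∀ u : ℤˣ, u * u = 1 := Int.units_mul_self
  calc _ = (∏ i, if s i < s k then (p i).negOnePow else 1) * (koszulSign r s p *
        koszulSign r s (Function.update p k (p k - 1))) *
        koszulSign r s (Function.update p k (p k - 1)) := by
        rw [← mul_assoc, mul_assoc _ (koszulSign r s (Function.update p k (p k - 1))), h2, mul_one]
    _ = _ := by rw [key, ← mul_assoc, h3, one_mul]

/-- The Koszul sign of `a₁ ⊗ ⋯ ⊗ aₙ ↦ ± a_{σ⁻¹(1)} ⊗ ⋯ ⊗ a_{σ⁻¹(n)}`. -/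
def permSign {n : ℕ} (σ : Equiv.Perm (Fin n)) (p : Fin n → ℤ) : ℤˣ :=
  koszulSign (fun i : Fin n => (i : ℕ)) (fun i => (σ i : ℕ)) p

/-- The action of `σ` on `A^{⊗n}`: `a₁ ⊗ ⋯ ⊗ aₙ ↦ ± a_{σ⁻¹(1)} ⊗ ⋯ ⊗ a_{σ⁻¹(n)}`, with its Koszul
sign. -/
def permMap {K : Type u} [Field K] (A : ChainComplex (ModuleCat.{u} K) ℤ) {n : ℕ}
    (σ : Equiv.Perm (Fin n)) : TPow A n →ₗ[K] TPow A n :=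
  PiTensorProduct.lift <| MultilinearMap.fromDirectSumEquiv fun p : Fin n → ℤ =>
    usign K (permSign σ p) •
      ((PiTensorProduct.tprod K (s := fun _ : Fin n => Tot A)).domDomCongr σ.symm).compLinearMap
        fun i => lof K ℤ (fun q => A.X q) (p i)

/-- The positions in the concatenation of two blocks. -/
def blockPos {k l : ℕ} : Fin k ⊕ Fin l → ℕ := Sum.elim (fun i => (i : ℕ)) (fun j => k + (j : ℕ))

/-- The Koszul sign of
`a₁ ⊗ ⋯ ⊗ aₙ ↦ ± (a_{e(inl 1)} ⊗ ⋯ ⊗ a_{e(inl k)}) ⊗ (a_{e(inr 1)} ⊗ ⋯ ⊗ a_{e(inr l)})`. -/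
def splitSign {k l n : ℕ} (e : Fin k ⊕ Fin l ≃ Fin n) (p : Fin n → ℤ) : ℤˣ :=
  koszulSign (fun i : Fin n => (i : ℕ)) (fun i => blockPos (e.symm i)) p

/-- The map `a₁ ⊗ ⋯ ⊗ aₙ ↦ ± (a_{e(inl 1)} ⊗ ⋯ ⊗ a_{e(inl k)}) ⊗ (a_{e(inr 1)} ⊗ ⋯ ⊗ a_{e(inr l)})`
with its Koszul sign. -/
def unshuffle {K : Type u} [Field K] (A : ChainComplex (ModuleCat.{u} K) ℤ) {k l n : ℕ}
    (e : Fin k ⊕ Fin l ≃ Fin n) : TPow A n →ₗ[K] TPow A k ⊗[K] TPow A l :=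
  PiTensorProduct.lift <| MultilinearMap.fromDirectSumEquiv fun p : Fin n → ℤ =>
    usign K (splitSign e p) • ((MultilinearMap.domCoprod
      (PiTensorProduct.tprod K (s := fun _ : Fin k => Tot A))
      (PiTensorProduct.tprod K (s := fun _ : Fin l => Tot A))).domDomCongr e).compLinearMap
        fun i => lof K ℤ (fun q => A.X q) (p i)

/-- The standard enumeration of a subset `T` and of its complement, both in increasing order. -/
def splitEquiv {n : ℕ} (T : Finset (Fin n)) : Fin T.card ⊕ Fin (Tᶜ).card ≃ Fin n :=
  finSumEquivOfFinset rfl rfl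

/-! ### Trees with two vertices -/

/-- A tree with a lower vertex with inputs `Fin m`, an upper vertex with inputs `Fin k`, whose
output is grafted on the input `slot` of the lower vertex, and leaves labelled by `Fin n`:
`root j` is the input of the lower vertex lying below the leaf `j`, and `top y` is the leaf at the
input `y` of the upper vertex. -/
structure Graft (m k n : ℕ) where
  slot : Fin m
  root : Fin n → Fin m
  top : Fin k → Fin n
  top_injective : Function.Injective top
  root_eq_slot : ∀ j, root j = slot ↔ j ∈ Set.range top
  root_bij : ∀ x, x ≠ slot → ∃! j, root j = x

/-- The tree whose upper vertex is grafted on the first input of the lower one, with leaves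
`e (inl y)` above the upper vertex, and `e (inr x)` at the input `x + 1` of the lower vertex. -/
def Graft.ofEquiv {k l n : ℕ} (e : Fin k ⊕ Fin l ≃ Fin n) : Graft (l + 1) k n where
  slot := 0
  root j := Sum.elim (fun _ => 0) Fin.succ (e.symm j)
  top y := e (Sum.inl y)
  top_injective := e.injective.comp Sum.inl_injective
  root_eq_slot j := by
    obtain ⟨x, rfl⟩ := e.surjective j
    cases x <;> simp
  root_bij x hx := by
    obtain ⟨y, rfl⟩ := Fin.exists_succ_eq.2 hx
    refine ⟨e (Sum.inr y), by simp, fun j hj => ?_⟩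
    obtain ⟨z, rfl⟩ := e.surjective j
    cases z with
    | inl z => exact absurd hj.symm (by simp)
    | inr z => simpa using hj

/-- The permutations `σ`, `τ`, `ρ` of the inputs of the two vertices and of the leaves carry the
tree `g` to the tree `g'`. -/
structure Graft.Rel {m k n : ℕ} (σ : Equiv.Perm (Fin m)) (τ : Equiv.Perm (Fin k))
    (ρ : Equiv.Perm (Fin n)) (g g' : Graft m k n) : Prop where
  slot : g'.slot = σ g.slot
  root : ∀ j, g'.root (ρ j) = σ (g.root j)
  top : ∀ y, g'.top (τ y) = ρ (g.top y)

/-- The two ways of cutting a tree with three vertices, stacked one above the other, agree: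
cut off the top vertex first (`g₂`, then `g₁`), or the bottom vertex first (`h₁`, then `h₂`). -/
structure Graft.Sequential {m k l n s r : ℕ} (g₁ : Graft m k n) (g₂ : Graft n l r)
    (h₁ : Graft m s r) (h₂ : Graft k l s) : Prop where
  slot₁ : h₁.slot = g₁.slot
  slot₂ : g₂.slot = g₁.top h₂.slot
  root : ∀ j, h₁.root j = g₁.root (g₂.root j)
  mid : ∀ t, g₂.root (h₁.top t) = g₁.top (h₂.root t)
  top : ∀ w, h₁.top (h₂.top w) = g₂.top w

/-- The two ways of cutting a tree with a bottom vertex and two upper vertices, grafted on two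
different inputs of the bottom vertex, agree: `g₂` cuts off one of the upper vertices (and then
`g₁` the other one), and `h₂` the other one (and then `h₁` the first one). -/
structure Graft.Parallel {m k l n n' r : ℕ} (g₁ : Graft m k n) (g₂ : Graft n l r)
    (h₁ : Graft m l n') (h₂ : Graft n' k r) : Prop where
  ne : g₁.slot ≠ h₁.slot
  slot₁ : g₁.root g₂.slot = h₁.slot
  slot₂ : h₁.root h₂.slot = g₁.slot
  root : ∀ j, g₁.root (g₂.root j) = h₁.root (h₂.root j)
  top₁ : ∀ w, h₂.root (g₂.top w) = h₁.top w
  top₂ : ∀ y, g₂.root (h₂.top y) = g₁.top y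

/-! ### Symmetric sequences, operads and cooperads -/

/-- An `𝕊`-module: a sequence of chain complexes `X n` with an action of the symmetric group on
`n` letters by chain maps. -/
structure SModule (K : Type u) [Field K] where
  X : ℕ → ChainComplex (ModuleCat.{u} K) ℤ
  ρ : ∀ n, Equiv.Perm (Fin n) →* End (X n)

section SModule
variable {K : Type u} [Field K]

/-- The action of a permutation on the total space of `M(n)`. -/
def SModule.act (M : SModule K) {n : ℕ} (σ : Equiv.Perm (Fin n)) :
    Tot (M.X n) →ₗ[K] Tot (M.X n) :=
  totMap (M.ρ n σ)

/-- The representation of the symmetric group on `M(n)_d`. -/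
def SModule.rep (M : SModule K) (n : ℕ) (d : ℤ) :
    Representation K (Equiv.Perm (Fin n)) ((M.X n).X d) where
  toFun σ := ((M.ρ n σ).f d).hom
  map_one' := by rw [map_one]; rfl
  map_mul' σ τ := by rw [map_mul]; rfl

/-- Each `M(n)_d` is a projective module over the group algebra of the symmetric group. -/
def SModule.IsProjective (M : SModule K) : Prop :=
  ∀ n d, Module.Projective (MonoidAlgebra K (Equiv.Perm (Fin n))) (M.rep n d).asModule

/-- `M` is concentrated in non-negative degrees. -/
def SModule.IsNonneg (M : SModule K) : Prop :=
  ∀ n d, d < 0 → Subsingleton ((M.X n).X d)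

/-- A connected (`P(0) = 0`, `P(1) = K`) symmetric differential graded operad, presented by its
partial compositions: `circ g x y` is the composite of `x` and `y` along the tree `g`, with the
inputs numbered according to the labels of the leaves. -/
structure Operad (K : Type u) [Field K] extends SModule K where
  circ : ∀ {m k n : ℕ}, Graft m k n → Tot (X m) →ₗ[K] Tot (X k) →ₗ[K] Tot (X n)
  one : Tot (X 1)
  circ_mem : ∀ {m k n : ℕ} (g : Graft m k n) {p q : ℤ} {x y},
    x ∈ gr (X m) p → y ∈ gr (X k) q → circ g x y ∈ gr (X n) (p + q)
  one_mem : one ∈ gr (X 1) 0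
  circ_d : ∀ {m k n : ℕ} (g : Graft m k n) (x y),
    totD (X n) (circ g x y) = circ g (totD (X m) x) y + circ g (sgn (X m) x) (totD (X k) y)
  circ_act : ∀ {m k n : ℕ} {g g' : Graft m k n} {σ τ ρ}, Graft.Rel σ τ ρ g g' → ∀ x y,
    circ g' (toSModule.act σ x) (toSModule.act τ y) = toSModule.act ρ (circ g x y)
  circ_sequential : ∀ {m k l n s r : ℕ} {g₁ : Graft m k n} {g₂ : Graft n l r}
    {h₁ : Graft m s r} {h₂ : Graft k l s}, Graft.Sequential g₁ g₂ h₁ h₂ → ∀ x y z,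
    circ g₂ (circ g₁ x y) z = circ h₁ x (circ h₂ y z)
  circ_parallel : ∀ {m k l n n' r : ℕ} {g₁ : Graft m k n} {g₂ : Graft n l r}
    {h₁ : Graft m l n'} {h₂ : Graft n' k r}, Graft.Parallel g₁ g₂ h₁ h₂ → ∀ {p q : ℤ} (x) {y z},
    y ∈ gr (X k) p → z ∈ gr (X l) q →
    circ g₂ (circ g₁ x y) z = usign K (p * q).negOnePow • circ h₂ (circ h₁ x z) y
  circ_one : ∀ {n : ℕ} (g : Graft n 1 n) (σ : Equiv.Perm (Fin n)), (∀ j, g.root (σ j) = j) →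
    ∀ x, circ g x one = toSModule.act σ x
  one_circ : ∀ {n : ℕ} (g : Graft 1 n n) (σ : Equiv.Perm (Fin n)), (∀ j, g.top j = σ j) →
    ∀ x, circ g one x = toSModule.act σ x
  connected_zero : Subsingleton (Tot (X 0))
  connected_one : Function.Bijective fun c : K => c • one

/-- A connected (`C(0) = 0`, `C(1) = K`) symmetric differential graded cooperad, presented by its
partial (infinitesimal) decompositions: `cocirc g` is the component of the infinitesimal
decomposition map `C → C ∘₍₁₎ C` at the tree `g`. Since `C(0) = 0` and `C(1) = K`, these components
determine the full decomposition map `C → C ∘ C`. -/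
structure Cooperad (K : Type u) [Field K] extends SModule K where
  cocirc : ∀ {m k n : ℕ}, Graft m k n → Tot (X n) →ₗ[K] Tot (X m) ⊗[K] Tot (X k)
  counit : Tot (X 1) →ₗ[K] K
  cocirc_mem : ∀ {m k n : ℕ} (g : Graft m k n) {p : ℤ} {x},
    x ∈ gr (X n) p → cocirc g x ∈ tensorGr (X m) (X k) p
  counit_mem : ∀ {p : ℤ} {x}, p ≠ 0 → x ∈ gr (X 1) p → counit x = 0
  cocirc_d : ∀ {m k n : ℕ} (g : Graft m k n) (x),
    cocirc g (totD (X n) x) = TensorProduct.map (totD (X m)) LinearMap.id (cocirc g x) +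
      TensorProduct.map (sgn (X m)) (totD (X k)) (cocirc g x)
  cocirc_act : ∀ {m k n : ℕ} {g g' : Graft m k n} {σ τ ρ}, Graft.Rel σ τ ρ g g' → ∀ x,
    cocirc g' (toSModule.act ρ x) =
      TensorProduct.map (toSModule.act σ) (toSModule.act τ) (cocirc g x)
  cocirc_sequential : ∀ {m k l n s r : ℕ} {g₁ : Graft m k n} {g₂ : Graft n l r}
    {h₁ : Graft m s r} {h₂ : Graft k l s}, Graft.Sequential g₁ g₂ h₁ h₂ → ∀ x,
    TensorProduct.assoc K _ _ _ (TensorProduct.map (cocirc g₁) LinearMap.id (cocirc g₂ x)) =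
      TensorProduct.map LinearMap.id (cocirc h₂) (cocirc h₁ x)
  cocirc_parallel : ∀ {m k l n n' r : ℕ} {g₁ : Graft m k n} {g₂ : Graft n l r}
    {h₁ : Graft m l n'} {h₂ : Graft n' k r}, Graft.Parallel g₁ g₂ h₁ h₂ → ∀ x,
    TensorProduct.map LinearMap.id (swap (X k) (X l))
        (TensorProduct.assoc K _ _ _ (TensorProduct.map (cocirc g₁) LinearMap.id (cocirc g₂ x))) =
      TensorProduct.assoc K _ _ _ (TensorProduct.map (cocirc h₁) LinearMap.id (cocirc h₂ x))
  cocirc_counit : ∀ {n : ℕ} (g : Graft n 1 n) (σ : Equiv.Perm (Fin n)), (∀ j, g.root j = σ j) →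
    ∀ x, TensorProduct.rid K _ (TensorProduct.map LinearMap.id counit (cocirc g x)) =
      toSModule.act σ x
  counit_cocirc : ∀ {n : ℕ} (g : Graft 1 n n) (σ : Equiv.Perm (Fin n)), (∀ y, g.top (σ y) = y) →
    ∀ x, TensorProduct.lid K _ (TensorProduct.map counit LinearMap.id (cocirc g x)) =
      toSModule.act σ x
  connected_zero : Subsingleton (Tot (X 0))
  connected_one : Function.Bijective counit

/-- An algebra `A` over an operad `P`: a chain complex with structure maps
`P(n) ⊗ A^{⊗n} → A` which are chain maps, equivariant, unital and associative. -/
structure Algebra (P : Operad K) where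
  X : ChainComplex (ModuleCat.{u} K) ℤ
  γ : ∀ n, Tot (P.X n) →ₗ[K] TPow X n →ₗ[K] Tot X
  γ_mem : ∀ {n : ℕ} {q : ℤ} {p : Fin n → ℤ} {x} {a : Fin n → Tot X},
    x ∈ gr (P.X n) q → (∀ i, a i ∈ gr X (p i)) →
    γ n x (PiTensorProduct.tprod K a) ∈ gr X (q + ∑ i, p i)
  γ_d : ∀ {n : ℕ} (x) (v), totD X (γ n x v) =
    γ n (totD (P.X n) x) v + γ n (sgn (P.X n) x) (tpowD X n v)
  γ_act : ∀ {n : ℕ} (σ : Equiv.Perm (Fin n)) (x) (v), γ n (P.act σ x) (permMap X σ v) = γ n x v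
  γ_one : ∀ a : Fin 1 → Tot X, γ 1 P.one (PiTensorProduct.tprod K a) = a 0
  γ_circ : ∀ {k l n : ℕ} (e : Fin k ⊕ Fin l ≃ Fin n) (x y) (v),
    γ n (P.circ (Graft.ofEquiv e) x y) v =
      γ (l + 1) x (consMap X l (TensorProduct.map (γ k y) LinearMap.id (unshuffle X e v)))

/-- A morphism of `P`-algebras. -/
structure Algebra.Hom {P : Operad K} (A B : Algebra P) where
  hom : A.X ⟶ B.X
  map_γ : ∀ {n : ℕ} (x) (v), totMap hom (A.γ n x v) =
    B.γ n x (PiTensorProduct.map (fun _ => totMap hom) v)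

/-- An operadic twisting morphism: an equivariant map `C → P` of degree `-1` satisfying the
Maurer–Cartan equation `∂α + α ⋆ α = 0`. -/
structure Twisting (C : Cooperad K) (P : Operad K) where
  map : ∀ n, Tot (C.X n) →ₗ[K] Tot (P.X n)
  map_mem : ∀ {n : ℕ} {q : ℤ} {x}, x ∈ gr (C.X n) q → map n x ∈ gr (P.X n) (q - 1)
  map_act : ∀ {n : ℕ} (σ : Equiv.Perm (Fin n)) (x), map n (C.act σ x) = P.act σ (map n x)
  maurer_cartan : ∀ (n : ℕ) (x : Tot (C.X n)),
    totD (P.X n) (map n x) + map n (totD (C.X n) x) +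
      ∑ T : Finset (Fin n), TensorProduct.lift (P.circ (Graft.ofEquiv (splitEquiv T)))
        (TensorProduct.map (map _ ∘ₗ sgn (C.X _)) (map _)
          (C.cocirc (Graft.ofEquiv (splitEquiv T)) x)) = 0

/-! ### The bar construction -/

variable {C : Cooperad K} {P : Operad K} (α : Twisting C P) (A : Algebra P)

/-- The diagonal action of `σ` on `M(n) ⊗ A^{⊗n}`. -/
def diagAct (M : SModule K) (A : ChainComplex (ModuleCat.{u} K) ℤ) {n : ℕ}
    (σ : Equiv.Perm (Fin n)) : Tot (M.X n) ⊗[K] TPow A n →ₗ[K] Tot (M.X n) ⊗[K] TPow A n :=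
  TensorProduct.map (M.act σ) (permMap A σ)

/-- The relations `σ·z = z` cutting out the coinvariants of `M(n) ⊗ A^{⊗n}`. -/
def coinvRel (M : SModule K) (A : ChainComplex (ModuleCat.{u} K) ℤ) (n : ℕ) :
    Submodule K (Tot (M.X n) ⊗[K] TPow A n) :=
  Submodule.span K {z | ∃ (σ : Equiv.Perm (Fin n)) (y : Tot (M.X n) ⊗[K] TPow A n),
    z = diagAct M A σ y - y}

/-- The coinvariants `(M(n) ⊗ A^{⊗n})_{𝕊ₙ}`. -/
def Coinv (M : SModule K) (A : ChainComplex (ModuleCat.{u} K) ℤ) (n : ℕ) : Type u :=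
  (Tot (M.X n) ⊗[K] TPow A n) ⧸ coinvRel M A n

instance (M : SModule K) (A : ChainComplex (ModuleCat.{u} K) ℤ) (n : ℕ) :
    AddCommGroup (Coinv M A n) :=
  Submodule.Quotient.addCommGroup _

instance (M : SModule K) (A : ChainComplex (ModuleCat.{u} K) ℤ) (n : ℕ) :
    Module K (Coinv M A n) :=
  Submodule.Quotient.module _

/-- The composite `M ∘ A = ⨁ₙ (M(n) ⊗ A^{⊗n})_{𝕊ₙ}`. -/
abbrev Comp (M : SModule K) (A : ChainComplex (ModuleCat.{u} K) ℤ) : Type u :=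
  ⨁ n : ℕ, Coinv M A n

/-- The class of an element of `M(n) ⊗ A^{⊗n}` in `M ∘ A`. -/
def Comp.mk (M : SModule K) (A : ChainComplex (ModuleCat.{u} K) ℤ) (n : ℕ) :
    Tot (M.X n) ⊗[K] TPow A n →ₗ[K] Comp M A :=
  lof K ℕ (Coinv M A) n ∘ₗ (coinvRel M A n).mkQ

/-- The elements of degree `q` of `M ∘ A`. -/
def Comp.gr (M : SModule K) (A : ChainComplex (ModuleCat.{u} K) ℤ) (q : ℤ) :
    Submodule K (Comp M A) :=
  Submodule.span K {z | ∃ (n : ℕ) (r : ℤ) (p : Fin n → ℤ) (x : Tot (M.X n)) (a : Fin n → Tot A),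
    x ∈ OperadicBar.gr (M.X n) r ∧ (∀ i, a i ∈ OperadicBar.gr A (p i)) ∧ r + ∑ i, p i = q ∧
    z = Comp.mk M A n (x ⊗ₜ[K] PiTensorProduct.tprod K a)}

/-- The part of the bar differential given by the differential of the algebra. -/
def barD₁ (n : ℕ) : Tot (C.X n) ⊗[K] TPow A.X n →ₗ[K] Tot (C.X n) ⊗[K] TPow A.X n :=
  TensorProduct.map (sgn (C.X n)) (tpowD A.X n)

/-- The part of the bar differential given by the differential of the cooperad. -/
def barD₃ (n : ℕ) : Tot (C.X n) ⊗[K] TPow A.X n →ₗ[K] Tot (C.X n) ⊗[K] TPow A.X n :=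
  TensorProduct.map (totD (C.X n)) LinearMap.id

/-- `(x' ⊗ x'') ⊗ (v ⊗ w) ↦ (-1)^{|x'|} x' ⊗ (γ(α(x''); v) ⊗ w)`. -/
def barApply (k l : ℕ) : (Tot (C.X (l + 1)) ⊗[K] Tot (C.X k)) ⊗[K] (TPow A.X k ⊗[K] TPow A.X l)
    →ₗ[K] Tot (C.X (l + 1)) ⊗[K] TPow A.X (l + 1) :=
  TensorProduct.map (sgn (C.X (l + 1)))
    (consMap A.X l ∘ₗ
      TensorProduct.map (TensorProduct.lift (A.γ k ∘ₗ α.map k)) LinearMap.id ∘ₗ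
      (TensorProduct.assoc K _ _ _).symm.toLinearMap) ∘ₗ
    (TensorProduct.assoc K _ _ _).toLinearMap

/-- The summand of `C ∘ A → (C ∘₍₁₎ C) ∘ A → (C ∘₍₁₎ P) ∘ A → C ∘ A` at the tree given by `e`. -/
def barTerm {k l n : ℕ} (e : Fin k ⊕ Fin l ≃ Fin n) :
    Tot (C.X n) ⊗[K] TPow A.X n →ₗ[K] Tot (C.X (l + 1)) ⊗[K] TPow A.X (l + 1) :=
  barApply α A k l ∘ₗ TensorProduct.map (C.cocirc (Graft.ofEquiv e)) (unshuffle A.X e)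

/-- The bar differential, before passing to coinvariants. -/
def barPre (n : ℕ) : Tot (C.X n) ⊗[K] TPow A.X n →ₗ[K] Comp C.toSModule A.X :=
  Comp.mk C.toSModule A.X n ∘ₗ (barD₁ A n + barD₃ A n) +
    ∑ T : Finset (Fin n), Comp.mk C.toSModule A.X _ ∘ₗ barTerm α A (splitEquiv T)


end SModule

/-! ### Elementary facts -/

section Tot
variable {K : Type u} [Field K] {A B : ChainComplex (ModuleCat.{u} K) ℤ}

theorem usign_mul_self (c : ℤˣ) : usign K c * usign K c = 1 := by
  rw [← map_mul, Int.units_mul_self, map_one]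

theorem totD_lof (q : ℤ) (x : A.X q) : totD A (lof K ℤ (fun i => A.X i) q x) =
    lof K ℤ (fun i => A.X i) (q - 1) ((A.d q (q - 1)).hom x) :=
  toModule_lof ..

theorem totMap_lof (f : A ⟶ B) (q : ℤ) (x : A.X q) : totMap f (lof K ℤ (fun i => A.X i) q x) =
    lof K ℤ (fun i => B.X i) q ((f.f q).hom x) :=
  lmap_lof ..

theorem lof_mem_gr {q : ℤ} (x : A.X q) : lof K ℤ (fun i => A.X i) q x ∈ gr A q := ⟨x, rfl⟩

theorem Tot.induction {motive : Tot A → Prop} (x : Tot A)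
    (h : ∀ q, ∀ x ∈ gr A q, motive x) (hadd : ∀ x y, motive x → motive y → motive (x + y)) :
    motive x :=
  DirectSum.induction_on x (h 0 0 (Submodule.zero_mem _)) (fun q x => h q _ ⟨x, rfl⟩) hadd

theorem sgn_of_mem {q : ℤ} {x : Tot A} (hx : x ∈ gr A q) : sgn A x = usign K q.negOnePow • x := by
  obtain ⟨x, rfl⟩ := hx
  exact (toModule_lof ..).trans rfl

theorem sgn_mem {q : ℤ} {x : Tot A} (hx : x ∈ gr A q) : sgn A x ∈ gr A q := by
  rw [sgn_of_mem hx]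
  exact Submodule.smul_mem _ _ hx

theorem totD_mem {q : ℤ} {x : Tot A} (hx : x ∈ gr A q) : totD A x ∈ gr A (q - 1) := by
  obtain ⟨x, rfl⟩ := hx
  exact ⟨(A.d q (q - 1)).hom x, (totD_lof q x).symm⟩

theorem totD_totD (x : Tot A) : totD A (totD A x) = 0 := by
  induction x using Tot.induction with
  | h q x hx =>
    obtain ⟨x, rfl⟩ := hx
    rw [totD_lof, totD_lof, ← LinearMap.comp_apply (A.d _ _).hom, ← ModuleCat.hom_comp, A.d_comp_d]
    simp
  | hadd x y hx hy => rw [map_add, map_add, hx, hy, add_zero]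

theorem sgn_totD (x : Tot A) : sgn A (totD A x) = - totD A (sgn A x) := by
  induction x using Tot.induction with
  | h q x hx =>
    rw [sgn_of_mem hx, sgn_of_mem (totD_mem hx), Int.negOnePow_sub, map_smul]
    simp [usign]
  | hadd x y hx hy => simp only [map_add, hx, hy, neg_add]

theorem sgn_sgn (x : Tot A) : sgn A (sgn A x) = x := by
  induction x using Tot.induction with
  | h q x hx =>
    rw [sgn_of_mem (sgn_mem hx), sgn_of_mem hx, smul_smul, usign_mul_self, one_smul]
  | hadd x y hx hy => simp only [map_add, hx, hy]

theorem totMap_mem (f : A ⟶ B) {q : ℤ} {x : Tot A} (hx : x ∈ gr A q) : totMap f x ∈ gr B q := by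
  obtain ⟨x, rfl⟩ := hx
  exact ⟨(f.f q).hom x, (totMap_lof ..).symm⟩

theorem totMap_sgn (f : A ⟶ B) (x : Tot A) : totMap f (sgn A x) = sgn B (totMap f x) := by
  induction x using Tot.induction with
  | h q x hx =>
    rw [sgn_of_mem hx, sgn_of_mem (totMap_mem f hx), map_smul]
  | hadd x y hx hy => simp only [map_add, hx, hy]

theorem totMap_totD (f : A ⟶ B) (x : Tot A) : totMap f (totD A x) = totD B (totMap f x) := by
  induction x using Tot.induction with
  | h q x hx =>
    obtain ⟨x, rfl⟩ := hx
    rw [totD_lof, totMap_lof, totMap_lof, totD_lof, ← LinearMap.comp_apply (B.d _ _).hom, ← ModuleCat.hom_comp, f.comm]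
    rfl
  | hadd x y hx hy => simp only [map_add, hx, hy]

theorem totMap_id : totMap (𝟙 A) = LinearMap.id := by
  ext; simp [totMap]

theorem totMap_comp {D : ChainComplex (ModuleCat.{u} K) ℤ} (f : A ⟶ B) (g : B ⟶ D) :
    totMap (f ≫ g) = totMap g ∘ₗ totMap f := by
  ext; simp [totMap]

/-- Linear maps out of a tensor power agree if they agree on tensors of homogeneous elements. -/
theorem tpow_ext {n : ℕ} {M : Type*} [AddCommGroup M] [Module K M] {f g : TPow A n →ₗ[K] M}
    (h : ∀ (p : Fin n → ℤ) (a : Fin n → Tot A), (∀ i, a i ∈ gr A (p i)) →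
      f (PiTensorProduct.tprod K a) = g (PiTensorProduct.tprod K a)) : f = g := by
  refine PiTensorProduct.ext (MultilinearMap.fromDirectSumEquiv.symm.injective ?_)
  funext p
  ext a
  simpa using h p _ fun i => lof_mem_gr (a i)

/-- To check an identity on `A ⊗ B`, take homogeneous tensors. -/
theorem tensor_ext {M : Type*} [AddCommGroup M] [Module K M] {f g : Tot A ⊗[K] Tot B →ₗ[K] M}
    (h : ∀ p q, ∀ x ∈ gr A p, ∀ y ∈ gr B q, f (x ⊗ₜ y) = g (x ⊗ₜ y)) : f = g := by
  refine TensorProduct.ext' fun x y => ?_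
  induction x using Tot.induction with
  | hadd x x' hx hx' => simp only [add_tmul, map_add, hx, hx']
  | h p x hx =>
    induction y using Tot.induction with
    | hadd y y' hy hy' => simp only [tmul_add, map_add, hy, hy']
    | h q y hy => exact h p q x hx y hy

theorem tpow_tensor_ext {k l : ℕ} {M : Type*} [AddCommGroup M] [Module K M]
    {f g : TPow A k ⊗[K] TPow A l →ₗ[K] M}
    (h : ∀ (p : Fin k → ℤ) (u : Fin k → Tot A) (q : Fin l → ℤ) (w : Fin l → Tot A),
      (∀ i, u i ∈ gr A (p i)) → (∀ i, w i ∈ gr A (q i)) →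
      f (PiTensorProduct.tprod K u ⊗ₜ PiTensorProduct.tprod K w) =
        g (PiTensorProduct.tprod K u ⊗ₜ PiTensorProduct.tprod K w)) : f = g := by
  apply TensorProduct.ext
  refine tpow_ext fun p u hu => ?_
  exact tpow_ext fun q w hw => h p u q w hu hw

theorem unshuffle_tprod {k l n : ℕ} (e : Fin k ⊕ Fin l ≃ Fin n) {p : Fin n → ℤ}
    {a : Fin n → Tot A} (ha : ∀ i, a i ∈ gr A (p i)) :
    unshuffle A e (PiTensorProduct.tprod K a) = usign K (splitSign e p) •
      ((PiTensorProduct.tprod K fun i => a (e (.inl i))) ⊗ₜ[K]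
        PiTensorProduct.tprod K fun i => a (e (.inr i))) := by
  choose b hb using ha
  obtain rfl : (fun i => lof K ℤ (fun q => A.X q) (p i) (b i)) = a := funext hb
  rw [unshuffle, PiTensorProduct.lift.tprod, MultilinearMap.fromDirectSumEquiv_lof,
    _root_.smul_apply]
  rfl

theorem permMap_tprod {n : ℕ} (σ : Equiv.Perm (Fin n)) {p : Fin n → ℤ} {a : Fin n → Tot A}
    (ha : ∀ i, a i ∈ gr A (p i)) : permMap A σ (PiTensorProduct.tprod K a) =
      usign K (permSign σ p) • PiTensorProduct.tprod K fun i => a (σ.symm i) := by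
  choose b hb using ha
  obtain rfl : (fun i => lof K ℤ (fun q => A.X q) (p i) (b i)) = a := funext hb
  rw [permMap, PiTensorProduct.lift.tprod, MultilinearMap.fromDirectSumEquiv_lof,
    _root_.smul_apply]
  rfl

theorem consMap_tprod {n : ℕ} (x : Tot A) (a : Fin n → Tot A) :
    consMap A n (x ⊗ₜ[K] PiTensorProduct.tprod K a) = PiTensorProduct.tprod K (Fin.cons x a) := by
  simp [consMap, MultilinearMap.curryLeft_apply]

theorem tpowD_tprod {n : ℕ} {p : Fin n → ℤ} {a : Fin n → Tot A} (ha : ∀ i, a i ∈ gr A (p i)) :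
    tpowD A n (PiTensorProduct.tprod K a) = ∑ j,
      usign K (∏ i, if i < j then (p i).negOnePow else 1) •
      PiTensorProduct.tprod K (Function.update a j (totD A (a j))) := by
  rw [tpowD, LinearMap.sum_apply]
  refine Finset.sum_congr rfl fun j _ => ?_
  rw [PiTensorProduct.map_tprod]
  have : (fun i => (if i < j then sgn A else if i = j then totD A else LinearMap.id) (a i)) =
      fun i => (if i < j then usign K (p i).negOnePow else 1) •
        Function.update a j (totD A (a j)) i := by
    funext i
    rcases lt_trichotomy i j with h | h | h
    · simp only [h, h.ne, if_true, sgn_of_mem (ha i), ne_eq, not_false_eq_true,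
        Function.update_of_ne]
    · subst h; simp
    · simp [h.ne', not_lt.2 h.le]
  rw [this, MultilinearMap.map_smul_univ, map_prod]
  congr 1
  refine Finset.prod_congr rfl fun i _ => ?_
  split_ifs <;> simp
end Tot

/-! ### The bar differential descends to coinvariants -/

theorem blockPos_injective {k l : ℕ} : Function.Injective (blockPos (k := k) (l := l)) := by
  rintro (i | i) (j | j) h <;> simp only [blockPos, Sum.elim_inl, Sum.elim_inr] at h
  · rw [Fin.ext h]
  · omega
  · omega
  · rw [Fin.ext (by omega : (i : ℕ) = j)]

/-- The extension of a permutation of `n` letters to `n + 1` letters fixing the first one. -/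
def permCons {n : ℕ} (σ : Equiv.Perm (Fin n)) : Equiv.Perm (Fin (n + 1)) :=
  Equiv.Perm.decomposeFin.symm (0, σ)

@[simp] theorem permCons_zero {n : ℕ} (σ : Equiv.Perm (Fin n)) : permCons σ 0 = 0 := by
  simp [permCons]

@[simp] theorem permCons_succ {n : ℕ} (σ : Equiv.Perm (Fin n)) (i : Fin n) :
    permCons σ i.succ = (σ i).succ := by
  simp [permCons]

theorem permSign_permCons {n : ℕ} (σ : Equiv.Perm (Fin n)) (q : ℤ) (p : Fin n → ℤ) :
    permSign (permCons σ) (Fin.cons q p) = permSign σ p := by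
  unfold permSign koszulSign
  simp [Fin.prod_univ_succ]

theorem cons_permCons {n : ℕ} {M : Type*} (σ : Equiv.Perm (Fin n)) (b : M) (w : Fin n → M) :
    (fun i => (Fin.cons b w : Fin (n + 1) → M) ((permCons σ).symm i)) =
      Fin.cons b fun i => w (σ.symm i) := by
  funext i
  obtain ⟨j, rfl⟩ := (permCons σ).surjective i
  rw [Equiv.symm_apply_apply]
  cases j using Fin.cases <;> simp

theorem splitSign_perm {k l n : ℕ} {e e' : Fin k ⊕ Fin l ≃ Fin n} {σ : Equiv.Perm (Fin n)}
    {τ : Equiv.Perm (Fin k)} {υ : Equiv.Perm (Fin l)} (hl : ∀ i, σ (e (.inl i)) = e' (.inl (τ i)))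
    (hr : ∀ i, σ (e (.inr i)) = e' (.inr (υ i))) (p : Fin n → ℤ) :
    permSign σ p * splitSign e' (fun i => p (σ.symm i)) =
      splitSign e p * (permSign τ (fun i => p (e (.inl i))) *
        permSign υ (fun i => p (e (.inr i)))) := by
  have hv : Function.Injective (fun i : Fin n => (i : ℕ)) := Fin.val_injective
  have h1 : splitSign e' (fun i => p (σ.symm i)) =
      koszulSign (fun i : Fin n => (σ i : ℕ)) (fun i => blockPos (e'.symm (σ i))) p := by
    unfold splitSign
    rw [← koszulSign_equiv σ]
    simp
  have h2 : permSign τ (fun i => p (e (.inl i))) * permSign υ (fun i => p (e (.inr i))) =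
      koszulSign (fun i => blockPos (e.symm i)) (fun i => blockPos (e'.symm (σ i))) p := by
    rw [← koszulSign_equiv e, koszulSign_sum]
    · unfold permSign
      congr 1
      · exact koszulSign_congr _ (by simp [blockPos]) (by simp [blockPos, hl])
      · exact koszulSign_congr _ (by simp [blockPos]) (by simp [blockPos, hr])
    · intro i j; simp [blockPos]; omega
    · intro i j; simp [blockPos, hl, hr]; omega
  rw [h1, h2, permSign, splitSign, koszulSign_trans hv, koszulSign_trans hv]
  · exact blockPos_injective.comp e.symm.injective
  · exact blockPos_injective.comp (e'.symm.injective.comp σ.injective)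
  · exact hv.comp σ.injective
  · exact blockPos_injective.comp (e'.symm.injective.comp σ.injective)

section
variable {K : Type u} [Field K] {A : ChainComplex (ModuleCat.{u} K) ℤ}

theorem permMap_one {n : ℕ} : permMap A (1 : Equiv.Perm (Fin n)) = LinearMap.id := by
  refine tpow_ext fun p a ha => ?_
  rw [permMap_tprod 1 ha, permSign]
  simp [koszulSign_self, Equiv.Perm.one_def]

theorem tprod_cons_smul {n : ℕ} (c : K) (x : Tot A) (w : Fin n → Tot A) :
    PiTensorProduct.tprod K (Fin.cons (c • x) w : Fin (n + 1) → Tot A) =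
      c • PiTensorProduct.tprod K (Fin.cons x w : Fin (n + 1) → Tot A) := by
  rw [← consMap_tprod, ← consMap_tprod, ← smul_tmul', map_smul]

theorem permMap_consMap {n : ℕ} (σ : Equiv.Perm (Fin n)) (x : Tot A) (v : TPow A n) :
    permMap A (permCons σ) (consMap A n (x ⊗ₜ[K] v)) = consMap A n (x ⊗ₜ[K] permMap A σ v) := by
  induction x using Tot.induction with
  | hadd x y hx hy => simp only [add_tmul, map_add, hx, hy]
  | h q x hx =>
    suffices h : (permMap A (permCons σ) ∘ₗ consMap A n) ∘ₗ TensorProduct.mk K _ _ x =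
        (consMap A n ∘ₗ TensorProduct.mk K _ _ x) ∘ₗ permMap A σ from LinearMap.congr_fun h v
    refine tpow_ext fun p a ha => ?_
    simp only [LinearMap.comp_apply, TensorProduct.mk_apply, consMap_tprod, permMap_tprod σ ha,
      map_smul]
    rw [permMap_tprod (p := Fin.cons q p), permSign_permCons, cons_permCons]
    intro i
    cases i using Fin.cases with
    | zero => exact hx
    | succ i => exact ha i

theorem unshuffle_permMap {k l n : ℕ} {e e' : Fin k ⊕ Fin l ≃ Fin n} {σ : Equiv.Perm (Fin n)}
    {τ : Equiv.Perm (Fin k)} {υ : Equiv.Perm (Fin l)} (hl : ∀ i, σ (e (.inl i)) = e' (.inl (τ i)))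
    (hr : ∀ i, σ (e (.inr i)) = e' (.inr (υ i))) (v : TPow A n) :
    unshuffle A e' (permMap A σ v) =
      TensorProduct.map (permMap A τ) (permMap A υ) (unshuffle A e v) := by
  suffices h : unshuffle A e' ∘ₗ permMap A σ =
    TensorProduct.map (permMap A τ) (permMap A υ) ∘ₗ unshuffle A e from LinearMap.congr_fun h v
  refine tpow_ext (A := A) (M := TPow A k ⊗[K] TPow A l) fun p a ha => ?_
  have hl' : (fun i => a (σ.symm (e' (.inl i)))) = fun i => a (e (.inl (τ.symm i))) := by
    funext i
    obtain ⟨j, rfl⟩ := τ.surjective i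
    rw [← hl]; simp
  have hr' : (fun i => a (σ.symm (e' (.inr i)))) = fun i => a (e (.inr (υ.symm i))) := by
    funext i
    obtain ⟨j, rfl⟩ := υ.surjective i
    rw [← hr]; simp
  rw [LinearMap.comp_apply, LinearMap.comp_apply, permMap_tprod σ ha, map_smul,
    unshuffle_tprod (p := fun i => p (σ.symm i)) e' fun i => ha _, unshuffle_tprod e ha, map_smul,
    TensorProduct.map_tmul, permMap_tprod τ fun i => ha (e (.inl i)),
    permMap_tprod υ fun i => ha (e (.inr i)), hl', hr', smul_tmul_smul, smul_smul, smul_smul,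
    ← map_mul, ← map_mul, ← map_mul, splitSign_perm hl hr p]

end

section
variable {K : Type u} [Field K] {C : Cooperad K} {P : Operad K} (α : Twisting C P) (A : Algebra P)

theorem SModule.act_sgn (M : SModule K) {n : ℕ} (σ : Equiv.Perm (Fin n)) (x : Tot (M.X n)) :
    M.act σ (sgn _ x) = sgn _ (M.act σ x) := totMap_sgn ..

theorem SModule.act_totD (M : SModule K) {n : ℕ} (σ : Equiv.Perm (Fin n)) (x : Tot (M.X n)) :
    M.act σ (totD _ x) = totD _ (M.act σ x) := totMap_totD ..

theorem SModule.act_one (M : SModule K) {n : ℕ} :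
    M.act (1 : Equiv.Perm (Fin n)) = LinearMap.id := by
  rw [SModule.act, map_one]; exact totMap_id

theorem diagAct_one (M : SModule K) (A : ChainComplex (ModuleCat.{u} K) ℤ) {n : ℕ} :
    diagAct M A (1 : Equiv.Perm (Fin n)) = LinearMap.id := by
  rw [diagAct, permMap_one, SModule.act_one, TensorProduct.map_id]

theorem mk_diagAct (M : SModule K) (A : ChainComplex (ModuleCat.{u} K) ℤ) {n : ℕ}
    (σ : Equiv.Perm (Fin n)) (z : Tot (M.X n) ⊗[K] TPow A n) :
    Comp.mk M A n (diagAct M A σ z) = Comp.mk M A n z :=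
  congrArg (lof K ℕ (Coinv M A) n)
    ((Submodule.Quotient.eq _).2 (Submodule.subset_span ⟨σ, z, rfl⟩))

variable {A} in
theorem barApply_tmul {k l : ℕ} (x : Tot (C.X (l + 1))) (y : Tot (C.X k)) (v : TPow A.X k)
    (w : TPow A.X l) :
    barApply α A k l ((x ⊗ₜ[K] y) ⊗ₜ[K] (v ⊗ₜ[K] w)) =
    sgn (C.X (l + 1)) x ⊗ₜ[K] consMap A.X l (A.γ k (α.map k y) v ⊗ₜ[K] w) := by
  simp [barApply]

theorem barApply_diagAct {k l : ℕ} (τ : Equiv.Perm (Fin k)) (υ : Equiv.Perm (Fin l)) (z) :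
    barApply α A k l (TensorProduct.map (TensorProduct.map (C.act (permCons υ)) (C.act τ))
      (TensorProduct.map (permMap A.X τ) (permMap A.X υ)) z) =
    diagAct C.toSModule A.X (permCons υ) (barApply α A k l z) := by
  suffices h : barApply α A k l ∘ₗ TensorProduct.map
      (TensorProduct.map (C.act (permCons υ)) (C.act τ))
      (TensorProduct.map (permMap A.X τ) (permMap A.X υ)) =
      diagAct C.toSModule A.X (permCons υ) ∘ₗ barApply α A k l from LinearMap.congr_fun h z
  apply TensorProduct.ext_fourfold'
  intro x y v w
  simp only [LinearMap.comp_apply, TensorProduct.map_tmul, barApply_tmul, diagAct, α.map_act,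
    A.γ_act, permMap_consMap, SModule.act_sgn]

theorem rel_ofEquiv {k l n : ℕ} {e e' : Fin k ⊕ Fin l ≃ Fin n} {σ : Equiv.Perm (Fin n)}
    {τ : Equiv.Perm (Fin k)} {υ : Equiv.Perm (Fin l)} (hl : ∀ i, σ (e (.inl i)) = e' (.inl (τ i)))
    (hr : ∀ i, σ (e (.inr i)) = e' (.inr (υ i))) :
    Graft.Rel (permCons υ) τ σ (Graft.ofEquiv e) (Graft.ofEquiv e') where
  slot := by simp [Graft.ofEquiv]
  root j := by
    obtain ⟨j, rfl⟩ := e.surjective j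
    cases j <;> simp [Graft.ofEquiv, hl, hr]
  top y := (hl y).symm

theorem barTerm_diagAct {k l n : ℕ} {e e' : Fin k ⊕ Fin l ≃ Fin n} {σ : Equiv.Perm (Fin n)}
    {τ : Equiv.Perm (Fin k)} {υ : Equiv.Perm (Fin l)} (hl : ∀ i, σ (e (.inl i)) = e' (.inl (τ i)))
    (hr : ∀ i, σ (e (.inr i)) = e' (.inr (υ i))) (z) :
    barTerm α A e' (diagAct C.toSModule A.X σ z) =
      diagAct C.toSModule A.X (permCons υ) (barTerm α A e z) := by
  rw [barTerm, barTerm, LinearMap.comp_apply, LinearMap.comp_apply,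
    ← barApply_diagAct α A τ υ]
  congr 1
  induction z using TensorProduct.induction_on with
  | zero => simp only [map_zero]
  | add z z' h h' => simp only [map_add, h, h']
  | tmul x v =>
    rw [diagAct, TensorProduct.map_tmul, TensorProduct.map_tmul, TensorProduct.map_tmul,
      TensorProduct.map_tmul, unshuffle_permMap hl hr, C.cocirc_act (rel_ofEquiv hl hr)]

theorem exists_perms {k l k' l' n : ℕ} (e : Fin k ⊕ Fin l ≃ Fin n)
    (e' : Fin k' ⊕ Fin l' ≃ Fin n) (σ : Equiv.Perm (Fin n))
    (h : ∀ i, (∃ y, e (.inl y) = i) ↔ ∃ y, e' (.inl y) = σ i) : k = k' ∧ l = l' := by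
  have hk : k = k' := by
    apply le_antisymm
    · choose f hf using fun y => (h (e (.inl y))).1 ⟨y, rfl⟩
      have : Function.Injective f := fun y z hyz => by
        have := hf y
        rw [hyz, hf z] at this
        simpa using this.symm
      simpa using Fintype.card_le_of_injective f this
    · choose f hf using fun y => (h (σ.symm (e' (.inl y)))).2 ⟨y, by simp⟩
      have : Function.Injective f := fun y z hyz => by
        have := hf y
        rw [hyz, hf z] at this
        simpa using this.symm
      simpa using Fintype.card_le_of_injective f this
  have h1 := Fintype.card_congr e
  have h2 := Fintype.card_congr e'
  simp at h1 h2
  exact ⟨hk, by omega⟩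

theorem exists_perms' {k l n : ℕ} (e e' : Fin k ⊕ Fin l ≃ Fin n) (σ : Equiv.Perm (Fin n))
    (h : ∀ i, (∃ y, e (.inl y) = i) ↔ ∃ y, e' (.inl y) = σ i) :
    ∃ (τ : Equiv.Perm (Fin k)) (υ : Equiv.Perm (Fin l)),
      (∀ i, σ (e (.inl i)) = e' (.inl (τ i))) ∧ ∀ i, σ (e (.inr i)) = e' (.inr (υ i)) := by
  obtain ⟨⟨τ, υ⟩, hτ⟩ := Equiv.Perm.mem_sumCongrHom_range_of_perm_mapsTo_inl
    (σ := (e.trans σ).trans e'.symm) (by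
      rintro _ ⟨y, rfl⟩
      obtain ⟨z, hz⟩ := (h (e (.inl y))).1 ⟨y, rfl⟩
      exact ⟨z, by simp [← hz]⟩)
  refine ⟨τ, υ, fun i => ?_, fun i => ?_⟩
  · have := congrArg e' (DFunLike.congr_fun hτ (.inl i))
    simpa using this.symm
  · have := congrArg e' (DFunLike.congr_fun hτ (.inr i))
    simpa using this.symm

theorem mk_barTerm_diagAct {k l k' l' n : ℕ} (e : Fin k ⊕ Fin l ≃ Fin n)
    (e' : Fin k' ⊕ Fin l' ≃ Fin n) (σ : Equiv.Perm (Fin n))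
    (h : ∀ i, (∃ y, e (.inl y) = i) ↔ ∃ y, e' (.inl y) = σ i) (z) :
    Comp.mk C.toSModule A.X (l' + 1) (barTerm α A e' (diagAct C.toSModule A.X σ z)) =
      Comp.mk C.toSModule A.X (l + 1) (barTerm α A e z) := by
  obtain ⟨rfl, rfl⟩ := exists_perms e e' σ h
  obtain ⟨τ, υ, hl, hr⟩ := exists_perms' e e' σ h
  rw [barTerm_diagAct α A hl hr, mk_diagAct]

theorem splitEquiv_inl_iff {n : ℕ} (T : Finset (Fin n)) (i : Fin n) :
    (∃ y, splitEquiv T (.inl y) = i) ↔ i ∈ T := by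
  have := Finset.range_orderEmbOfFin T rfl
  rw [← Finset.mem_coe, ← this]
  simp only [splitEquiv, finSumEquivOfFinset_inl, Set.mem_range]

/-- The sum over all trees is compatible with the actions of permutations. -/
theorem mk_barTerm_sum {n : ℕ} (σ : Equiv.Perm (Fin n)) (z) :
    ∑ T : Finset (Fin n), Comp.mk C.toSModule A.X _ (barTerm α A (splitEquiv T)
      (diagAct C.toSModule A.X σ z)) =
    ∑ T : Finset (Fin n), Comp.mk C.toSModule A.X _ (barTerm α A (splitEquiv T) z) := by
  rw [← σ.finsetCongr.sum_comp]
  refine Finset.sum_congr rfl fun T _ => ?_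
  refine mk_barTerm_diagAct α A _ _ σ (fun i => ?_) z
  rw [splitEquiv_inl_iff, splitEquiv_inl_iff]
  simp

theorem tpowD_permMap {n : ℕ} {A : ChainComplex (ModuleCat.{u} K) ℤ} (σ : Equiv.Perm (Fin n)) (v) :
    tpowD A n (permMap A σ v) = permMap A σ (tpowD A n v) := by
  suffices h : tpowD A n ∘ₗ permMap A σ = permMap A σ ∘ₗ tpowD A n from LinearMap.congr_fun h v
  refine tpow_ext fun p a ha => ?_
  rw [LinearMap.comp_apply, LinearMap.comp_apply, permMap_tprod σ ha, map_smul, tpowD_tprod ha,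
    tpowD_tprod (p := fun i => p (σ.symm i)) fun i => ha _, map_sum, Finset.smul_sum,
    ← Equiv.sum_comp σ]
  refine Finset.sum_congr rfl fun j _ => ?_
  have h1 : Function.update (fun i => a (σ.symm i)) (σ j) (totD A (a (σ.symm (σ j)))) =
      fun i => Function.update a j (totD A (a j)) (σ.symm i) := by
    funext i
    obtain ⟨i, rfl⟩ := σ.surjective i
    by_cases h : i = j
    · subst h; simp
    · simp [h]
  rw [map_smul, permMap_tprod (p := Function.update p j (p j - 1)) σ, h1, smul_smul, smul_smul,
    ← map_mul, ← map_mul]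
  · have h2 := koszulSign_update (r := fun i : Fin n => (i : ℕ)) (s := fun i => (σ i : ℕ))
      Fin.val_injective (Fin.val_injective.comp σ.injective) p j
    simp only [Fin.val_fin_lt] at h2
    rw [permSign, permSign, ← h2, mul_comm, ← Equiv.prod_comp σ]
    simp
  · intro i
    by_cases h : i = j
    · subst h; simpa using totD_mem (ha i)
    · simpa [h] using ha i

theorem coinvRel_le_ker (n : ℕ) :
    coinvRel C.toSModule A.X n ≤ LinearMap.ker (barPre α A n) := by
  refine Submodule.span_le.2 ?_
  rintro _ ⟨σ, z, rfl⟩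
  rw [SetLike.mem_coe, LinearMap.mem_ker, map_sub, sub_eq_zero]
  simp only [barPre, LinearMap.add_apply, LinearMap.comp_apply, LinearMap.sum_apply,
    mk_barTerm_sum α A σ z]
  congr 1
  rw [← mk_diagAct _ _ σ ((barD₁ A n) z + (barD₃ A n) z)]
  congr 1
  induction z using TensorProduct.induction_on with
  | zero => simp only [map_zero, add_zero]
  | add z z' h h' =>
    simp only [map_add] at h h' ⊢
    rw [add_add_add_comm, h, h', add_add_add_comm]
  | tmul x v =>
    simp [barD₁, barD₃, diagAct, tpowD_permMap, SModule.act_sgn, SModule.act_totD]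

end

/-! ### Compatibility with the internal differentials -/

section
variable {K : Type u} [Field K] {A : ChainComplex (ModuleCat.{u} K) ℤ}

/-- The Koszul sign operator on `A^{⊗n}`. -/
def tpowSgn (A : ChainComplex (ModuleCat.{u} K) ℤ) (n : ℕ) : TPow A n →ₗ[K] TPow A n :=
  PiTensorProduct.map fun _ => sgn A

theorem tpowSgn_tprod {n : ℕ} {p : Fin n → ℤ} {a : Fin n → Tot A} (ha : ∀ i, a i ∈ gr A (p i)) :
    tpowSgn A n (PiTensorProduct.tprod K a) =
      usign K (∏ i, (p i).negOnePow) • PiTensorProduct.tprod K a := by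
  rw [tpowSgn, PiTensorProduct.map_tprod]
  simp_rw [fun i => sgn_of_mem (ha i)]
  rw [MultilinearMap.map_smul_univ, map_prod]

theorem negOnePow_sum {ι : Type} (s : Finset ι) (p : ι → ℤ) :
    (∑ i ∈ s, p i).negOnePow = ∏ i ∈ s, (p i).negOnePow := by
  classical
  induction s using Finset.induction_on with
  | empty => simp
  | insert i s hi h => rw [Finset.sum_insert hi, Finset.prod_insert hi, Int.negOnePow_add, h]

theorem tpowD_consMap {n : ℕ} (x : Tot A) (v : TPow A n) :
    tpowD A (n + 1) (consMap A n (x ⊗ₜ[K] v)) =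
      consMap A n (totD A x ⊗ₜ[K] v) + consMap A n (sgn A x ⊗ₜ[K] tpowD A n v) := by
  suffices h : (tpowD A (n + 1) ∘ₗ consMap A n) ∘ₗ TensorProduct.mk K _ _ x =
      consMap A n ∘ₗ TensorProduct.mk K _ _ (totD A x) +
      (consMap A n ∘ₗ TensorProduct.mk K _ _ (sgn A x)) ∘ₗ tpowD A n from LinearMap.congr_fun h v
  refine PiTensorProduct.ext (MultilinearMap.ext fun a => ?_)
  have h (f : Fin (n + 1) → Tot A →ₗ[K] Tot A) : (fun i => f i ((Fin.cons x a : Fin (n + 1) → Tot A) i)) =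
      Fin.cons (f 0 x) fun i => f i.succ (a i) := by
    funext i
    cases i using Fin.cases <;> simp
  simp only [LinearMap.compMultilinearMap_apply, LinearMap.comp_apply, TensorProduct.mk_apply,
    consMap_tprod, LinearMap.add_apply, tpowD, LinearMap.sum_apply, PiTensorProduct.map_tprod,
    Fin.sum_univ_succ, h, map_sum]
  congr 1
  refine Finset.sum_congr rfl fun j _ => ?_
  simp [Fin.succ_inj]

theorem unshuffle_tpowD {k l n : ℕ} (e : Fin k ⊕ Fin l ≃ Fin n) (v : TPow A n) :
    unshuffle A e (tpowD A n v) =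
      TensorProduct.map (tpowD A k) LinearMap.id (unshuffle A e v) +
      TensorProduct.map (tpowSgn A k) (tpowD A l) (unshuffle A e v) := by
  suffices h : unshuffle A e ∘ₗ tpowD A n = TensorProduct.map (tpowD A k) LinearMap.id ∘ₗ
      unshuffle A e + TensorProduct.map (tpowSgn A k) (tpowD A l) ∘ₗ unshuffle A e from
    LinearMap.congr_fun h v
  refine tpow_ext (A := A) (M := TPow A k ⊗[K] TPow A l) fun p a ha => ?_
  simp only [LinearMap.comp_apply, LinearMap.add_apply]
  rw [unshuffle_tprod e ha, tpowD_tprod ha, map_sum, map_smul, map_smul, TensorProduct.map_tmul,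
    TensorProduct.map_tmul, tpowSgn_tprod fun i => ha _, tpowD_tprod fun i => ha (e (.inl i)),
    tpowD_tprod fun i => ha (e (.inr i)), ← Equiv.sum_comp e, Fintype.sum_sum_type, sum_tmul,
    tmul_sum, Finset.smul_sum, Finset.smul_sum]
  have hu : ∀ j i, Function.update p j (p j - 1) i = p i ∨ i = j := fun j i => by
    by_cases h : i = j <;> simp [h]
  have hmem : ∀ j i, Function.update a j (totD A (a j)) i ∈
      gr A (Function.update p j (p j - 1) i) := fun j i => by
    by_cases h : i = j
    · subst h; simpa using totD_mem (ha i)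
    · simpa [h] using ha i
  have hs : ∀ j, (∏ i, if blockPos i < blockPos (e.symm j) then (p (e i)).negOnePow else 1) *
      splitSign e p = (∏ i, if i < j then (p i).negOnePow else 1) *
        splitSign e (Function.update p j (p j - 1)) := fun j => by
    have h2 := koszulSign_update (r := fun i : Fin n => (i : ℕ))
      (s := fun i => blockPos (e.symm i))
      Fin.val_injective (blockPos_injective.comp e.symm.injective) p j
    simp only [Fin.val_fin_lt] at h2
    rw [splitSign, splitSign, ← h2, ← Equiv.prod_comp e]
    simp
  congr 1
  · refine Finset.sum_congr rfl fun j _ => ?_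
    have h1 : (fun i => Function.update a (e (.inl j)) (totD A (a (e (.inl j)))) (e (.inl i))) =
        Function.update (fun i => a (e (.inl i))) j (totD A (a (e (.inl j)))) := by
      funext i; by_cases h : i = j
      · subst h; simp
      · simp [h]
    have h2 : (fun i => Function.update a (e (.inl j)) (totD A (a (e (.inl j)))) (e (.inr i))) =
        fun i => a (e (.inr i)) := by
      funext i; simp
    rw [map_smul, unshuffle_tprod e (hmem _), smul_smul, ← map_mul, ← hs, h1, h2,
      ← smul_tmul', smul_smul, ← map_mul, mul_comm]
    simp [Fintype.prod_sum_type, blockPos, Nat.not_lt.2 (le_trans j.is_lt.le (Nat.le_add_right _ _))]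
  · refine Finset.sum_congr rfl fun j _ => ?_
    have h1 : (fun i => Function.update a (e (.inr j)) (totD A (a (e (.inr j)))) (e (.inr i))) =
        Function.update (fun i => a (e (.inr i))) j (totD A (a (e (.inr j)))) := by
      funext i; by_cases h : i = j
      · subst h; simp
      · simp [h]
    have h2 : (fun i => Function.update a (e (.inr j)) (totD A (a (e (.inr j)))) (e (.inl i))) =
        fun i => a (e (.inl i)) := by
      funext i; simp
    have h3 : ∀ i : Fin k, (i : ℕ) < k + j := fun i => by omega
    rw [map_smul, unshuffle_tprod e (hmem _), smul_smul, ← map_mul, ← hs, h1, h2, smul_tmul_smul,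
      smul_smul, ← map_mul, ← map_mul, mul_comm]
    simp [Fintype.prod_sum_type, blockPos, h3]

end

section
variable {K : Type u} [Field K] {C : Cooperad K} {P : Operad K} (α : Twisting C P) (A : Algebra P)

theorem cocirc_sgn {m k n : ℕ} (g : Graft m k n) (x : Tot (C.X n)) :
    C.cocirc g (sgn _ x) = TensorProduct.map (sgn _) (sgn _) (C.cocirc g x) := by
  induction x using Tot.induction with
  | hadd x y hx hy => simp only [map_add, hx, hy]
  | h q x hx =>
    rw [sgn_of_mem hx, map_smul]
    have h := C.cocirc_mem g hx
    generalize C.cocirc g x = z at h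
    induction h using Submodule.span_induction with
    | mem z hz =>
      obtain ⟨i, j, x, y, rfl, hx, hy, rfl⟩ := hz
      rw [TensorProduct.map_tmul, sgn_of_mem hx, sgn_of_mem hy, smul_tmul_smul,
        Int.negOnePow_add, map_mul]
    | zero => simp only [map_zero, smul_zero]
    | add z z' _ _ h h' => simp only [map_add, smul_add, h, h']
    | smul c z _ h => rw [map_smul, ← h, smul_comm]

theorem γ_sgn {n : ℕ} (x : Tot (P.X n)) (v : TPow A.X n) :
    A.γ n (sgn _ x) (tpowSgn A.X n v) = sgn _ (A.γ n x v) := by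
  induction x using Tot.induction with
  | hadd x y hx hy => simp only [map_add, LinearMap.add_apply, hx, hy]
  | h q x hx =>
    suffices h : A.γ n (sgn _ x) ∘ₗ tpowSgn A.X n = sgn _ ∘ₗ A.γ n x from LinearMap.congr_fun h v
    refine tpow_ext fun p a ha => ?_
    rw [LinearMap.comp_apply, LinearMap.comp_apply, tpowSgn_tprod ha, sgn_of_mem hx,
      sgn_of_mem (A.γ_mem hx ha), map_smul, map_smul, LinearMap.smul_apply, smul_smul,
      ← map_mul, Int.negOnePow_add, negOnePow_sum, mul_comm]

theorem map_sgn {n : ℕ} (x : Tot (C.X n)) : α.map n (sgn _ x) = - sgn _ (α.map n x) := by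
  induction x using Tot.induction with
  | hadd x y hx hy => simp only [map_add, hx, hy, neg_add]
  | h q x hx =>
    rw [sgn_of_mem hx, sgn_of_mem (α.map_mem hx), map_smul, Int.negOnePow_sub]
    simp [usign]

/-- `(x' ⊗ x'') ⊗ (v ⊗ w) ↦ x' ⊗ (γ(β(x''); v) ⊗ w)`. -/
def evenApply {k : ℕ} (l : ℕ) (β : Tot (C.X k) →ₗ[K] Tot (P.X k)) :
    (Tot (C.X (l + 1)) ⊗[K] Tot (C.X k)) ⊗[K] (TPow A.X k ⊗[K] TPow A.X l)
    →ₗ[K] Tot (C.X (l + 1)) ⊗[K] TPow A.X (l + 1) :=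
  TensorProduct.map LinearMap.id
    (consMap A.X l ∘ₗ TensorProduct.map (TensorProduct.lift (A.γ k ∘ₗ β)) LinearMap.id ∘ₗ
      (TensorProduct.assoc K _ _ _).symm.toLinearMap) ∘ₗ
    (TensorProduct.assoc K _ _ _).toLinearMap

/-- The analogue of `barTerm` for a map of even degree. -/
def evenTerm {k l n : ℕ} (e : Fin k ⊕ Fin l ≃ Fin n) (β : Tot (C.X k) →ₗ[K] Tot (P.X k)) :
    Tot (C.X n) ⊗[K] TPow A.X n →ₗ[K] Tot (C.X (l + 1)) ⊗[K] TPow A.X (l + 1) :=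
  evenApply A l β ∘ₗ TensorProduct.map (C.cocirc (Graft.ofEquiv e)) (unshuffle A.X e)

variable {A} in
theorem evenApply_tmul {k l : ℕ} (β : Tot (C.X k) →ₗ[K] Tot (P.X k)) (x : Tot (C.X (l + 1)))
    (y : Tot (C.X k)) (v : TPow A.X k) (w : TPow A.X l) :
    evenApply A l β ((x ⊗ₜ[K] y) ⊗ₜ[K] (v ⊗ₜ[K] w)) =
    x ⊗ₜ[K] consMap A.X l (A.γ k (β y) v ⊗ₜ[K] w) := by
  simp [evenApply]

theorem evenTerm_add {k l n : ℕ} (e : Fin k ⊕ Fin l ≃ Fin n)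
    (β β' : Tot (C.X k) →ₗ[K] Tot (P.X k)) :
    evenTerm A e (β + β') = evenTerm A e β + evenTerm A e β' := by
  unfold evenTerm
  rw [← LinearMap.add_comp]
  congr 1
  apply TensorProduct.ext_fourfold'
  intro x y v w
  simp only [evenApply_tmul, LinearMap.add_apply, map_add, add_tmul, tmul_add]

theorem evenTerm_zero {k l n : ℕ} (e : Fin k ⊕ Fin l ≃ Fin n) :
    evenTerm (C := C) A e (0 : Tot (C.X k) →ₗ[K] Tot (P.X k)) = 0 := by
  have h : evenApply (C := C) A l (0 : Tot (C.X k) →ₗ[K] Tot (P.X k)) = 0 := by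
    apply TensorProduct.ext_fourfold'
    intro x y v w
    simp [evenApply_tmul]
  rw [evenTerm, h, LinearMap.zero_comp]

theorem cross_pure {k l : ℕ} (Z : Tot (C.X (l + 1)) ⊗[K] Tot (C.X k))
    (U : TPow A.X k ⊗[K] TPow A.X l) :
    barApply α A k l (TensorProduct.map (sgn _) (sgn _) Z ⊗ₜ[K]
      (TensorProduct.map (tpowD A.X k) LinearMap.id U +
        TensorProduct.map (tpowSgn A.X k) (tpowD A.X l) U)) +
    barApply α A k l ((TensorProduct.map (totD _) LinearMap.id Z +
      TensorProduct.map (sgn _) (totD _) Z) ⊗ₜ[K] U) +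
    (barD₁ A (l + 1) (barApply α A k l (Z ⊗ₜ[K] U)) +
      barD₃ A (l + 1) (barApply α A k l (Z ⊗ₜ[K] U))) =
    evenApply A l (totD _ ∘ₗ α.map k + α.map k ∘ₗ totD _) (Z ⊗ₜ[K] U) := by
  induction Z using TensorProduct.induction_on with
  | zero => simp only [map_zero, zero_tmul, add_zero]
  | add Z Z' h h' =>
    simp only [map_add, add_tmul] at h h' ⊢
    rw [← h, ← h']; abel
  | tmul x y =>
    induction U using TensorProduct.induction_on with
    | zero => simp only [map_zero, tmul_zero, add_zero]
    | add U U' h h' =>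
      simp only [map_add, add_tmul, tmul_add] at h h' ⊢
      rw [← h, ← h']; abel
    | tmul v w =>
      simp only [TensorProduct.map_tmul, add_tmul, tmul_add, map_add, barApply_tmul,
        evenApply_tmul, barD₁, barD₃, LinearMap.id_apply, LinearMap.add_apply,
        LinearMap.comp_apply, sgn_sgn, tpowD_consMap, A.γ_d, ← γ_sgn, map_sgn, sgn_totD,
        map_neg, LinearMap.neg_apply, neg_tmul, tmul_neg]
      abel

theorem cross_term {k l n : ℕ} (e : Fin k ⊕ Fin l ≃ Fin n) (z) :
    barTerm α A e (barD₁ A n z + barD₃ A n z) +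
      (barD₁ A (l + 1) (barTerm α A e z) + barD₃ A (l + 1) (barTerm α A e z)) =
    evenTerm A e (totD _ ∘ₗ α.map k + α.map k ∘ₗ totD _) z := by
  induction z using TensorProduct.induction_on with
  | zero => simp only [map_zero, add_zero]
  | add z z' h h' =>
    simp only [map_add] at h h' ⊢
    rw [← h, ← h']; abel
  | tmul x v =>
    simp only [evenTerm, LinearMap.comp_apply, TensorProduct.map_tmul, ← cross_pure]
    simp only [barTerm, barD₁, barD₃, map_add, LinearMap.comp_apply, TensorProduct.map_tmul,
      LinearMap.id_apply, cocirc_sgn, C.cocirc_d, unshuffle_tpowD]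

theorem tpowD_tpowD {n : ℕ} {A : ChainComplex (ModuleCat.{u} K) ℤ} (v : TPow A n) :
    tpowD A n (tpowD A n v) = 0 := by
  induction n with
  | zero => simp [tpowD]
  | succ n ih =>
    suffices h : tpowD A (n + 1) ∘ₗ tpowD A (n + 1) = 0 from LinearMap.congr_fun h v
    refine PiTensorProduct.ext (MultilinearMap.ext fun a => ?_)
    simp only [LinearMap.compMultilinearMap_apply, LinearMap.comp_apply, LinearMap.zero_apply]
    rw [← Fin.cons_self_tail a, ← consMap_tprod, tpowD_consMap, map_add, tpowD_consMap,
      tpowD_consMap, ih, totD_totD, sgn_totD, neg_tmul]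
    simp

theorem barD₁₃_sq (n : ℕ) (z : Tot (C.X n) ⊗[K] TPow A.X n) :
    barD₁ A n (barD₁ A n z + barD₃ A n z) + barD₃ A n (barD₁ A n z + barD₃ A n z) = 0 := by
  induction z using TensorProduct.induction_on with
  | zero => simp only [map_zero, add_zero]
  | add z z' h h' =>
    simp only [map_add] at h h' ⊢
    rw [← add_zero (0 : Tot (C.X n) ⊗[K] TPow A.X n)]
    nth_rw 1 [← h]
    rw [← h']; abel
  | tmul x v =>
    simp only [barD₁, barD₃, map_add, TensorProduct.map_tmul, LinearMap.id_apply, sgn_sgn,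
      tpowD_tpowD, totD_totD, sgn_totD, neg_tmul, tmul_zero, zero_tmul]
    abel

end

/-! ### Signs of iterated splittings -/

/-- The positions in the concatenation of three blocks. -/
def blockPos₃ {k k' l : ℕ} : Fin k ⊕ (Fin k' ⊕ Fin l) → ℕ :=
  Sum.elim (fun i => (i : ℕ)) (fun j => k + blockPos j)

theorem blockPos₃_injective {k k' l : ℕ} :
    Function.Injective (blockPos₃ (k := k) (k' := k') (l := l)) := by
  rintro (i | i) (j | j) h <;> simp only [blockPos₃, Sum.elim_inl, Sum.elim_inr] at h
  · rw [Fin.ext h]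
  · omega
  · omega
  · rw [blockPos_injective (by omega : blockPos i = blockPos j)]

theorem splitSign_inr {k k' l l' n : ℕ} (e : Fin k ⊕ Fin l ≃ Fin n) (f : Fin k' ⊕ Fin l' ≃ Fin l)
    (E : Fin k ⊕ (Fin k' ⊕ Fin l') ≃ Fin n) (h₁ : ∀ y, E (.inl y) = e (.inl y))
    (h₂ : ∀ y, E (.inr y) = e (.inr (f y))) (p : Fin n → ℤ) :
    splitSign e p * splitSign f (fun j => p (e (.inr j))) =
      koszulSign (fun t => (E t : ℕ)) blockPos₃ (fun t => p (E t)) := by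
  have h1 : splitSign f (fun j => p (e (.inr j))) =
      koszulSign (fun t => blockPos (e.symm (E t))) blockPos₃ (fun t => p (E t)) := by
    rw [koszulSign_sum,
      koszulSign_congr (r' := fun i : Fin k => (i : ℕ)) (s' := fun i : Fin k => (i : ℕ)),
      koszulSign_self, one_mul, splitSign, ← koszulSign_equiv f]
    · simp only [h₂]
      exact koszulSign_congr _ (by simp [blockPos]) (by simp [blockPos₃])
    · simp [h₁, blockPos]
    · simp [blockPos₃]
    · intro i j; simp [h₁, h₂, blockPos]; omega
    · intro i j; simp [blockPos₃]; omega
  have h2 : splitSign e p =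
      koszulSign (fun t => (E t : ℕ)) (fun t => blockPos (e.symm (E t))) (fun t => p (E t)) :=
    (koszulSign_equiv E _ _ p).symm
  rw [h1, h2, koszulSign_trans]
  · exact Fin.val_injective.comp E.injective
  · exact blockPos_injective.comp (e.symm.injective.comp E.injective)
  · exact blockPos₃_injective

theorem splitSign_inl {k k' l n : ℕ} (e : Fin (k + k') ⊕ Fin l ≃ Fin n)
    (f : Fin k ⊕ Fin k' ≃ Fin (k + k'))
    (E : Fin k ⊕ (Fin k' ⊕ Fin l) ≃ Fin n) (h₁ : ∀ y, E (.inl y) = e (.inl (f (.inl y))))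
    (h₂ : ∀ y, E (.inr (.inl y)) = e (.inl (f (.inr y)))) (h₃ : ∀ y, E (.inr (.inr y)) = e (.inr y))
    (p : Fin n → ℤ) :
    splitSign e p * splitSign f (fun j => p (e (.inl j))) =
      koszulSign (fun t => (E t : ℕ)) blockPos₃ (fun t => p (E t)) := by
  let F : (Fin k ⊕ Fin k') ⊕ Fin l ≃ Fin n := (Equiv.sumAssoc _ _ _).trans E
  have hF₁ : ∀ y, F (.inl y) = e (.inl (f y)) := by rintro (y | y) <;> simp [F, h₁, h₂]
  have hF₂ : ∀ y, F (.inr y) = e (.inr y) := by simp [F, h₃]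
  have h1 : splitSign f (fun j => p (e (.inl j))) =
      koszulSign (fun t => blockPos (e.symm (F t)))
        (fun t => blockPos₃ (Equiv.sumAssoc _ _ _ t)) (fun t => p (F t)) := by
    rw [koszulSign_sum, mul_comm,
      koszulSign_congr (r' := fun i : Fin l => (i : ℕ)) (s' := fun i : Fin l => (i : ℕ)),
      koszulSign_self, one_mul, splitSign, ← koszulSign_equiv f]
    · simp only [hF₁]
      refine koszulSign_congr _ (by simp [blockPos]) ?_
      rintro (i | i) (j | j) <;> simp [blockPos₃, blockPos]
    · simp [hF₂, blockPos]
    · simp [blockPos₃, blockPos]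
    · intro i j; simp [hF₁, hF₂, blockPos]; omega
    · rintro (i | i) j <;> simp [blockPos₃, blockPos] <;> omega
  have h2 : splitSign e p =
      koszulSign (fun t => (F t : ℕ)) (fun t => blockPos (e.symm (F t))) (fun t => p (F t)) :=
    (koszulSign_equiv F _ _ p).symm
  rw [h1, h2, koszulSign_trans]
  · exact koszulSign_equiv (Equiv.sumAssoc _ _ _) (fun t => (E t : ℕ)) blockPos₃ (fun t => p (E t))
  · exact Fin.val_injective.comp F.injective
  · exact blockPos_injective.comp (e.symm.injective.comp F.injective)
  · exact blockPos₃_injective.comp (Equiv.injective _)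

theorem splitSign_swap {k k' l l' l'' n : ℕ} (e : Fin k ⊕ Fin l ≃ Fin n)
    (f : Fin k' ⊕ Fin l'' ≃ Fin l) (e' : Fin k' ⊕ Fin l' ≃ Fin n) (f' : Fin k ⊕ Fin l'' ≃ Fin l')
    (h₁ : ∀ y, e' (.inl y) = e (.inr (f (.inl y)))) (h₂ : ∀ y, e' (.inr (f' (.inl y))) = e (.inl y))
    (h₃ : ∀ y, e' (.inr (f' (.inr y))) = e (.inr (f (.inr y)))) (p : Fin n → ℤ) :
    splitSign e p * splitSign f (fun j => p (e (.inr j))) =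
      splitSign e' p * splitSign f' (fun j => p (e' (.inr j))) *
        ((∑ y, p (e (.inl y))) * ∑ y, p (e' (.inl y))).negOnePow := by
  let E : Fin k ⊕ (Fin k' ⊕ Fin l'') ≃ Fin n := ((Equiv.refl _).sumCongr f).trans e
  let E' : Fin k' ⊕ (Fin k ⊕ Fin l'') ≃ Fin n := ((Equiv.refl _).sumCongr f').trans e'
  let S : Fin k ⊕ (Fin k' ⊕ Fin l'') ≃ Fin k' ⊕ (Fin k ⊕ Fin l'') :=
    ((Equiv.sumAssoc _ _ _).symm.trans ((Equiv.sumComm _ _).sumCongr (Equiv.refl _))).trans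
      (Equiv.sumAssoc _ _ _)
  have hS : ∀ t, E' (S t) = E t := by rintro (t | t | t) <;> simp [S, E, E', h₁, h₂, h₃]
  rw [splitSign_inr e f E (fun _ => rfl) (fun _ => rfl),
    splitSign_inr e' f' E' (fun _ => rfl) (fun _ => rfl), ← koszulSign_equiv S]
  simp only [hS]
  have h : koszulSign (fun t => blockPos₃ (S t)) blockPos₃ (fun t => p (E t)) =
      ((∑ y, p (e (.inl y))) * ∑ y, p (e' (.inl y))).negOnePow := by
    rw [Finset.sum_mul_sum, negOnePow_sum]
    simp only [negOnePow_sum]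
    unfold koszulSign
    have r1 : ∀ i : Fin k, blockPos₃ (S (.inl i)) = k' + i := fun _ => rfl
    have r2 : ∀ i : Fin k', blockPos₃ (S (.inr (.inl i))) = i := fun _ => rfl
    have r3 : ∀ i : Fin l'', blockPos₃ (S (.inr (.inr i))) = k' + (k + i) := fun _ => rfl
    have s1 : ∀ i : Fin k, blockPos₃ (k' := k') (l := l'') (.inl i) = i := fun _ => rfl
    have s2 : ∀ i : Fin k', blockPos₃ (k := k) (l := l'') (.inr (.inl i)) = k + i := fun _ => rfl
    have s3 : ∀ i : Fin l'', blockPos₃ (k := k) (k' := k') (.inr (.inr i)) = k + (k' + i) :=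
      fun _ => rfl
    simp only [Fintype.prod_sum_type, r1, r2, r3, s1, s2, s3]
    simp (disch := omega) only [if_neg, if_pos, Finset.prod_const_one, one_mul, mul_one]
    rw [Finset.prod_comm]
    simp [E, h₁, mul_comm]
  rw [← h, koszulSign_trans]
  · exact Fin.val_injective.comp E.injective
  · exact blockPos₃_injective.comp S.injective
  · exact blockPos₃_injective

/-! ### Stacked subtrees -/

section
variable {K : Type u} [Field K] {C : Cooperad K} {P : Operad K} (α : Twisting C P) (A : Algebra P)

/-- The second of two successive terms of the bar differential. -/
def tailMap {k l k' l' : ℕ} (e : Fin k' ⊕ Fin l' ≃ Fin (l + 1)) (u : TPow A.X k) (w : TPow A.X l) :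
    (Tot (C.X (l' + 1)) ⊗[K] Tot (C.X k')) ⊗[K] Tot (C.X k) →ₗ[K]
      Tot (C.X (l' + 1)) ⊗[K] TPow A.X (l' + 1) :=
  barApply α A k' l' ∘ₗ TensorProduct.map (TensorProduct.map (sgn _) (sgn _))
    (unshuffle A.X e ∘ₗ consMap A.X l ∘ₗ (TensorProduct.mk K _ _).flip w ∘ₗ
      (A.γ k).flip u ∘ₗ α.map k)

theorem tailMap_tmul {k l k' l' : ℕ} (e : Fin k' ⊕ Fin l' ≃ Fin (l + 1)) (u : TPow A.X k)
    (w : TPow A.X l) (x : Tot (C.X (l' + 1))) (x' : Tot (C.X k')) (y : Tot (C.X k)) :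
    tailMap α A e u w ((x ⊗ₜ[K] x') ⊗ₜ[K] y) =
      barApply α A k' l' ((sgn _ x ⊗ₜ[K] sgn _ x') ⊗ₜ[K]
        unshuffle A.X e (consMap A.X l (A.γ k (α.map k y) u ⊗ₜ[K] w))) := by
  simp [tailMap]

theorem barTerm_barApply {k l k' l' : ℕ} (e : Fin k' ⊕ Fin l' ≃ Fin (l + 1)) (u : TPow A.X k)
    (w : TPow A.X l) (Y : Tot (C.X (l + 1)) ⊗[K] Tot (C.X k)) :
    barTerm α A e (barApply α A k l (Y ⊗ₜ[K] (u ⊗ₜ[K] w))) =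
      tailMap α A e u w (TensorProduct.map (C.cocirc (Graft.ofEquiv e)) LinearMap.id Y) := by
  induction Y using TensorProduct.induction_on with
  | zero => simp only [map_zero, zero_tmul]
  | add Z Z' h h' => simp only [map_add, add_tmul, h, h']
  | tmul x y =>
    simp only [barApply_tmul, barTerm, tailMap, LinearMap.comp_apply, TensorProduct.map_tmul,
      cocirc_sgn, LinearMap.id_apply, LinearMap.flip_apply, TensorProduct.mk_apply]

variable {A} in
theorem barTerm_barTerm {k l k' l' n : ℕ} (e : Fin k ⊕ Fin l ≃ Fin n)
    (e' : Fin k' ⊕ Fin l' ≃ Fin (l + 1)) {p : Fin n → ℤ} {a : Fin n → Tot A.X}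
    (ha : ∀ i, a i ∈ gr A.X (p i)) (x : Tot (C.X n)) :
    barTerm α A e' (barTerm α A e (x ⊗ₜ[K] PiTensorProduct.tprod K a)) =
      usign K (splitSign e p) • tailMap α A e' (PiTensorProduct.tprod K fun i => a (e (.inl i)))
        (PiTensorProduct.tprod K fun i => a (e (.inr i)))
        (TensorProduct.map (C.cocirc (Graft.ofEquiv e')) LinearMap.id
          (C.cocirc (Graft.ofEquiv e) x)) := by
  rw [← barTerm_barApply]
  nth_rw 2 [barTerm]
  rw [LinearMap.comp_apply, TensorProduct.map_tmul, unshuffle_tprod e ha, tmul_smul, map_smul,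
    map_smul]

/-- The map `α ⋆ α`, at one tree. -/
def starTerm {k k' s : ℕ} (f : Fin k ⊕ Fin k' ≃ Fin s) : Tot (C.X s) →ₗ[K] Tot (P.X s) :=
  TensorProduct.lift (P.circ (Graft.ofEquiv f)) ∘ₗ
    TensorProduct.map (α.map _ ∘ₗ sgn (C.X _)) (α.map _) ∘ₗ C.cocirc (Graft.ofEquiv f)

/-- `f` enlarged by a first element in the first block. -/
structure IsTailSeq {k l n : ℕ} (f : Fin k ⊕ Fin l ≃ Fin n)
    (g : Fin (k + 1) ⊕ Fin l ≃ Fin (n + 1)) : Prop where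
  zero : g (.inl 0) = 0
  succ : ∀ y, g (.inl (Fin.succ y)) = (f (.inl y)).succ
  inr : ∀ y, g (.inr y) = (f (.inr y)).succ

/-- `f` enlarged by a first element in the second block. -/
structure IsTailPar {k l n : ℕ} (f : Fin k ⊕ Fin l ≃ Fin n)
    (g : Fin k ⊕ Fin (l + 1) ≃ Fin (n + 1)) : Prop where
  zero : g (.inr 0) = 0
  succ : ∀ y, g (.inr (Fin.succ y)) = (f (.inr y)).succ
  inl : ∀ y, g (.inl y) = (f (.inl y)).succ

theorem IsTailSeq.exists {k l n : ℕ} (f : Fin k ⊕ Fin l ≃ Fin n) : ∃ g, IsTailSeq f g := by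
  refine ⟨((finSuccEquiv k).sumCongr (Equiv.refl _)).trans
    (((Equiv.optionEquivSumPUnit.{0} (Fin k)).sumCongr (Equiv.refl _)).trans
    (((Equiv.sumComm _ _).sumCongr (Equiv.refl _)).trans
    ((Equiv.sumAssoc _ _ _).trans ((Equiv.sumComm _ _).trans ((f.sumCongr (Equiv.refl _)).trans
    ((Equiv.optionEquivSumPUnit _).symm.trans (finSuccEquiv n).symm)))))), ?_, ?_, ?_⟩ <;>
  simp

theorem IsTailPar.exists {k l n : ℕ} (f : Fin k ⊕ Fin l ≃ Fin n) : ∃ g, IsTailPar f g := by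
  obtain ⟨g, hg⟩ := IsTailSeq.exists ((Equiv.sumComm _ _).trans f)
  exact ⟨(Equiv.sumComm _ _).trans g, hg.zero, hg.succ, hg.inr⟩

theorem splitSign_tailSeq {k l n : ℕ} {f : Fin k ⊕ Fin l ≃ Fin n}
    {g : Fin (k + 1) ⊕ Fin l ≃ Fin (n + 1)} (h : IsTailSeq f g) (q : ℤ) (p : Fin n → ℤ) :
    splitSign g (Fin.cons q p) = splitSign f p := by
  have h0 : g.symm 0 = .inl 0 := by rw [Equiv.symm_apply_eq, h.zero]
  have h1 : ∀ i, blockPos (g.symm i.succ) = blockPos (f.symm i) + 1 := fun i => by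
    obtain ⟨i, rfl⟩ := f.surjective i
    rcases i with i | i
    · rw [← h.succ]; simp [blockPos]
    · rw [← h.inr]; simp [blockPos]; omega
  have h2 : blockPos (g.symm 0) = 0 := by rw [h0]; rfl
  unfold splitSign koszulSign
  simp [Fin.prod_univ_succ, h1, h2]

theorem splitSign_tailPar {k l n : ℕ} {f : Fin k ⊕ Fin l ≃ Fin n}
    {g : Fin k ⊕ Fin (l + 1) ≃ Fin (n + 1)} (h : IsTailPar f g) (q : ℤ) (p : Fin n → ℤ) :
    splitSign g (Fin.cons q p) = (q * ∑ y, p (f (.inl y))).negOnePow * splitSign f p := by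
  have h0 : g.symm 0 = .inr 0 := by rw [Equiv.symm_apply_eq, h.zero]
  have h1 : ∀ i, blockPos (g.symm (Fin.succ (f (.inl i)))) = i := fun i => by
    rw [← h.inl]; simp [blockPos]
  have h1' : ∀ i, blockPos (g.symm (Fin.succ (f (.inr i)))) = k + i + 1 := fun i => by
    rw [← h.succ]; simp [blockPos]; omega
  have h2 : blockPos (g.symm 0) = k := by rw [h0]; rfl
  have h3 : ∀ i j, blockPos (g.symm (Fin.succ i)) < blockPos (g.symm (Fin.succ j)) ↔
      blockPos (f.symm i) < blockPos (f.symm j) := fun i j => by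
    obtain ⟨i, rfl⟩ := f.surjective i
    obtain ⟨j, rfl⟩ := f.surjective j
    rcases i with i | i <;> rcases j with j | j <;>
      simp only [h1, h1', Equiv.symm_apply_apply] <;>
      simp only [blockPos, Sum.elim_inl, Sum.elim_inr] <;> omega
  unfold splitSign koszulSign
  simp only [Fin.prod_univ_succ, h3]
  have h4 : (∏ i : Fin n, if blockPos (g.symm i.succ) < k then (q * p i).negOnePow else 1) =
      (q * ∑ y, p (f (.inl y))).negOnePow := by
    rw [← f.prod_comp, Fintype.prod_sum_type, Finset.mul_sum, negOnePow_sum]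
    simp [h1, h1']
    exact Finset.prod_eq_one fun i _ => if_neg (by omega)
  simp [h2, ← h4]

theorem unshuffle_tailSeq {k l n : ℕ} {f : Fin k ⊕ Fin l ≃ Fin n}
    {g : Fin (k + 1) ⊕ Fin l ≃ Fin (n + 1)} (h : IsTailSeq f g)
    {A : ChainComplex (ModuleCat.{u} K) ℤ} {p : Fin n → ℤ} {w : Fin n → Tot A}
    (hw : ∀ i, w i ∈ gr A (p i)) (b : Tot A) :
    unshuffle A g (consMap A n (b ⊗ₜ[K] PiTensorProduct.tprod K w)) = usign K (splitSign f p) •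
      (consMap A k (b ⊗ₜ[K] PiTensorProduct.tprod K fun i => w (f (.inl i))) ⊗ₜ[K]
        PiTensorProduct.tprod K fun i => w (f (.inr i))) := by
  induction b using Tot.induction with
  | hadd x y hx hy => simp only [add_tmul, map_add, smul_add, hx, hy]
  | h q b hb =>
    rw [consMap_tprod, unshuffle_tprod (p := Fin.cons q p), splitSign_tailSeq h, consMap_tprod]
    · congr 3
      · funext i
        cases i using Fin.cases <;> simp [h.zero, h.succ]
      · funext i
        simp [h.inr]
    · intro i
      cases i using Fin.cases with
      | zero => exact hb
      | succ i => exact hw i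

theorem unshuffle_tailPar {k l n : ℕ} {f : Fin k ⊕ Fin l ≃ Fin n}
    {g : Fin k ⊕ Fin (l + 1) ≃ Fin (n + 1)} (h : IsTailPar f g)
    {A : ChainComplex (ModuleCat.{u} K) ℤ} {p : Fin n → ℤ} {w : Fin n → Tot A}
    (hw : ∀ i, w i ∈ gr A (p i)) {q : ℤ} {b : Tot A} (hb : b ∈ gr A q) :
    unshuffle A g (consMap A n (b ⊗ₜ[K] PiTensorProduct.tprod K w)) =
      usign K ((q * ∑ y, p (f (.inl y))).negOnePow * splitSign f p) •
      ((PiTensorProduct.tprod K fun i => w (f (.inl i))) ⊗ₜ[K]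
        consMap A l (b ⊗ₜ[K] PiTensorProduct.tprod K fun i => w (f (.inr i)))) := by
  rw [consMap_tprod, unshuffle_tprod (p := Fin.cons q p), splitSign_tailPar h, consMap_tprod]
  · congr 3
    · funext i
      simp [h.inl]
    · funext i
      cases i using Fin.cases <;> simp [h.zero, h.succ]
  · intro i
    cases i using Fin.cases with
    | zero => exact hb
    | succ i => exact hw i

/-- Two stacked subtrees. -/
theorem barTerm_seq {k k' l l' n : ℕ} {e : Fin k ⊕ Fin l ≃ Fin n} {f : Fin k' ⊕ Fin l' ≃ Fin l}
    {g : Fin (k' + 1) ⊕ Fin l' ≃ Fin (l + 1)} (hg : IsTailSeq f g)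
    {e' : Fin (k + k') ⊕ Fin l' ≃ Fin n} {f' : Fin k ⊕ Fin k' ≃ Fin (k + k')}
    (h₁ : ∀ y, e (.inl y) = e' (.inl (f' (.inl y))))
    (h₂ : ∀ y, e (.inr (f (.inl y))) = e' (.inl (f' (.inr y))))
    (h₃ : ∀ y, e (.inr (f (.inr y))) = e' (.inr y)) (z) :
    barTerm α A g (barTerm α A e z) = evenTerm A e' (starTerm α f') z := by
  have c₁ : ∀ y, e'.symm (e (.inl y)) = .inl (f' (.inl y)) := by simp [h₁]
  have c₂ : ∀ y, e'.symm (e (.inr (f (.inl y)))) = .inl (f' (.inr y)) := by simp [h₂]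
  have c₃ : ∀ y, e'.symm (e (.inr (f (.inr y)))) = .inr y := by simp [h₃]
  have hS : Graft.Sequential (Graft.ofEquiv g) (Graft.ofEquiv e) (Graft.ofEquiv e')
      (Graft.ofEquiv f') := by
    refine ⟨rfl, hg.zero.symm, fun j => ?_, fun t => ?_, fun w => (h₁ w).symm⟩
    · obtain ⟨j, rfl⟩ := e.surjective j
      rcases j with j | j
      · have : g.symm 0 = .inl 0 := by rw [Equiv.symm_apply_eq, hg.zero]
        simp [Graft.ofEquiv, c₁, this]
      · obtain ⟨j, rfl⟩ := f.surjective j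
        rcases j with j | j
        · have : g.symm (f (.inl j)).succ = .inl j.succ := by rw [Equiv.symm_apply_eq, hg.succ]
          simp [Graft.ofEquiv, c₂, this]
        · have : g.symm (f (.inr j)).succ = .inr j := by rw [Equiv.symm_apply_eq, hg.inr]
          simp [Graft.ofEquiv, c₃, this]
    · obtain ⟨t, rfl⟩ := f'.surjective t
      rcases t with t | t <;> simp [Graft.ofEquiv, ← h₁, ← h₂, hg.zero, hg.succ]
  suffices h : ∀ x, (barTerm α A g ∘ₗ barTerm α A e) ∘ₗ TensorProduct.mk K _ _ x =
      evenTerm A e' (starTerm α f') ∘ₗ TensorProduct.mk K _ _ x by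
    induction z using TensorProduct.induction_on with
    | zero => simp only [map_zero]
    | add z z' h h' => simp only [map_add, h, h']
    | tmul x v => exact LinearMap.congr_fun (h x) v
  intro x
  refine tpow_ext fun p a ha => ?_
  simp only [LinearMap.comp_apply, TensorProduct.mk_apply]
  let E : Fin k ⊕ (Fin k' ⊕ Fin l') ≃ Fin n := ((Equiv.refl _).sumCongr f).trans e
  have hs := (splitSign_inr e f E (fun _ => rfl) (fun _ => rfl) p).trans
    (splitSign_inl e' f' E h₁ h₂ h₃ p).symm
  rw [barTerm_barTerm α e g ha, evenTerm, LinearMap.comp_apply, TensorProduct.map_tmul,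
    unshuffle_tprod e' ha, tmul_smul, map_smul]
  let Ψ : Tot (C.X (k' + 1)) ⊗[K] Tot (C.X k) →ₗ[K] TPow A.X (l' + 1) :=
    consMap A.X l' ∘ₗ (TensorProduct.mk K _ _).flip
      (PiTensorProduct.tprod K fun i => a (e' (.inr i))) ∘ₗ
    TensorProduct.lift ((A.γ (k' + 1)).compl₁₂ (α.map _ ∘ₗ sgn _) (consMap A.X k' ∘ₗ
      (TensorProduct.mk K _ _).flip (PiTensorProduct.tprod K fun i => a (e' (.inl (f' (.inr i))))) ∘ₗ
      (A.γ k).flip (PiTensorProduct.tprod K fun i => a (e (.inl i))) ∘ₗ α.map k))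
  have hL : ∀ Z, tailMap α A g (PiTensorProduct.tprod K fun i => a (e (.inl i)))
      (PiTensorProduct.tprod K fun i => a (e (.inr i))) Z =
      usign K (splitSign f (fun j => p (e (.inr j)))) •
        TensorProduct.map LinearMap.id Ψ (TensorProduct.assoc K _ _ _ Z) := by
    intro Z
    suffices h : tailMap α A g (PiTensorProduct.tprod K fun i => a (e (.inl i)))
      (PiTensorProduct.tprod K fun i => a (e (.inr i))) =
      usign K (splitSign f (fun j => p (e (.inr j)))) •
        (TensorProduct.map LinearMap.id Ψ ∘ₗ (TensorProduct.assoc K _ _ _).toLinearMap) from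
      LinearMap.congr_fun h Z
    refine TensorProduct.ext_threefold fun x₁ x₂ y => ?_
    rw [tailMap_tmul, unshuffle_tailSeq hg fun i => ha _, tmul_smul, map_smul, barApply_tmul,
      sgn_sgn]
    simp [Ψ, h₂, h₃]
  have hR : ∀ X : Tot (C.X (l' + 1)) ⊗[K] Tot (C.X (k + k')),
      evenApply A l' (starTerm α f') (X ⊗ₜ[K] ((PiTensorProduct.tprod K fun i => a (e' (.inl i)))
        ⊗ₜ[K] PiTensorProduct.tprod K fun i => a (e' (.inr i)))) =
      usign K (splitSign f' (fun j => p (e' (.inl j)))) •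
        TensorProduct.map LinearMap.id Ψ
          (TensorProduct.map LinearMap.id (C.cocirc (Graft.ofEquiv f')) X) := by
    intro X
    induction X using TensorProduct.induction_on with
    | zero => simp only [map_zero, zero_tmul, smul_zero]
    | add Z Z' h h' => simp only [map_add, add_tmul, smul_add, h, h']
    | tmul x₁ s =>
      rw [evenApply_tmul, starTerm, LinearMap.comp_apply, LinearMap.comp_apply,
        TensorProduct.map_tmul, TensorProduct.map_tmul, ← tmul_smul]
      congr 1
      generalize C.cocirc (Graft.ofEquiv f') s = Y
      induction Y using TensorProduct.induction_on with
      | zero => simp only [map_zero, LinearMap.zero_apply, zero_tmul, smul_zero]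
      | add Z Z' h h' => simp only [map_add, LinearMap.add_apply, add_tmul, smul_add, h, h']
      | tmul x₂ y =>
        simp only [TensorProduct.map_tmul, TensorProduct.lift.tmul]
        rw [A.γ_circ, unshuffle_tprod f' fun i => ha _]
        simp [Ψ, h₁, ← smul_tmul', map_smul]
  rw [hL, hR, smul_smul, smul_smul, ← map_mul, ← map_mul, hs, C.cocirc_sequential hS]

end

/-! ### Parallel subtrees -/

theorem permSign_swap {n : ℕ} (q q' : ℤ) (p : Fin n → ℤ) :
    permSign (Equiv.swap 0 1) (Fin.cons q (Fin.cons q' p : Fin (n + 1) → ℤ) : Fin (n + 2) → ℤ) =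
      (q * q').negOnePow := by
  have h1 : (Fin.succ 0 : Fin (n + 2)) = 1 := rfl
  have h2 : ∀ i : Fin n, Equiv.swap (0 : Fin (n + 2)) 1 i.succ.succ = i.succ.succ := fun i =>
    Equiv.swap_apply_of_ne_of_ne (Fin.succ_ne_zero _) (by rw [← h1]; simp [Fin.ext_iff])
  unfold permSign koszulSign
  simp [Fin.prod_univ_succ, h1, h2]
  refine Finset.prod_eq_one fun i _ => Finset.prod_eq_one fun j _ => if_neg ?_
  exact fun h => lt_asymm h.1 h.2

section
variable {K : Type u} [Field K] {A : ChainComplex (ModuleCat.{u} K) ℤ}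

theorem permMap_swap {n : ℕ} {q q' : ℤ} {b c : Tot A} (hb : b ∈ gr A q) (hc : c ∈ gr A q')
    {p : Fin n → ℤ} {w : Fin n → Tot A} (hw : ∀ i, w i ∈ gr A (p i)) :
    permMap A (Equiv.swap 0 1) (consMap A (n + 1) (b ⊗ₜ[K]
      consMap A n (c ⊗ₜ[K] PiTensorProduct.tprod K w))) = usign K (q * q').negOnePow •
    consMap A (n + 1) (c ⊗ₜ[K] consMap A n (b ⊗ₜ[K] PiTensorProduct.tprod K w)) := by
  simp only [consMap_tprod]
  rw [permMap_tprod (p := Fin.cons q (Fin.cons q' p)), permSign_swap]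
  · congr 2
    funext i
    have h1 : (Fin.succ 0 : Fin (n + 2)) = 1 := rfl
    cases i using Fin.cases with
    | zero => simp
    | succ i =>
      cases i using Fin.cases with
      | zero => simp
      | succ i =>
        rw [Equiv.symm_swap, Equiv.swap_apply_of_ne_of_ne (Fin.succ_ne_zero _)
          (by rw [← h1]; simp [Fin.ext_iff])]
        simp
  · intro i
    cases i using Fin.cases with
    | zero => exact hb
    | succ i =>
      cases i using Fin.cases with
      | zero => exact hc
      | succ i => exact hw i

theorem swap_tmul {B : ChainComplex (ModuleCat.{u} K) ℤ} {p q : ℤ} {x : Tot A} {y : Tot B}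
    (hx : x ∈ gr A p) (hy : y ∈ gr B q) :
    swap A B (x ⊗ₜ[K] y) = usign K (p * q).negOnePow • (y ⊗ₜ[K] x) := by
  obtain ⟨x, rfl⟩ := hx
  obtain ⟨y, rfl⟩ := hy
  simp [swap]

end

/-- The same tree, with the inputs of the root renumbered. -/
def Graft.relabel {m k n : ℕ} (σ : Equiv.Perm (Fin m)) (g : Graft m k n) : Graft m k n where
  slot := σ g.slot
  root j := σ (g.root j)
  top := g.top
  top_injective := g.top_injective
  root_eq_slot j := by rw [σ.injective.eq_iff, g.root_eq_slot]
  root_bij x hx := by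
    simpa [Equiv.eq_symm_apply] using g.root_bij (σ.symm x) (by rwa [ne_eq, Equiv.symm_apply_eq])

theorem Graft.rel_relabel {m k n : ℕ} (σ : Equiv.Perm (Fin m)) (g : Graft m k n) :
    Graft.Rel σ 1 1 g (g.relabel σ) :=
  ⟨rfl, fun _ => rfl, fun _ => rfl⟩

section
variable {K : Type u} [Field K] {C : Cooperad K} {P : Operad K} (α : Twisting C P) (A : Algebra P)

theorem parallel_ofEquiv {k k' l l' l'' n : ℕ} {e : Fin k ⊕ Fin l ≃ Fin n}
    {f : Fin k' ⊕ Fin l'' ≃ Fin l} {e' : Fin k' ⊕ Fin l' ≃ Fin n} {f' : Fin k ⊕ Fin l'' ≃ Fin l'}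
    {g : Fin k' ⊕ Fin (l'' + 1) ≃ Fin (l + 1)} {g' : Fin k ⊕ Fin (l'' + 1) ≃ Fin (l' + 1)}
    (hg : IsTailPar f g) (hg' : IsTailPar f' g')
    (h₁ : ∀ y, e' (.inl y) = e (.inr (f (.inl y)))) (h₂ : ∀ y, e' (.inr (f' (.inl y))) = e (.inl y))
    (h₃ : ∀ y, e' (.inr (f' (.inr y))) = e (.inr (f (.inr y)))) :
    Graft.Parallel (Graft.ofEquiv g) (Graft.ofEquiv e)
      ((Graft.ofEquiv g').relabel (Equiv.swap 0 1)) (Graft.ofEquiv e') := by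
  have c₁ : ∀ y, e'.symm (e (.inr (f (.inl y)))) = .inl y := by simp [← h₁]
  have c₂ : ∀ y, e'.symm (e (.inl y)) = .inr (f' (.inl y)) := by simp [← h₂]
  have c₃ : ∀ y, e'.symm (e (.inr (f (.inr y)))) = .inr (f' (.inr y)) := by simp [← h₃]
  have d₁ : g.symm 0 = .inr 0 := by rw [Equiv.symm_apply_eq, hg.zero]
  have d₂ : ∀ y, g.symm (f (.inl y)).succ = .inl y := by simp [← hg.inl]
  have d₃ : ∀ y, g.symm (f (.inr y)).succ = .inr y.succ := by simp [← hg.succ]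
  have d₁' : g'.symm 0 = .inr 0 := by rw [Equiv.symm_apply_eq, hg'.zero]
  have d₂' : ∀ y, g'.symm (f' (.inl y)).succ = .inl y := by simp [← hg'.inl]
  have d₃' : ∀ y, g'.symm (f' (.inr y)).succ = .inr y.succ := by simp [← hg'.succ]
  have one : (1 : Fin (l'' + 1 + 1)) = Fin.succ 0 := rfl
  refine ⟨?_, ?_, ?_, fun j => ?_, fun w => ?_, fun y => ?_⟩
  · simp [Graft.ofEquiv, Graft.relabel]
  · simp [Graft.ofEquiv, Graft.relabel, d₁]
  · simp [Graft.ofEquiv, Graft.relabel, d₁']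
  · obtain ⟨j, rfl⟩ := e.surjective j
    rcases j with j | j
    · simp [Graft.ofEquiv, Graft.relabel, c₂, d₁, d₂']
    · obtain ⟨j, rfl⟩ := f.surjective j
      rcases j with j | j
      · simp [Graft.ofEquiv, Graft.relabel, c₁, d₁', d₂]
      · simp only [Graft.ofEquiv, Graft.relabel, c₃, d₃', d₃, Equiv.symm_apply_apply, Sum.elim_inr]
        rw [Equiv.swap_apply_of_ne_of_ne (Fin.succ_ne_zero _) (by rw [one]; simp [Fin.ext_iff])]
  · simp [Graft.ofEquiv, Graft.relabel, hg'.inl, c₂]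
  · simp [Graft.ofEquiv, h₁, hg.inl]

end

theorem parallel_sign (i j U U' : ℤ) (s s' : ℤˣ) (h : s = s' * (U * U').negOnePow) :
    s' * ((i * j).negOnePow * (((i - 1 + U') * U).negOnePow * (j.negOnePow *
      ((j - 1 + U) * (i - 1 + U')).negOnePow))) =
      -(s * (((j - 1 + U) * U').negOnePow * i.negOnePow)) := by
  have h1 : ((i * j).negOnePow * (((i - 1 + U') * U).negOnePow * (j.negOnePow *
      ((j - 1 + U) * (i - 1 + U')).negOnePow))) =
      Int.negOnePow 1 * ((U * U').negOnePow * (((j - 1 + U) * U').negOnePow * i.negOnePow)) := by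
    simp only [← Int.negOnePow_add]
    rw [Int.negOnePow_eq_iff]
    exact ⟨i * j + i * U - U - i, by ring⟩
  rw [h1, h]
  simp [mul_assoc]

section
variable {K : Type u} [Field K] {C : Cooperad K} {P : Operad K} (α : Twisting C P) (A : Algebra P)

theorem usign_neg (s : ℤˣ) : usign K (-s) = - usign K s := by
  simp [usign]

/-- Two subtrees side by side. -/
theorem barTerm_par {k k' l l' l'' n : ℕ} {e : Fin k ⊕ Fin l ≃ Fin n}
    {f : Fin k' ⊕ Fin l'' ≃ Fin l} {e' : Fin k' ⊕ Fin l' ≃ Fin n} {f' : Fin k ⊕ Fin l'' ≃ Fin l'}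
    {g : Fin k' ⊕ Fin (l'' + 1) ≃ Fin (l + 1)} {g' : Fin k ⊕ Fin (l'' + 1) ≃ Fin (l' + 1)}
    (hg : IsTailPar f g) (hg' : IsTailPar f' g')
    (h₁ : ∀ y, e' (.inl y) = e (.inr (f (.inl y)))) (h₂ : ∀ y, e' (.inr (f' (.inl y))) = e (.inl y))
    (h₃ : ∀ y, e' (.inr (f' (.inr y))) = e (.inr (f (.inr y)))) (z) :
    diagAct C.toSModule A.X (Equiv.swap 0 1) (barTerm α A g' (barTerm α A e' z)) =
      - barTerm α A g (barTerm α A e z) := by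
  have hP := parallel_ofEquiv hg hg' h₁ h₂ h₃
  set σ : Equiv.Perm (Fin (l'' + 1 + 1)) := Equiv.swap 0 1 with hσ
  have hσσ : ∀ x, C.act σ (C.act σ x) = x := fun x => by
    have : C.act σ ∘ₗ C.act σ = C.act (σ * σ) := by
      rw [SModule.act, SModule.act, map_mul, ← totMap_comp]; rfl
    rw [← LinearMap.comp_apply, this, hσ, Equiv.swap_mul_self, SModule.act_one]; rfl
  suffices h : ∀ x, (diagAct C.toSModule A.X σ ∘ₗ barTerm α A g' ∘ₗ barTerm α A e') ∘ₗ
      TensorProduct.mk K _ _ x = - (barTerm α A g ∘ₗ barTerm α A e) ∘ₗ TensorProduct.mk K _ _ x by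
    induction z using TensorProduct.induction_on with
    | zero => simp only [map_zero, neg_zero]
    | add z z' h h' => simp only [map_add, h, h', neg_add]
    | tmul x v => exact LinearMap.congr_fun (h x) v
  intro x
  refine tpow_ext fun p a ha => ?_
  simp only [LinearMap.comp_apply, LinearMap.neg_apply, TensorProduct.mk_apply]
  rw [barTerm_barTerm α e g ha, barTerm_barTerm α e' g' ha, map_smul]
  have hZ := C.cocirc_parallel hP x
  have hrel : C.cocirc ((Graft.ofEquiv g').relabel σ) =
      TensorProduct.map (C.act σ) LinearMap.id ∘ₗ C.cocirc (Graft.ofEquiv g') := by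
    refine LinearMap.ext fun y => ?_
    have := C.cocirc_act (Graft.rel_relabel σ (Graft.ofEquiv g')) y
    rw [SModule.act_one, SModule.act_one] at this
    exact this
  let Θ := diagAct C.toSModule A.X σ ∘ₗ tailMap α A g' (PiTensorProduct.tprod K fun i => a (e' (.inl i)))
      (PiTensorProduct.tprod K fun i => a (e' (.inr i))) ∘ₗ
      TensorProduct.map (TensorProduct.map (C.act σ) LinearMap.id) LinearMap.id ∘ₗ
      (TensorProduct.assoc K _ _ _).symm.toLinearMap
  have hΘ : diagAct C.toSModule A.X σ (tailMap α A g'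
      (PiTensorProduct.tprod K fun i => a (e' (.inl i)))
      (PiTensorProduct.tprod K fun i => a (e' (.inr i)))
        (TensorProduct.map (C.cocirc (Graft.ofEquiv g')) LinearMap.id
          (C.cocirc (Graft.ofEquiv e') x))) =
      Θ (TensorProduct.map LinearMap.id (swap _ _) (TensorProduct.assoc K _ _ _
        (TensorProduct.map (C.cocirc (Graft.ofEquiv g)) LinearMap.id
          (C.cocirc (Graft.ofEquiv e) x)))) := by
    rw [hZ, hrel]
    simp only [Θ, LinearMap.comp_apply, LinearEquiv.coe_coe, LinearEquiv.symm_apply_apply]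
    congr 2
    generalize C.cocirc (Graft.ofEquiv e') x = Y
    induction Y using TensorProduct.induction_on with
    | zero => simp only [map_zero]
    | add z z' h h' => simp only [map_add, ← h, ← h']
    | tmul x y =>
      simp only [TensorProduct.map_tmul, LinearMap.comp_apply]
      generalize C.cocirc (Graft.ofEquiv g') x = Y
      induction Y using TensorProduct.induction_on with
      | zero => simp only [map_zero, zero_tmul]
      | add z z' h h' => simp only [map_add, add_tmul, ← h, ← h']
      | tmul x y => simp only [TensorProduct.map_tmul, hσσ, LinearMap.id_apply]
  rw [hΘ]
  generalize TensorProduct.map (C.cocirc (Graft.ofEquiv g)) LinearMap.id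
          (C.cocirc (Graft.ofEquiv e) x) = Z
  suffices h : usign K (splitSign e' p) • (Θ ∘ₗ TensorProduct.map LinearMap.id (swap _ _) ∘ₗ
      (TensorProduct.assoc K _ _ _).toLinearMap) = -(usign K (splitSign e p) •
      tailMap α A g (PiTensorProduct.tprod K fun i => a (e (.inl i)))
      (PiTensorProduct.tprod K fun i => a (e (.inr i)))) from LinearMap.congr_fun h Z
  refine TensorProduct.ext_threefold fun x₁ x₂ y => ?_
  simp only [LinearMap.smul_apply, LinearMap.neg_apply, LinearMap.comp_apply, LinearEquiv.coe_coe,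
    TensorProduct.assoc_tmul, TensorProduct.map_tmul, LinearMap.id_apply]
  induction x₂ using Tot.induction with
  | hadd x x' hx hx' => simp only [add_tmul, tmul_add, map_add, smul_add, neg_add, hx, hx']
  | h i x₂ hx₂ =>
  induction y using Tot.induction with
  | hadd x x' hx hx' => simp only [tmul_add, map_add, smul_add, neg_add, hx, hx']
  | h j y hy =>
  have hb := A.γ_mem (α.map_mem hx₂) fun t => ha (e' (.inl t))
  have hc := A.γ_mem (α.map_mem hy) fun t => ha (e (.inl t))
  rw [tailMap_tmul, swap_tmul hx₂ hy, unshuffle_tailPar hg (fun t => ha (e (.inr t))) hc,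
    tmul_smul, tmul_smul, map_smul, map_smul, barApply_tmul, sgn_sgn]
  simp only [Θ, LinearMap.comp_apply, LinearEquiv.coe_coe, TensorProduct.assoc_symm_tmul,
    TensorProduct.map_tmul, LinearMap.id_apply]
  rw [tailMap_tmul, unshuffle_tailPar hg' (fun t => ha (e' (.inr t))) hb,
    tmul_smul, map_smul, map_smul, barApply_tmul, sgn_sgn, diagAct, TensorProduct.map_tmul, hσσ]
  simp only [h₂, h₃]
  rw [sgn_of_mem hy, sgn_of_mem hx₂]
  simp only [map_smul, LinearMap.smul_apply, ← smul_tmul', tmul_smul]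
  rw [permMap_swap hc hb fun t => ha (e (.inr (f (.inr t))))]
  have hs := parallel_sign i j (∑ y, p (e (.inl y))) (∑ y, p (e' (.inl y))) _ _
    (splitSign_swap e f e' f' h₁ h₂ h₃ p)
  simp only [h₁, smul_smul, tmul_smul, ← map_mul] at hs ⊢
  rw [← neg_smul, ← usign_neg]
  congr 2
  calc _ = _ := by ac_rfl
    _ = _ := hs
    _ = _ := congrArg Neg.neg (by ac_rfl)

end

/-! ### The square of the bar differential -/

section
variable {K : Type u} [Field K] {C : Cooperad K} {P : Operad K} (α : Twisting C P) (A : Algebra P)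

theorem splitEquiv_inr_iff {n : ℕ} (T : Finset (Fin n)) (i : Fin n) :
    (∃ y, splitEquiv T (.inr y) = i) ↔ i ∉ T := by
  rw [← splitEquiv_inl_iff]
  obtain ⟨i, rfl⟩ := (splitEquiv T).surjective i
  rcases i with i | i <;> simp

theorem mk_barTerm_barTerm_congr {n k l k₁ l₁ a b a₁ b₁ : ℕ} {e : Fin k ⊕ Fin l ≃ Fin n}
    {e₁ : Fin k₁ ⊕ Fin l₁ ≃ Fin n} {g : Fin a ⊕ Fin b ≃ Fin (l + 1)}
    {g₁ : Fin a₁ ⊕ Fin b₁ ≃ Fin (l₁ + 1)}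
    (he : ∀ i, (∃ y, e (.inl y) = i) ↔ ∃ y, e₁ (.inl y) = i)
    (hg : (∃ y, g (.inl y) = 0) ↔ ∃ y, g₁ (.inl y) = 0)
    (h : ∀ i, (∃ j, e (.inr j) = i ∧ ∃ y, g (.inl y) = j.succ) ↔
      ∃ j, e₁ (.inr j) = i ∧ ∃ y, g₁ (.inl y) = j.succ) (z) :
    Comp.mk C.toSModule A.X (b + 1) (barTerm α A g (barTerm α A e z)) =
      Comp.mk C.toSModule A.X (b₁ + 1) (barTerm α A g₁ (barTerm α A e₁ z)) := by
  obtain ⟨rfl, rfl⟩ := exists_perms e e₁ 1 he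
  obtain ⟨τ, υ, hl, hr⟩ := exists_perms' e e₁ 1 he
  have h1 := barTerm_diagAct α A hl hr z
  rw [diagAct_one, LinearMap.id_apply] at h1
  rw [h1]
  refine (mk_barTerm_diagAct α A g g₁ (permCons υ) (fun i => ?_) _).symm
  cases i using Fin.cases with
  | zero => rw [permCons_zero]; exact hg
  | succ j =>
    rw [permCons_succ]
    have h2 := h (e (.inr j))
    simp only [EmbeddingLike.apply_eq_iff_eq, Sum.inr.injEq, exists_eq_left] at h2
    have h3 : e (.inr j) = e₁ (.inr (υ j)) := hr j
    simpa [h3] using h2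

/-- The elements of the second block which are sent to `W`. -/
def pull {k l n : ℕ} (e : Fin k ⊕ Fin l ≃ Fin n) (W : Finset (Fin n)) : Finset (Fin l) :=
  Finset.univ.filter fun j => e (.inr j) ∈ W

/-- The term of the square of the bar differential contracting first the leaves in `T`, and then the
resulting leaf together with the leaves in `W`. -/
def seqVal {n : ℕ} (z : Tot (C.X n) ⊗[K] TPow A.X n) (T W : Finset (Fin n)) :
    Comp C.toSModule A.X :=
  Comp.mk C.toSModule A.X _ (barTerm α A (IsTailSeq.exists (splitEquiv (pull (splitEquiv T) W))).choose
    (barTerm α A (splitEquiv T) z))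

/-- The term of the square of the bar differential contracting first the leaves in `T`, and then the
leaves in `W`. -/
def parVal {n : ℕ} (z : Tot (C.X n) ⊗[K] TPow A.X n) (T W : Finset (Fin n)) :
    Comp C.toSModule A.X :=
  Comp.mk C.toSModule A.X _ (barTerm α A (IsTailPar.exists (splitEquiv (pull (splitEquiv T) W))).choose
    (barTerm α A (splitEquiv T) z))

theorem seqVal_eq {n k l a b : ℕ} {e : Fin k ⊕ Fin l ≃ Fin n} {g : Fin a ⊕ Fin b ≃ Fin (l + 1)}
    {T W : Finset (Fin n)} (hd : Disjoint T W) (he : ∀ i, (∃ y, e (.inl y) = i) ↔ i ∈ T)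
    (hg : ∃ y, g (.inl y) = 0)
    (h : ∀ i, (∃ j, e (.inr j) = i ∧ ∃ y, g (.inl y) = j.succ) ↔ i ∈ W) (z) :
    Comp.mk C.toSModule A.X (b + 1) (barTerm α A g (barTerm α A e z)) = seqVal α A z T W := by
  have hs := (IsTailSeq.exists (splitEquiv (pull (splitEquiv T) W))).choose_spec
  refine mk_barTerm_barTerm_congr α A (fun i => ?_) ?_ (fun i => ?_) z
  · rw [he, splitEquiv_inl_iff]
  · exact iff_of_true hg ⟨0, hs.zero⟩
  · rw [h]
    have h1 : ∀ j, (∃ y, (IsTailSeq.exists (splitEquiv (pull (splitEquiv T) W))).choose (.inl y) =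
        Fin.succ j) ↔ splitEquiv T (.inr j) ∈ W := fun j => by
      rw [Fin.exists_fin_succ]
      simp only [hs.zero, hs.succ, Fin.succ_inj, splitEquiv_inl_iff]
      simp [pull, (Fin.succ_ne_zero _).symm]
    simp only [h1]
    constructor
    · intro hi
      obtain ⟨j, hj⟩ := (splitEquiv_inr_iff T i).2 (Finset.disjoint_right.1 hd hi)
      exact ⟨j, hj, hj ▸ hi⟩
    · rintro ⟨j, rfl, hj⟩; exact hj

theorem parVal_eq {n k l a b : ℕ} {e : Fin k ⊕ Fin l ≃ Fin n} {g : Fin a ⊕ Fin b ≃ Fin (l + 1)}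
    {T W : Finset (Fin n)} (hd : Disjoint T W) (he : ∀ i, (∃ y, e (.inl y) = i) ↔ i ∈ T)
    (hg : ¬ ∃ y, g (.inl y) = 0)
    (h : ∀ i, (∃ j, e (.inr j) = i ∧ ∃ y, g (.inl y) = j.succ) ↔ i ∈ W) (z) :
    Comp.mk C.toSModule A.X (b + 1) (barTerm α A g (barTerm α A e z)) = parVal α A z T W := by
  have hs := (IsTailPar.exists (splitEquiv (pull (splitEquiv T) W))).choose_spec
  refine mk_barTerm_barTerm_congr α A (fun i => ?_) ?_ (fun i => ?_) z
  · rw [he, splitEquiv_inl_iff]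
  · refine iff_of_false hg ?_
    rintro ⟨y, hy⟩
    rw [hs.inl] at hy
    exact Fin.succ_ne_zero _ hy
  · rw [h]
    have h1 : ∀ j, (∃ y, (IsTailPar.exists (splitEquiv (pull (splitEquiv T) W))).choose (.inl y) =
        Fin.succ j) ↔ splitEquiv T (.inr j) ∈ W := fun j => by
      simp only [hs.inl, Fin.succ_inj, splitEquiv_inl_iff]
      simp [pull]
    simp only [h1]
    constructor
    · intro hi
      obtain ⟨j, hj⟩ := (splitEquiv_inr_iff T i).2 (Finset.disjoint_right.1 hd hi)
      exact ⟨j, hj, hj ▸ hi⟩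
    · rintro ⟨j, rfl, hj⟩; exact hj

theorem sum_barTerm_barTerm {n : ℕ} (z) (T : Finset (Fin n)) :
    ∑ T' : Finset (Fin ((Tᶜ).card + 1)), Comp.mk C.toSModule A.X _
      (barTerm α A (splitEquiv T') (barTerm α A (splitEquiv T) z)) =
    ∑ W ∈ (Tᶜ).powerset, seqVal α A z T W + ∑ W ∈ (Tᶜ).powerset, parVal α A z T W := by
  classical
  let push : Finset (Fin ((Tᶜ).card + 1)) → Finset (Fin n) := fun T' =>
    Finset.univ.filter fun i => ∃ j, splitEquiv T (.inr j) = i ∧ Fin.succ j ∈ T'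
  have hpush : ∀ T', Disjoint T (push T') := fun T' => by
    rw [Finset.disjoint_right]
    intro i hi
    obtain ⟨j, rfl, -⟩ := (Finset.mem_filter.1 hi).2
    exact (splitEquiv_inr_iff T _).1 ⟨j, rfl⟩
  have hmem : ∀ T', push T' ∈ (Tᶜ).powerset := fun T' => by
    rw [Finset.mem_powerset, Finset.subset_compl_iff_disjoint_left]
    exact hpush T'
  have hinj : ∀ T₁ T₂, push T₁ = push T₂ → ∀ j, Fin.succ j ∈ T₁ ↔ Fin.succ j ∈ T₂ := by
    intro T₁ T₂ h j
    have h2 : splitEquiv T (.inr j) ∈ push T₁ ↔ splitEquiv T (.inr j) ∈ push T₂ := by rw [h]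
    simpa [push] using h2
  have hsurj : ∀ W ∈ (Tᶜ).powerset, ∀ T' : Finset (Fin ((Tᶜ).card + 1)),
      (∀ j, Fin.succ j ∈ T' ↔ splitEquiv T (.inr j) ∈ W) → push T' = W := by
    intro W hW T' h
    ext i
    simp only [push, h, Finset.mem_filter_univ]
    constructor
    · rintro ⟨j, rfl, hj⟩; exact hj
    · intro hi
      obtain ⟨j, hj⟩ := (splitEquiv_inr_iff T i).2
        (Finset.mem_compl.1 (Finset.mem_powerset.1 hW hi))
      exact ⟨j, hj, hj ▸ hi⟩
  rw [← Finset.sum_filter_add_sum_filter_not Finset.univ fun T' : Finset (Fin ((Tᶜ).card + 1)) =>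
    0 ∈ T']
  congr 1
  · refine Finset.sum_bij (fun T' _ => push T') (fun T' _ => hmem T') ?_ ?_ ?_
    · intro T₁ h₁ T₂ h₂ h
      ext i
      cases i using Fin.cases with
      | zero => simp at h₁ h₂; simp [h₁, h₂]
      | succ j => exact hinj _ _ h j
    · intro W hW
      refine ⟨Finset.univ.filter fun t => Fin.cases True (fun j => splitEquiv T (.inr j) ∈ W) t,
        by simp, hsurj W hW _ fun j => by simp⟩
    · intro T' hT'
      refine seqVal_eq α A (hpush T') (splitEquiv_inl_iff T) ?_ (fun i => ?_) z
      · rw [splitEquiv_inl_iff]; simpa using hT'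
      · simp [splitEquiv_inl_iff, push]
  · refine Finset.sum_bij (fun T' _ => push T') (fun T' _ => hmem T') ?_ ?_ ?_
    · intro T₁ h₁ T₂ h₂ h
      ext i
      cases i using Fin.cases with
      | zero => simp at h₁ h₂; simp [h₁, h₂]
      | succ j => exact hinj _ _ h j
    · intro W hW
      refine ⟨Finset.univ.filter fun t => Fin.cases False (fun j => splitEquiv T (.inr j) ∈ W) t,
        by simp, hsurj W hW _ fun j => by simp⟩
    · intro T' hT'
      refine parVal_eq α A (hpush T') (splitEquiv_inl_iff T) ?_ (fun i => ?_) z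
      · rw [splitEquiv_inl_iff]; simpa using hT'
      · simp [splitEquiv_inl_iff, push]

end

section
variable {K : Type u} [Field K] {C : Cooperad K} {P : Operad K} (α : Twisting C P) (A : Algebra P)

theorem barTerm_empty {k l n : ℕ} (hk : k = 0) (e : Fin k ⊕ Fin l ≃ Fin n) (z) :
    barTerm α A e z = 0 := by
  subst hk
  have := C.connected_zero
  have h : C.cocirc (Graft.ofEquiv e) = 0 := LinearMap.ext fun x => Subsingleton.elim _ _
  rw [barTerm, h, TensorProduct.map_zero_left, LinearMap.comp_zero, LinearMap.zero_apply]

theorem mem_pull_iff {n : ℕ} {T W : Finset (Fin n)} (hd : Disjoint T W) (i : Fin n) :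
    (∃ y, splitEquiv T (.inr (splitEquiv (pull (splitEquiv T) W) (.inl y))) = i) ↔ i ∈ W := by
  constructor
  · rintro ⟨y, rfl⟩
    have := (splitEquiv_inl_iff (pull (splitEquiv T) W) _).1 ⟨y, rfl⟩
    simpa [pull] using this
  · intro hi
    obtain ⟨j, rfl⟩ := (splitEquiv_inr_iff T i).2 (Finset.disjoint_right.1 hd hi)
    obtain ⟨y, rfl⟩ := (splitEquiv_inl_iff (pull (splitEquiv T) W) j).2 (by simpa [pull] using hi)
    exact ⟨y, rfl⟩

theorem parVal_add {n : ℕ} (z) {T W : Finset (Fin n)} (hd : Disjoint T W) :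
    parVal α A z T W + parVal α A z W T = 0 := by
  set e := splitEquiv T
  set f := splitEquiv (pull e W) with hf
  obtain ⟨g, hg⟩ := IsTailPar.exists f
  let e' := (((Equiv.refl _).sumCongr finSumFinEquiv.symm).trans
    ((Equiv.sumAssoc _ _ _).symm.trans (((Equiv.sumComm _ _).sumCongr (Equiv.refl _)).trans
      (Equiv.sumAssoc _ _ _)))).trans (((Equiv.refl _).sumCongr f).trans e)
  obtain ⟨g', hg'⟩ := IsTailPar.exists (finSumFinEquiv (m := T.card) (n := (pull e W)ᶜ.card))
  have h₁ : ∀ y, e' (.inl y) = e (.inr (f (.inl y))) := fun y => by simp [e']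
  have h₂ : ∀ y, e' (.inr (finSumFinEquiv (.inl y))) = e (.inl y) := fun y => by
    simp [e', -finSumFinEquiv_apply_left]
  have h₃ : ∀ y, e' (.inr (finSumFinEquiv (.inr y))) = e (.inr (f (.inr y))) := fun y => by
    simp [e', -finSumFinEquiv_apply_right]
  have h := congrArg (Comp.mk C.toSModule A.X _) (barTerm_par α A hg hg' h₁ h₂ h₃ z)
  rw [mk_diagAct, map_neg] at h
  have hW : ∀ i, (∃ y, e' (.inl y) = i) ↔ i ∈ W := fun i => by
    simp only [h₁]; exact mem_pull_iff hd i
  rw [← parVal_eq (e := e) (g := g) α A hd (splitEquiv_inl_iff T),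
    ← parVal_eq (e := e') (g := g') α A hd.symm hW, h, add_neg_cancel]
  · rintro ⟨y, hy⟩
    rw [hg'.inl] at hy
    exact Fin.succ_ne_zero _ hy
  · intro i
    simp only [hg'.inl, Fin.succ_inj]
    rw [← splitEquiv_inl_iff T i]
    constructor
    · rintro ⟨j, rfl, y, rfl⟩
      exact ⟨y, (h₂ y).symm⟩
    · rintro ⟨y, rfl⟩
      exact ⟨_, h₂ y, y, rfl⟩
  · rintro ⟨y, hy⟩
    rw [hg.inl] at hy
    exact Fin.succ_ne_zero _ hy
  · intro i
    simp only [hg.inl, Fin.succ_inj]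
    rw [← mem_pull_iff hd i]
    constructor
    · rintro ⟨j, rfl, y, rfl⟩
      exact ⟨y, rfl⟩
    · rintro ⟨y, rfl⟩
      exact ⟨_, rfl, y, rfl⟩

theorem sum_parVal {n : ℕ} (z) :
    ∑ T : Finset (Fin n), ∑ W ∈ (Tᶜ).powerset, parVal α A z T W = 0 := by
  rw [Finset.sum_sigma']
  have hd : ∀ x ∈ (Finset.univ : Finset (Finset (Fin n))).sigma fun T => (Tᶜ).powerset,
      Disjoint x.1 x.2 := fun x hx => by
    rw [Finset.mem_sigma, Finset.mem_powerset, Finset.subset_compl_iff_disjoint_left] at hx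
    exact hx.2
  refine Finset.sum_involution (fun x _ => ⟨x.2, x.1⟩) (fun x hx => parVal_add α A z (hd x hx))
    ?_ ?_ (fun _ _ => rfl)
  · rintro ⟨T, W⟩ hx h0 h
    dsimp only at h h0
    obtain ⟨rfl, -⟩ := Sigma.mk.inj_iff.1 h
    refine h0 ?_
    have hT : W = ∅ := by simpa using hd _ hx
    rw [parVal, barTerm_empty α A (k := W.card) (by rw [hT]; rfl), map_zero, map_zero]
  · intro x hx
    rw [Finset.mem_sigma, Finset.mem_powerset, Finset.subset_compl_iff_disjoint_left]
    exact ⟨Finset.mem_univ _, (hd x hx).symm⟩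

theorem seqVal_eq_evenTerm {n k k' s l : ℕ} (e' : Fin s ⊕ Fin l ≃ Fin n)
    (f' : Fin k ⊕ Fin k' ≃ Fin s) {T W : Finset (Fin n)} (hd : Disjoint T W)
    (hT : ∀ i, (∃ y, e' (.inl (f' (.inl y))) = i) ↔ i ∈ T)
    (hW : ∀ i, (∃ y, e' (.inl (f' (.inr y))) = i) ↔ i ∈ W) (z) :
    Comp.mk C.toSModule A.X (l + 1) (evenTerm A e' (starTerm α f') z) = seqVal α A z T W := by
  obtain rfl : k + k' = s := by simpa using Fintype.card_congr f'
  let e := ((Equiv.refl _).sumCongr finSumFinEquiv.symm).trans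
    ((Equiv.sumAssoc _ _ _).symm.trans ((f'.sumCongr (Equiv.refl _)).trans e'))
  obtain ⟨g, hg⟩ := IsTailSeq.exists (finSumFinEquiv (m := k') (n := l))
  have h₁ : ∀ y, e (.inl y) = e' (.inl (f' (.inl y))) := fun y => by simp [e]
  have h₂ : ∀ y, e (.inr (finSumFinEquiv (.inl y))) = e' (.inl (f' (.inr y))) := fun y => by
    simp [e, -finSumFinEquiv_apply_left]
  have h₃ : ∀ y, e (.inr (finSumFinEquiv (.inr y))) = e' (.inr y) := fun y => by
    simp [e, -finSumFinEquiv_apply_right]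
  rw [← barTerm_seq α A hg h₁ h₂ h₃ z]
  refine seqVal_eq α A hd (fun i => ?_) ⟨0, hg.zero⟩ (fun i => ?_) z
  · simp only [h₁, hT]
  · simp only [Fin.exists_fin_succ, hg.zero, hg.succ, Fin.succ_inj, (Fin.succ_ne_zero _).symm,
      false_or]
    rw [← hW]
    constructor
    · rintro ⟨j, rfl, y, rfl⟩
      exact ⟨y, (h₂ y).symm⟩
    · rintro ⟨y, rfl⟩
      exact ⟨_, h₂ y, y, rfl⟩

theorem sum_seqVal {n : ℕ} (z) :
    ∑ T : Finset (Fin n), ∑ W ∈ (Tᶜ).powerset, seqVal α A z T W =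
    ∑ U : Finset (Fin n), ∑ V : Finset (Fin U.card),
      Comp.mk C.toSModule A.X _ (evenTerm A (splitEquiv U) (starTerm α (splitEquiv V)) z) := by
  classical
  rw [Finset.sum_sigma', Finset.sum_sigma']
  let j : (U : Finset (Fin n)) → Fin U.card ↪ Fin n := fun U =>
    ⟨fun y => splitEquiv U (.inl y), (splitEquiv U).injective.comp Sum.inl_injective⟩
  have hj : ∀ U y, j U y = splitEquiv U (.inl y) := fun _ _ => rfl
  have hjU : ∀ U, Finset.univ.map (j U) = U := fun U => by
    ext i
    simp [hj, splitEquiv_inl_iff]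
  have hdis : ∀ U (V : Finset (Fin U.card)), Disjoint (V.map (j U)) ((Vᶜ).map (j U)) := fun U V =>
    (Finset.disjoint_map _).2 disjoint_compl_right
  symm
  refine Finset.sum_bij (fun x _ => ⟨x.2.map (j x.1), (x.2ᶜ).map (j x.1)⟩) ?_ ?_ ?_ ?_
  · intro x _
    rw [Finset.mem_sigma, Finset.mem_powerset, Finset.subset_compl_iff_disjoint_left]
    exact ⟨Finset.mem_univ _, hdis _ _⟩
  · rintro ⟨U₁, V₁⟩ - ⟨U₂, V₂⟩ - h
    obtain ⟨h1, h2⟩ := Sigma.mk.inj_iff.1 h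
    rw [heq_eq_eq] at h2
    dsimp only at h1 h2
    have hu : ∀ (U) (V : Finset (Fin U.card)), V.map (j U) ∪ (Vᶜ).map (j U) = U := fun U V => by
      rw [← Finset.map_union, Finset.union_compl, hjU]
    obtain rfl : U₁ = U₂ := by rw [← hu U₁ V₁, h1, h2, hu]
    rw [Finset.map_inj.1 h1]
  · rintro ⟨T, W⟩ hx
    rw [Finset.mem_sigma, Finset.mem_powerset, Finset.subset_compl_iff_disjoint_left] at hx
    have hd : Disjoint T W := hx.2
    refine ⟨⟨T ∪ W, Finset.univ.filter fun y => j _ y ∈ T⟩, by simp, ?_⟩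
    have h1 : (Finset.univ.filter fun y => j (T ∪ W) y ∈ T).map (j _) = T := by
      ext i
      simp only [Finset.mem_map, Finset.mem_filter_univ]
      constructor
      · rintro ⟨y, hy, rfl⟩; exact hy
      · intro hi
        obtain ⟨y, rfl⟩ := (splitEquiv_inl_iff (T ∪ W) i).2 (Finset.mem_union_left _ hi)
        exact ⟨y, hi, rfl⟩
    have h2 : ((Finset.univ.filter fun y => j (T ∪ W) y ∈ T)ᶜ).map (j _) = W := by
      ext i
      simp only [Finset.mem_map, Finset.mem_compl, Finset.mem_filter_univ]
      constructor
      · rintro ⟨y, hy, rfl⟩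
        exact (Finset.mem_union.1 ((splitEquiv_inl_iff (T ∪ W) _).1 ⟨y, rfl⟩)).resolve_left hy
      · intro hi
        obtain ⟨y, rfl⟩ := (splitEquiv_inl_iff (T ∪ W) i).2 (Finset.mem_union_right _ hi)
        exact ⟨y, Finset.disjoint_right.1 hd hi, rfl⟩
    dsimp only
    rw [h1, h2]
  · rintro ⟨U, V⟩ -
    refine seqVal_eq_evenTerm α A _ _ (hdis U V) (fun i => ?_) (fun i => ?_) z
    · simp only [Finset.mem_map, hj]
      constructor
      · rintro ⟨y, rfl⟩
        exact ⟨_, (splitEquiv_inl_iff V _).1 ⟨y, rfl⟩, rfl⟩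
      · rintro ⟨y, hy, rfl⟩
        obtain ⟨y, rfl⟩ := (splitEquiv_inl_iff V _).2 hy
        exact ⟨y, rfl⟩
    · simp only [Finset.mem_map, hj, Finset.mem_compl]
      constructor
      · rintro ⟨y, rfl⟩
        exact ⟨_, (splitEquiv_inr_iff V _).1 ⟨y, rfl⟩, rfl⟩
      · rintro ⟨y, hy, rfl⟩
        obtain ⟨y, rfl⟩ := (splitEquiv_inr_iff V _).2 hy
        exact ⟨y, rfl⟩

theorem sum_evenTerm_starTerm {n : ℕ} (z) (U : Finset (Fin n)) :
    evenTerm A (splitEquiv U) (totD _ ∘ₗ α.map _ + α.map _ ∘ₗ totD _) z +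
      ∑ V : Finset (Fin U.card), evenTerm A (splitEquiv U) (starTerm α (splitEquiv V)) z = 0 := by
  have hsum : ∀ s : Finset (Finset (Fin U.card)),
      evenTerm A (splitEquiv U) (∑ V ∈ s, starTerm α (splitEquiv V)) z =
        ∑ V ∈ s, evenTerm A (splitEquiv U) (starTerm α (splitEquiv V)) z := by
    classical
    intro s
    induction s using Finset.induction_on with
    | empty => rw [Finset.sum_empty, Finset.sum_empty, evenTerm_zero, LinearMap.zero_apply]
    | insert V s hV h =>
      rw [Finset.sum_insert hV, Finset.sum_insert hV, evenTerm_add, LinearMap.add_apply, h]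
  rw [← hsum, ← LinearMap.add_apply, ← evenTerm_add]
  have h0 : totD _ ∘ₗ α.map _ + α.map _ ∘ₗ totD _ +
      ∑ V : Finset (Fin U.card), starTerm α (splitEquiv V) = 0 := by
    refine LinearMap.ext fun x => ?_
    rw [LinearMap.add_apply, LinearMap.sum_apply]
    exact α.maurer_cartan U.card x
  rw [h0, evenTerm_zero, LinearMap.zero_apply]

/-- The differential of the bar construction. -/
def barD : Comp C.toSModule A.X →ₗ[K] Comp C.toSModule A.X :=
  toModule K ℕ _ fun n => (coinvRel C.toSModule A.X n).liftQ (barPre α A n)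
    (coinvRel_le_ker α A n)

theorem barD_mk {n : ℕ} (z : Tot (C.X n) ⊗[K] TPow A.X n) :
    barD α A (Comp.mk C.toSModule A.X n z) = barPre α A n z :=
  (toModule_lof ..).trans (Submodule.liftQ_apply ..)

theorem Comp.induction {M : SModule K} {A : ChainComplex (ModuleCat.{u} K) ℤ}
    {motive : Comp M A → Prop} (x : Comp M A)
    (h : ∀ n z, motive (Comp.mk M A n z)) (hadd : ∀ x y, motive x → motive y → motive (x + y)) :
    motive x := by
  induction x using DirectSum.induction_on with
  | zero => simpa using h 0 0
  | of n x =>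
    obtain ⟨z, rfl⟩ := Submodule.mkQ_surjective _ x
    exact h n z
  | add x y hx hy => exact hadd x y hx hy

theorem barD_barD (x : Comp C.toSModule A.X) : barD α A (barD α A x) = 0 := by
  induction x using Comp.induction with
  | hadd x y hx hy => rw [map_add, map_add, hx, hy, add_zero]
  | h n z =>
    have h2 := (Finset.sum_add_distrib (s := Finset.univ)
      (f := fun T : Finset (Fin n) => ∑ W ∈ (Tᶜ).powerset, seqVal α A z T W)
      (g := fun T => ∑ W ∈ (Tᶜ).powerset, parVal α A z T W))
    rw [sum_parVal, add_zero, sum_seqVal] at h2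
    simp only [← sum_barTerm_barTerm] at h2
    have h3 : ∀ T : Finset (Fin n), Comp.mk C.toSModule A.X _
        (barTerm α A (splitEquiv T) (barD₁ A n z + barD₃ A n z)) +
        Comp.mk C.toSModule A.X _ (barD₁ A _ (barTerm α A (splitEquiv T) z) +
          barD₃ A _ (barTerm α A (splitEquiv T) z)) +
        ∑ V : Finset (Fin T.card), Comp.mk C.toSModule A.X _
          (evenTerm A (splitEquiv T) (starTerm α (splitEquiv V)) z) = 0 := fun T => by
      rw [← map_sum, ← map_add, cross_term, ← map_add, sum_evenTerm_starTerm, map_zero]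
    rw [barD_mk, barPre, LinearMap.add_apply, LinearMap.comp_apply, LinearMap.sum_apply, map_add,
      map_sum, barD_mk, barPre, LinearMap.add_apply, LinearMap.comp_apply, LinearMap.sum_apply,
      LinearMap.add_apply, LinearMap.add_apply, barD₁₃_sq, map_zero, zero_add]
    simp only [LinearMap.comp_apply, barD_mk]
    simp only [barPre, LinearMap.add_apply, LinearMap.comp_apply, LinearMap.sum_apply]
    rw [Finset.sum_add_distrib, h2, ← add_assoc, ← Finset.sum_add_distrib,
      ← Finset.sum_add_distrib]
    exact Finset.sum_eq_zero fun T _ => h3 T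

end

/-! ### The bar construction as a chain complex, and its functoriality -/

section
variable {K : Type u} [Field K] {A B : ChainComplex (ModuleCat.{u} K) ℤ} (f : A ⟶ B)

/-- The map `f^{⊗n}`. -/
def tpowMap (n : ℕ) : TPow A n →ₗ[K] TPow B n :=
  PiTensorProduct.map fun _ => totMap f

theorem tpowMap_tprod {n : ℕ} (a : Fin n → Tot A) :
    tpowMap f n (PiTensorProduct.tprod K a) = PiTensorProduct.tprod K fun i => totMap f (a i) :=
  PiTensorProduct.map_tprod _ _

theorem tpowMap_permMap {n : ℕ} (σ : Equiv.Perm (Fin n)) (v : TPow A n) :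
    tpowMap f n (permMap A σ v) = permMap B σ (tpowMap f n v) := by
  suffices h : tpowMap f n ∘ₗ permMap A σ = permMap B σ ∘ₗ tpowMap f n from LinearMap.congr_fun h v
  refine tpow_ext fun p a ha => ?_
  rw [LinearMap.comp_apply, LinearMap.comp_apply, permMap_tprod σ ha, map_smul, tpowMap_tprod,
    tpowMap_tprod, permMap_tprod σ fun i => totMap_mem f (ha i)]

theorem tpowMap_tpowD {n : ℕ} (v : TPow A n) :
    tpowMap f n (tpowD A n v) = tpowD B n (tpowMap f n v) := by
  suffices h : tpowMap f n ∘ₗ tpowD A n = tpowD B n ∘ₗ tpowMap f n from LinearMap.congr_fun h v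
  refine tpow_ext fun p a ha => ?_
  rw [LinearMap.comp_apply, LinearMap.comp_apply, tpowD_tprod ha, map_sum, tpowMap_tprod,
    tpowD_tprod fun i => totMap_mem f (ha i)]
  refine Finset.sum_congr rfl fun j _ => ?_
  rw [map_smul, tpowMap_tprod]
  congr 2
  funext i
  by_cases h : i = j
  · subst h; simp [totMap_totD]
  · simp [h]

theorem tpowMap_unshuffle {k l n : ℕ} (e : Fin k ⊕ Fin l ≃ Fin n) (v : TPow A n) :
    unshuffle B e (tpowMap f n v) =
      TensorProduct.map (tpowMap f k) (tpowMap f l) (unshuffle A e v) := by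
  suffices h : unshuffle B e ∘ₗ tpowMap f n =
    TensorProduct.map (tpowMap f k) (tpowMap f l) ∘ₗ unshuffle A e from LinearMap.congr_fun h v
  refine tpow_ext (A := A) (M := TPow B k ⊗[K] TPow B l) fun p a ha => ?_
  rw [LinearMap.comp_apply, LinearMap.comp_apply, tpowMap_tprod, unshuffle_tprod e ha,
    unshuffle_tprod e fun i => totMap_mem f (ha i), map_smul, TensorProduct.map_tmul,
    tpowMap_tprod, tpowMap_tprod]

theorem tpowMap_consMap {n : ℕ} (x : Tot A) (v : TPow A n) :
    tpowMap f (n + 1) (consMap A n (x ⊗ₜ[K] v)) = consMap B n (totMap f x ⊗ₜ[K] tpowMap f n v) := by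
  suffices h : (tpowMap f (n + 1) ∘ₗ consMap A n) ∘ₗ TensorProduct.mk K _ _ x =
      (consMap B n ∘ₗ TensorProduct.mk K _ _ (totMap f x)) ∘ₗ tpowMap f n from
    LinearMap.congr_fun h v
  refine tpow_ext fun p a ha => ?_
  simp only [LinearMap.comp_apply, TensorProduct.mk_apply, consMap_tprod, tpowMap_tprod]
  congr 1
  funext i
  cases i using Fin.cases <;> simp

variable (M : SModule K)

/-- The map `M ∘ f`. -/
def compMap : Comp M A →ₗ[K] Comp M B :=
  toModule K ℕ _ fun n => (coinvRel M A n).liftQ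
    (Comp.mk M B n ∘ₗ TensorProduct.map LinearMap.id (tpowMap f n)) <| by
      refine Submodule.span_le.2 ?_
      rintro _ ⟨σ, z, rfl⟩
      rw [SetLike.mem_coe, LinearMap.mem_ker, map_sub, sub_eq_zero, LinearMap.comp_apply,
        LinearMap.comp_apply, ← mk_diagAct M B σ (TensorProduct.map LinearMap.id (tpowMap f n) z)]
      congr 1
      induction z using TensorProduct.induction_on with
      | zero => simp only [map_zero]
      | add z z' h h' => simp only [map_add, h, h']
      | tmul x v => simp [diagAct, tpowMap_permMap]

theorem compMap_mk {n : ℕ} (z : Tot (M.X n) ⊗[K] TPow A n) :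
    compMap f M (Comp.mk M A n z) =
      Comp.mk M B n (TensorProduct.map LinearMap.id (tpowMap f n) z) :=
  (toModule_lof ..).trans (Submodule.liftQ_apply ..)

theorem compMap_mem {q : ℤ} {x : Comp M A} (hx : x ∈ Comp.gr M A q) :
    compMap f M x ∈ Comp.gr M B q := by
  induction hx using Submodule.span_induction with
  | zero => rw [map_zero]; exact Submodule.zero_mem _
  | add x y _ _ hx hy => rw [map_add]; exact Submodule.add_mem _ hx hy
  | smul c x _ hx => rw [map_smul]; exact Submodule.smul_mem _ _ hx
  | mem x hx =>
    obtain ⟨n, r, p, x, a, hx, ha, hq, rfl⟩ := hx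
    rw [compMap_mk, TensorProduct.map_tmul, tpowMap_tprod]
    exact Submodule.subset_span ⟨n, r, p, x, _, hx, fun i => totMap_mem f (ha i), hq, rfl⟩

end

section
variable {K : Type u} [Field K] {C : Cooperad K} {P : Operad K} (α : Twisting C P) (A : Algebra P)

theorem mk_mem {M : SModule K} {A : ChainComplex (ModuleCat.{u} K) ℤ} {n : ℕ} {q r : ℤ}
    {p : Fin n → ℤ} {x : Tot (M.X n)} {a : Fin n → Tot A} (hx : x ∈ gr (M.X n) r)
    (ha : ∀ i, a i ∈ gr A (p i)) (hq : r + ∑ i, p i = q) :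
    Comp.mk M A n (x ⊗ₜ[K] PiTensorProduct.tprod K a) ∈ Comp.gr M A q :=
  Submodule.subset_span ⟨n, r, p, x, a, hx, ha, hq, rfl⟩

theorem barD_mem {q : ℤ} {x : Comp C.toSModule A.X} (hx : x ∈ Comp.gr C.toSModule A.X q) :
    barD α A x ∈ Comp.gr C.toSModule A.X (q - 1) := by
  induction hx using Submodule.span_induction with
  | zero => rw [map_zero]; exact Submodule.zero_mem _
  | add x y _ _ hx hy => rw [map_add]; exact Submodule.add_mem _ hx hy
  | smul c x _ hx => rw [map_smul]; exact Submodule.smul_mem _ _ hx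
  | mem x hx =>
    obtain ⟨n, r, p, x, a, hx, ha, rfl, rfl⟩ := hx
    rw [barD_mk, barPre, LinearMap.add_apply, LinearMap.comp_apply, LinearMap.sum_apply,
      LinearMap.add_apply, map_add]
    refine Submodule.add_mem _ (Submodule.add_mem _ ?_ ?_) (Submodule.sum_mem _ fun T _ => ?_)
    · rw [barD₁, TensorProduct.map_tmul, tpowD_tprod ha, tmul_sum, map_sum]
      refine Submodule.sum_mem _ fun j _ => ?_
      rw [tmul_smul, map_smul]
      refine Submodule.smul_mem _ _ (mk_mem (p := Function.update p j (p j - 1)) (sgn_mem hx)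
        (fun i => ?_) ?_)
      · by_cases h : i = j
        · subst h; simpa using totD_mem (ha i)
        · simpa [h] using ha i
      · rw [Finset.sum_update_of_mem (Finset.mem_univ j),
          ← Finset.add_sum_erase _ p (Finset.mem_univ j), Finset.sdiff_singleton_eq_erase]
        ring
    · rw [barD₃, TensorProduct.map_tmul]
      exact mk_mem (totD_mem hx) ha (by ring)
    · rw [LinearMap.comp_apply, barTerm, LinearMap.comp_apply, TensorProduct.map_tmul,
        unshuffle_tprod _ ha, tmul_smul, map_smul, map_smul]
      refine Submodule.smul_mem _ _ ?_
      have h := C.cocirc_mem (Graft.ofEquiv (splitEquiv T)) hx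
      generalize C.cocirc (Graft.ofEquiv (splitEquiv T)) x = z at h
      induction h using Submodule.span_induction with
      | zero => rw [zero_tmul, map_zero, map_zero]; exact Submodule.zero_mem _
      | add x y _ _ hx hy => rw [add_tmul, map_add, map_add]; exact Submodule.add_mem _ hx hy
      | smul c x _ hx =>
        rw [← smul_tmul', map_smul, map_smul]; exact Submodule.smul_mem _ _ hx
      | mem z hz =>
        obtain ⟨i, j, x', x'', rfl, hx', hx'', rfl⟩ := hz
        rw [barApply_tmul, consMap_tprod]
        refine mk_mem (p := Fin.cons (j - 1 + ∑ t, p (splitEquiv T (.inl t)))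
          fun t => p (splitEquiv T (.inr t))) (sgn_mem hx') (fun t => ?_) ?_
        · cases t using Fin.cases with
          | zero => exact A.γ_mem (α.map_mem hx'') fun t => ha _
          | succ t => exact ha _
        · rw [Fin.sum_cons, ← (splitEquiv T).sum_comp p, Fintype.sum_sum_type]
          ring

/-- The relative bar construction `B_α A`: the graded vector space `C ∘ A`, with the sum of the
differential of `C`, of the differential of `A`, and of the twisting term. -/
def bar : ChainComplex (ModuleCat.{u} K) ℤ where
  X q := ModuleCat.of K (Comp.gr C.toSModule A.X q)
  d i j := if h : i - 1 = j then
      ModuleCat.ofHom ((barD α A).restrict fun _ hx => h ▸ barD_mem α A hx)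
    else 0
  shape i j h := dif_neg fun h' => h (by rw [← h']; exact sub_add_cancel i 1)
  d_comp_d' i j k hij hjk := by
    have h1 : i - 1 = j := by rw [← hij]; exact add_sub_cancel_right j 1
    have h2 : j - 1 = k := by rw [← hjk]; exact add_sub_cancel_right k 1
    rw [dif_pos h1, dif_pos h2]
    refine ModuleCat.hom_ext (LinearMap.ext fun x => Subtype.ext ?_)
    exact barD_barD α A x

variable {A} {B : Algebra P} (f : A.Hom B)

theorem compMap_barD (x : Comp C.toSModule A.X) :
    compMap f.hom C.toSModule (barD α A x) = barD α B (compMap f.hom C.toSModule x) := by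
  induction x using Comp.induction with
  | hadd x y hx hy => simp only [map_add, hx, hy]
  | h n z =>
    rw [barD_mk, compMap_mk, barD_mk]
    simp only [barPre, LinearMap.add_apply, LinearMap.comp_apply, LinearMap.sum_apply, map_add,
      map_sum, compMap_mk]
    congr 1
    · rw [← map_add, ← map_add]
      induction z using TensorProduct.induction_on with
      | zero => simp only [map_zero, add_zero]
      | add z z' h h' =>
        simp only [map_add] at h h' ⊢
        rw [add_add_add_comm, h, h', add_add_add_comm]
      | tmul x v => simp [barD₁, barD₃, tpowMap_tpowD]
    · refine Finset.sum_congr rfl fun T _ => ?_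
      induction z using TensorProduct.induction_on with
      | zero => simp only [map_zero]
      | add z z' h h' => simp only [map_add, h, h']
      | tmul x v =>
        simp only [barTerm, LinearMap.comp_apply, TensorProduct.map_tmul, tpowMap_unshuffle,
          LinearMap.id_apply]
        generalize C.cocirc (Graft.ofEquiv (splitEquiv T)) x = X
        generalize unshuffle A.X (splitEquiv T) v = U
        induction X using TensorProduct.induction_on with
        | zero => simp only [map_zero, zero_tmul]
        | add z z' h h' => simp only [map_add, add_tmul, h, h']
        | tmul x' x'' =>
          induction U using TensorProduct.induction_on with
          | zero => simp only [map_zero, tmul_zero]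
          | add z z' h h' => simp only [map_add, tmul_add, h, h']
          | tmul v w =>
            rw [TensorProduct.map_tmul, barApply_tmul, barApply_tmul, TensorProduct.map_tmul,
              tpowMap_consMap, f.map_γ]
            rfl

/-- The map `B_α f = C ∘ f`. -/
def barMap : bar α A ⟶ bar α B where
  f _ := ModuleCat.ofHom ((compMap f.hom C.toSModule).restrict fun _ hx =>
    compMap_mem f.hom C.toSModule hx)
  comm' i j hij := by
    have h1 : i - 1 = j := by rw [← hij]; exact add_sub_cancel_right j 1
    simp only [bar, dif_pos h1]
    refine ModuleCat.hom_ext (LinearMap.ext fun x => Subtype.ext ?_)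
    exact (compMap_barD α f x).symm

end

end OperadicBar

end

/-! Filter `C ∘ A` by the degree of the factor in `C`. The part `d₁` of the bar differential
preserves this degree. The part `d₃` lowers it by one. The part `d₂` replaces `x` by components `x'
⊗ x''` with `|x'| + |x''| = |x|` and applies `α` to `x''`; as `α(x'')` has degree `|x''| - 1` and
`P` vanishes in negative degrees, only `|x''| ≥ 1` contributes, so `d₂` also lowers the degree. The
filtration is exhaustive and, since `C` is non-negative, starts at zero, whatever the degrees of
`A`. Hence it suffices to treat the leading differential `d₁` (`compD`), provided that the cone of
`C ∘ f` for `d₁` has a contraction `H` compatible with the filtration: a cycle `z` for the full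
differential `D` of the cone then differs from the boundary `D (H z)` by a cycle lying one step
lower, and induction ends at zero. This is `ker_le_range_of_filtration`, used through
`IsConeContraction.isQI_of_filtration`.

For the leading differential, the cone of `f^{⊗n}` is acyclic by a Künneth argument
(`isQI_tpowMap`), hence contractible over the field `K`. The contraction obtained this way is merely
`K`-linear, not equivariant, and in positive characteristic it cannot be averaged by dividing by
`n!`. Projectivity of `C(n)_d` replaces the division: Higman's criterion (`exists_sum_conj_eq`)
gives a linear `θ` with `∑ g⁻¹ θ g = id`. For any linear `φ` on tensor powers the formula `x ⊗ v ↦ ∑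
θ(g x) ⊗ φ(g v)` descends to coinvariants (`transfer`); it is additive in `φ`, sends `φ = id` to the
identity, and absorbs composition with equivariant maps on either side. So the contraction
identities for `f^{⊗n}` become contraction identities for `C ∘ f` (`isConeContraction_transfer`). As
`θ` preserves degrees, the new contraction respects the filtration.

The argument uses ungraded differential modules: a quasi-isomorphism is a map with acyclic cone
(`IsQI`), and a contraction of the cone is recorded by its four matrix entries
(`IsConeContraction`), which can be carried separately through tensor products and coinvariants. The
passage from complexes to total spaces is `isQI_totMap`; the way back is `quasiIso_barMap`, which
projects solutions onto homogeneous components. -/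

noncomputable section

namespace OperadicBar

/-! ### Differential modules -/

section Cone
variable {K : Type*} [Field K] {V W X : Type*} [AddCommGroup V] [Module K V] [AddCommGroup W]
  [Module K W] [AddCommGroup X] [Module K X]

/-- The differential of the mapping cone of `f`. -/
def coneD (d : V →ₗ[K] V) (d' : W →ₗ[K] W) (f : V →ₗ[K] W) : V × W →ₗ[K] V × W :=
  (d ∘ₗ LinearMap.fst K V W).prod (f ∘ₗ LinearMap.fst K V W - d' ∘ₗ LinearMap.snd K V W)

theorem coneD_apply (d : V →ₗ[K] V) (d' : W →ₗ[K] W) (f : V →ₗ[K] W) (z : V × W) :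
    coneD d d' f z = (d z.1, f z.1 - d' z.2) := rfl

/-- `f` is a quasi-isomorphism of differential modules: its mapping cone is acyclic. -/
def IsQI (d : V →ₗ[K] V) (d' : W →ₗ[K] W) (f : V →ₗ[K] W) : Prop :=
  LinearMap.ker (coneD d d' f) ≤ LinearMap.range (coneD d d' f)

/-- Cone cycles are pairs consisting of a cycle `y` and a bounding element `x` for `f y`; this
elementwise form is the one used to verify and to apply `IsQI`. -/
theorem isQI_iff {d : V →ₗ[K] V} {d' : W →ₗ[K] W} {f : V →ₗ[K] W} : IsQI d d' f ↔
    ∀ y x, d y = 0 → f y = d' x → ∃ y' x', d y' = y ∧ f y' - d' x' = x := by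
  constructor
  · intro h y x hy hx
    obtain ⟨z, hz⟩ := h (x := (y, x)) (by simp [coneD_apply, hy, hx])
    exact ⟨z.1, z.2, congrArg Prod.fst hz, congrArg Prod.snd hz⟩
  · rintro h ⟨y, x⟩ hz
    rw [LinearMap.mem_ker, coneD_apply, Prod.mk_eq_zero, sub_eq_zero] at hz
    obtain ⟨y', x', h1, h2⟩ := h y x hz.1 hz.2
    exact ⟨(y', x'), Prod.ext h1 h2⟩

theorem coneD_coneD {d : V →ₗ[K] V} {d' : W →ₗ[K] W} {f : V →ₗ[K] W} (hd : ∀ y, d (d y) = 0)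
    (hd' : ∀ x, d' (d' x) = 0) (hf : ∀ y, f (d y) = d' (f y)) (z : V × W) :
    coneD d d' f (coneD d d' f z) = 0 := by
  simp [coneD_apply, hd, hd', hf]

/-- Solve the problem for `g` at `(f y, x)`; its first component `w` bounds `f y`, so `(y, w)` is a
cone cycle of `f`. The solution for `f` then corrects that for `g` by `g w'`. -/
theorem IsQI.comp {d : V →ₗ[K] V} {d' : W →ₗ[K] W} {d'' : X →ₗ[K] X} {f : V →ₗ[K] W}
    {g : W →ₗ[K] X} (hgd : ∀ x, g (d' x) = d'' (g x)) (hg : IsQI d' d'' g)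
    (hfd : ∀ x, f (d x) = d' (f x)) (hf : IsQI d d' f) : IsQI d d'' (g ∘ₗ f) := by
  rw [isQI_iff] at *
  intro y x hy hx
  obtain ⟨w, x', h1, h2⟩ := hg (f y) x (by rw [← hfd, hy, map_zero]) hx
  obtain ⟨y', w', h3, h4⟩ := hf y w hy h1.symm
  refine ⟨y', x' + g w', h3, ?_⟩
  rw [← h2, ← h4, map_sub, map_add, hgd, LinearMap.comp_apply]
  abel

theorem IsQI.of_bijective {d : V →ₗ[K] V} {d' : W →ₗ[K] W} {f : V →ₗ[K] W}
    (hfd : ∀ y, f (d y) = d' (f y)) (hf : Function.Bijective f) : IsQI d d' f := by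
  rw [isQI_iff]
  intro y x _ hx
  obtain ⟨w, rfl⟩ := hf.2 x
  exact ⟨w, 0, hf.1 (by rw [hfd, hx]), by rw [map_zero, sub_zero]⟩

/-- Isomorphisms of differential modules preserve quasi-isomorphisms. -/
theorem IsQI.of_equiv {V' W' : Type*} [AddCommGroup V'] [Module K V'] [AddCommGroup W']
    [Module K W'] {d : V →ₗ[K] V} {d' : W →ₗ[K] W} {f : V →ₗ[K] W} {δ : V' →ₗ[K] V'}
    {δ' : W' →ₗ[K] W'} {φ : V' →ₗ[K] W'} (e : V ≃ₗ[K] V') (e' : W ≃ₗ[K] W')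
    (he : ∀ y, δ (e y) = e (d y)) (he' : ∀ x, δ' (e' x) = e' (d' x))
    (hf : ∀ y, φ (e y) = e' (f y)) (h : IsQI d d' f) : IsQI δ δ' φ := by
  rw [isQI_iff] at *
  intro y x hy hx
  obtain ⟨y, rfl⟩ := e.surjective y
  obtain ⟨x, rfl⟩ := e'.surjective x
  rw [he, LinearEquiv.map_eq_zero_iff] at hy
  rw [hf, he', e'.injective.eq_iff] at hx
  obtain ⟨y', x', h1, h2⟩ := h y x hy hx
  exact ⟨e y', e' x', by rw [he, h1], by rw [hf, he', ← map_sub, h2]⟩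

/-- An acyclic differential vector space is contractible. -/
theorem exists_contraction {d : V →ₗ[K] V} (hd : ∀ y, d (d y) = 0)
    (h : LinearMap.ker d ≤ LinearMap.range d) :
    ∃ H : V →ₗ[K] V, ∀ y, d (H y) + H (d y) = y := by
  obtain ⟨s, hs⟩ := d.rangeRestrict.exists_rightInverse_of_surjective d.range_rangeRestrict
  obtain ⟨p, hp⟩ := (LinearMap.ker d).subtype.exists_leftInverse_of_injective
    (LinearMap.ker d).ker_subtype
  have hs' (z : LinearMap.range d) : d (s z) = z :=
    congrArg Subtype.val (LinearMap.congr_fun hs z)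
  have hp' (z : LinearMap.ker d) : p z = z := LinearMap.congr_fun hp z
  have hdk (z : LinearMap.ker d) : d z = 0 := z.2
  -- The raw section of `d` is corrected by its projection to `ker d`, so that `s'` is still a
  -- section but takes values in `ker p`. The contraction will be `s' ∘ p`.
  let s' := s ∘ₗ Submodule.inclusion h - (LinearMap.ker d).subtype ∘ₗ p ∘ₗ s ∘ₗ Submodule.inclusion h
  have h1 (z : LinearMap.ker d) : d (s' z) = z := by simp [s', hs', hdk]
  have h2 (z : LinearMap.ker d) : p (s' z) = 0 := by simp [s', hp']
  refine ⟨s' ∘ₗ p, fun y => ?_⟩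
  rw [LinearMap.comp_apply, LinearMap.comp_apply, h1]
  have h3 : p (d y) = ⟨d y, hd y⟩ := hp' ⟨d y, hd y⟩
  have h4 : d (y - p y - s' (p (d y))) = 0 := by
    rw [map_sub, map_sub, h1, h3, hdk, sub_zero, sub_self]
  have h5 : p (y - p y - s' (p (d y))) = 0 := by
    rw [map_sub, map_sub, h2, hp', sub_self, sub_zero]
  -- The remainder lies in `ker d`, where `p` is the identity, and is killed by `p`; hence it
  -- vanishes.
  have h6 : y - p y - s' (p (d y)) = 0 := by
    have := hp' ⟨_, h4⟩
    rw [h5] at this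
    exact congrArg Subtype.val this.symm
  rw [sub_sub, sub_eq_zero] at h6
  exact h6.symm

/-- The equations saying that `(y, x) ↦ (a y + b x, c y + e x)` contracts the cone of `f`. -/
structure IsConeContraction (d : V →ₗ[K] V) (d' : W →ₗ[K] W) (f : V →ₗ[K] W) (a : V →ₗ[K] V)
    (b : W →ₗ[K] V) (c : V →ₗ[K] W) (e : W →ₗ[K] W) : Prop where
  fst_left : d ∘ₗ a + a ∘ₗ d + b ∘ₗ f = LinearMap.id
  fst_right : d ∘ₗ b = b ∘ₗ d'
  snd_left : f ∘ₗ a - d' ∘ₗ c + c ∘ₗ d + e ∘ₗ f = 0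
  snd_right : f ∘ₗ b - d' ∘ₗ e - e ∘ₗ d' = LinearMap.id

/-- A contraction of the cone is a 2 × 2 matrix of maps, with diagonal entries `a`, `e`. In the
graded picture `a` and `e` have degree 1, `b` is a homotopy inverse of degree 0 and `c` has degree
2; these parities determine the signs needed later. -/
theorem IsQI.exists_contraction {d : V →ₗ[K] V} {d' : W →ₗ[K] W} {f : V →ₗ[K] W}
    (hd : ∀ y, d (d y) = 0) (hd' : ∀ x, d' (d' x) = 0) (hfd : ∀ y, f (d y) = d' (f y))
    (hf : IsQI d d' f) : ∃ a b c e, IsConeContraction d d' f a b c e := by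
  obtain ⟨H, hH⟩ := OperadicBar.exists_contraction (coneD_coneD hd hd' hfd) hf
  refine ⟨LinearMap.fst K V W ∘ₗ H ∘ₗ LinearMap.inl K V W,
    LinearMap.fst K V W ∘ₗ H ∘ₗ LinearMap.inr K V W,
    LinearMap.snd K V W ∘ₗ H ∘ₗ LinearMap.inl K V W,
    LinearMap.snd K V W ∘ₗ H ∘ₗ LinearMap.inr K V W, ?_, ?_, ?_, ?_⟩
  -- Each entry of the matrix identity comes from evaluating `D H + H D = id` on `(y, 0)` or `(0,
  -- y)` and reading off one coordinate.
  all_goals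
    refine LinearMap.ext fun y => ?_
    first
    | have h := hH (y, 0)
      have h' : H (d y, f y) = H (d y, 0) + H (0, f y) := by rw [← map_add]; simp
      simp only [coneD_apply, map_zero, sub_zero, h'] at h
      first
      | have h1 := congrArg Prod.fst h
        simpa [add_assoc] using h1
      | have h1 := congrArg Prod.snd h
        simpa [add_assoc] using h1
    | have h := hH (0, y)
      have h' : H (0, - d' y) = - H (0, d' y) := by
        rw [← map_neg H, Prod.neg_mk, neg_zero]
      simp only [coneD_apply, map_zero, zero_sub, h'] at h
      first
      | have h1 := congrArg Prod.fst h
        simpa [add_neg_eq_zero] using h1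
      | have h1 := congrArg Prod.snd h
        simpa [sub_eq_add_neg] using h1

/-- An operator is exact if it has, up to terms lowering an exhaustive filtration, a contracting
homotopy. -/
theorem ker_le_range_of_filtration {D : V →ₗ[K] V} (hD : ∀ y, D (D y) = 0) (H : V → V)
    (F : ℕ → Submodule K V) (h0 : F 0 = ⊥) (htop : ∀ y, ∃ r, y ∈ F r)
    (hF : ∀ r, ∀ y ∈ F (r + 1), D y = 0 → y - D (H y) ∈ F r) :
    LinearMap.ker D ≤ LinearMap.range D := by
  have key : ∀ r, ∀ y ∈ F r, D y = 0 → y ∈ LinearMap.range D := by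
    intro r
    induction r with
    | zero =>
      intro y hy _
      rw [h0, Submodule.mem_bot] at hy
      rw [hy]
      exact Submodule.zero_mem _
    | succ r ih =>
      intro y hy h
      have := ih _ (hF r y hy h) (by rw [map_sub, h, hD, sub_zero])
      exact (Submodule.sub_mem_iff_left _ (LinearMap.mem_range_self D _)).1 this
  intro y hy
  obtain ⟨r, hr⟩ := htop y
  exact key r y hr hy

/-- On a cone cycle the term `H D` of `D H + H D = id` vanishes, so the contraction itself supplies
the primitive. -/
theorem IsConeContraction.isQI {d : V →ₗ[K] V} {d' : W →ₗ[K] W} {f : V →ₗ[K] W} {a : V →ₗ[K] V}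
    {b : W →ₗ[K] V} {c : V →ₗ[K] W} {e : W →ₗ[K] W} (h : IsConeContraction d d' f a b c e) :
    IsQI d d' f := by
  rw [isQI_iff]
  intro y x hy hx
  refine ⟨a y + b x, c y + e x, ?_, ?_⟩
  · have h1 := LinearMap.congr_fun h.fst_left y
    have h2 := LinearMap.congr_fun h.fst_right x
    simp only [LinearMap.add_apply, LinearMap.comp_apply, LinearMap.id_apply, hy, map_zero,
      add_zero] at h1 h2
    rw [map_add, h2, ← hx, h1]
  · have h1 := LinearMap.congr_fun h.snd_left y
    have h2 := LinearMap.congr_fun h.snd_right x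
    simp only [LinearMap.add_apply, LinearMap.sub_apply, LinearMap.comp_apply, LinearMap.id_apply,
      hy, map_zero, add_zero, LinearMap.zero_apply, ← hx] at h1 h2
    rw [map_add, map_add]
    conv_rhs => rw [← add_zero x, ← h1, ← h2]
    abel

/-- If `f` is a quasi-isomorphism for the leading terms `d`, `d'` of the differentials `D`, `D'`,
compatibly with exhaustive filtrations, then it is a quasi-isomorphism for `D`, `D'`. -/
theorem IsConeContraction.isQI_of_filtration {d D : V →ₗ[K] V} {d' D' : W →ₗ[K] W}
    {f : V →ₗ[K] W} {a : V →ₗ[K] V} {b : W →ₗ[K] V} {c : V →ₗ[K] W} {e : W →ₗ[K] W}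
    (h : IsConeContraction d d' f a b c e) (hD : ∀ y, D (D y) = 0) (hD' : ∀ x, D' (D' x) = 0)
    (hf : ∀ y, f (D y) = D' (f y)) {F : ℕ → Submodule K V} {G : ℕ → Submodule K W}
    (hF : Monotone F) (hG : Monotone G) (hF₀ : F 0 = ⊥) (hG₀ : G 0 = ⊥) (hF₁ : ∀ y, ∃ r, y ∈ F r)
    (hG₁ : ∀ x, ∃ r, x ∈ G r) (hd : ∀ r, ∀ y ∈ F (r + 1), D y - d y ∈ F r)
    (hd' : ∀ r, ∀ x ∈ G (r + 1), D' x - d' x ∈ G r) (ha : ∀ r, ∀ y ∈ F r, a y ∈ F r)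
    (hb : ∀ r, ∀ x ∈ G r, b x ∈ F r) (hc : ∀ r, ∀ y ∈ F r, c y ∈ G r)
    (he : ∀ r, ∀ x ∈ G r, e x ∈ G r) : IsQI D D' f := by
  refine ker_le_range_of_filtration (coneD_coneD hD hD' hf)
    (fun z => (a z.1 + b z.2, c z.1 + e z.2)) (fun r => (F r).prod (G r))
    (by rw [hF₀, hG₀, Submodule.prod_bot]) (fun z => ?_) ?_
  · obtain ⟨r, hr⟩ := hF₁ z.1
    obtain ⟨s, hs⟩ := hG₁ z.2
    exact ⟨max r s, hF (le_max_left r s) hr, hG (le_max_right r s) hs⟩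
  · rintro r ⟨y, x⟩ ⟨hy, hx⟩ hz
    rw [coneD_apply, Prod.mk_eq_zero, sub_eq_zero] at hz
    obtain ⟨h1, h2⟩ := hz
    dsimp only at hy hx h1 h2
    have hy' := hd r y hy
    have hx' := hd' r x hx
    -- As `D y = 0`, the estimate on `D y - d y` says that `d y` itself lies in `F r`.
    rw [h1, zero_sub, Submodule.neg_mem_iff] at hy'
    have h3 := hd r _ (Submodule.add_mem _ (ha _ _ hy) (hb _ _ hx))
    have h4 := hd' r _ (Submodule.add_mem _ (hc _ _ hy) (he _ _ hx))
    have e1 := LinearMap.congr_fun h.fst_left y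
    have e2 := LinearMap.congr_fun h.fst_right x
    have e3 := LinearMap.congr_fun h.snd_left y
    have e4 := LinearMap.congr_fun h.snd_right x
    simp only [LinearMap.add_apply, LinearMap.sub_apply, LinearMap.comp_apply, LinearMap.id_apply,
      LinearMap.zero_apply] at e1 e2 e3 e4
    constructor
    · have e5 : y - D (a y + b x) = a (d y) + b (D' x - d' x) - (D (a y + b x) - d (a y + b x)) := by
        rw [h2] at e1
        rw [sub_eq_iff_eq_add]
        refine e1.symm.trans ?_
        rw [map_sub b, map_add d, e2]
        abel
      rw [coneD_apply]
      change y - D (a y + b x) ∈ F r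
      rw [e5]
      exact Submodule.sub_mem _ (Submodule.add_mem _ (ha _ _ hy')
        (hb _ _ hx')) h3
    · have e5 : x - (f (a y + b x) - D' (c y + e x)) =
          c (d y) + e (D' x - d' x) + (D' (c y + e x) - d' (c y + e x)) := by
        have e6 : f (b x) - d' (e x) - e (d' x) + (f (a y) - d' (c y) + c (d y) + e (D' x)) = x := by
          rw [← h2, e3, e4, add_zero]
        rw [sub_eq_iff_eq_add]
        refine e6.symm.trans ?_
        rw [map_sub e, map_add d', map_add f]
        abel
      rw [coneD_apply]
      change x - (f (a y + b x) - D' (c y + e x)) ∈ G r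
      rw [e5]
      exact Submodule.add_mem _ (Submodule.add_mem _ (hc _ _ hy')
        (he _ _ hx')) h4

/-! ### Tensor products of differential modules -/

section tensor
variable {T : Type*} [AddCommGroup T] [Module K T]

/-- The differential of a tensor product, with respect to a sign operator `s` on the left factor. -/
def tensorD (d s : V →ₗ[K] V) (δ : T →ₗ[K] T) : V ⊗[K] T →ₗ[K] V ⊗[K] T :=
  TensorProduct.map d LinearMap.id + TensorProduct.map s δ

theorem tensorD_tmul (d s : V →ₗ[K] V) (δ : T →ₗ[K] T) (x : V) (t : T) :
    tensorD d s δ (x ⊗ₜ t) = d x ⊗ₜ t + s x ⊗ₜ δ t := rfl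

theorem tensorD_tensorD {d s : V →ₗ[K] V} {δ : T →ₗ[K] T} (hd : ∀ y, d (d y) = 0)
    (hs : ∀ y, s (d y) = - d (s y)) (hδ : ∀ t, δ (δ t) = 0) (z : V ⊗[K] T) :
    tensorD d s δ (tensorD d s δ z) = 0 := by
  induction z using TensorProduct.induction_on with
  | zero => simp
  | add z z' h h' => rw [map_add, map_add, h, h', add_zero]
  | tmul x t => simp [tensorD_tmul, hd, hs, hδ, neg_tmul]

/-- A contraction `H` of the left factor need not anticommute with the sign operator `s`, so `H ⊗
id` is a contraction only up to an error `(s H + H s) ⊗ δ`. This error is harmless because `δ² = 0`: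
a filtration with two steps absorbs it. -/
theorem tensorD_ker_le_range {d s : V →ₗ[K] V} {δ : T →ₗ[K] T} (hd : ∀ y, d (d y) = 0)
    (hs : ∀ y, s (d y) = - d (s y)) (hδ : ∀ t, δ (δ t) = 0)
    (h : LinearMap.ker d ≤ LinearMap.range d) :
    LinearMap.ker (tensorD d s δ) ≤ LinearMap.range (tensorD d s δ) := by
  obtain ⟨H, hH⟩ := exists_contraction hd h
  let N : V ⊗[K] T →ₗ[K] V ⊗[K] T := TensorProduct.map (s ∘ₗ H + H ∘ₗ s) LinearMap.id
  let δ' : V ⊗[K] T →ₗ[K] V ⊗[K] T := TensorProduct.map LinearMap.id δ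
  have hN (z) : tensorD d s δ (TensorProduct.map H LinearMap.id z) +
      TensorProduct.map H LinearMap.id (tensorD d s δ z) = z + N (δ' z) := by
    induction z using TensorProduct.induction_on with
    | zero => simp
    | add z z' h h' =>
      simp only [map_add] at h h' ⊢
      rw [add_add_add_comm, h, h', add_add_add_comm]
    | tmul x t =>
      have hx := congrArg (· ⊗ₜ[K] t) (hH x)
      simp only [add_tmul] at hx
      refine Eq.trans ?_ (congrArg (· + N (δ' (x ⊗ₜ[K] t))) hx)
      simp only [N, δ', tensorD_tmul, TensorProduct.map_tmul, LinearMap.id_apply,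
        LinearMap.add_apply, LinearMap.comp_apply, add_tmul, map_add]
      abel
  -- `N` acts on the left factor only, so `δ' N δ'` contains `δ²`.
  have hδN (z) : δ' (N (δ' z)) = 0 := by
    induction z using TensorProduct.induction_on with
    | zero => simp
    | add z z' h h' => simp only [map_add, h, h', add_zero]
    | tmul x t => simp [N, δ', hδ]
  refine ker_le_range_of_filtration (tensorD_tensorD hd hs hδ) (TensorProduct.map H LinearMap.id)
    -- The filtration is `0`, then `ker δ'`, then everything. On `ker δ'` the error `N δ'` is zero,
    -- and on the whole space it takes values in `ker δ'`.
    (fun r => if r = 0 then ⊥ else if r = 1 then LinearMap.ker δ' else ⊤) (if_pos rfl)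
    (fun y => ⟨2, by simp⟩) fun r z hz hDz => ?_
  have h1 := hN z
  rw [hDz, map_zero, add_zero] at h1
  rw [h1, sub_add_cancel_left]
  rcases r with - | r
  · have : δ' z = 0 := by simpa using hz
    simp [this]
  · rcases r with - | r
    · simp [hδN]
    · simp

/-- The cone of `f ⊗ id` is the cone of `f` tensored with `T`, so acyclicity of the latter is
enough. -/
theorem IsQI.rTensor {d s : V →ₗ[K] V} {d' s' : W →ₗ[K] W} {f : V →ₗ[K] W} {δ : T →ₗ[K] T}
    (hd : ∀ y, d (d y) = 0) (hs : ∀ y, s (d y) = - d (s y))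
    (hd' : ∀ y, d' (d' y) = 0) (hs' : ∀ y, s' (d' y) = - d' (s' y))
    (hfd : ∀ y, f (d y) = d' (f y)) (hfs : ∀ y, f (s y) = s' (f y)) (hδ : ∀ t, δ (δ t) = 0)
    (hf : IsQI d d' f) :
    IsQI (tensorD d s δ) (tensorD d' s' δ) (TensorProduct.map f LinearMap.id) := by
  -- The target enters the cone with its differential negated, as a shifted copy; this is why its
  -- sign operator is `-s'`.
  have h := tensorD_ker_le_range (d := coneD d d' f) (s := s.prodMap (-s')) (δ := δ)
    (coneD_coneD hd hd' hfd) (fun z => by simp [coneD_apply, hs, hs', hfs]) hδ hf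
  let e := TensorProduct.prodLeft K K V W T
  have he (z) : coneD (tensorD d s δ) (tensorD d' s' δ) (TensorProduct.map f LinearMap.id) (e z) =
      e (tensorD (coneD d d' f) (s.prodMap (-s')) δ z) := by
    induction z using TensorProduct.induction_on with
    | zero => simp
    | add z z' h h' => simp only [map_add, h, h']
    | tmul x t =>
      obtain ⟨y, x⟩ := x
      simp [e, tensorD_tmul, coneD_apply, sub_tmul, neg_tmul]
      abel
  intro z hz
  obtain ⟨z, rfl⟩ := e.surjective z
  rw [LinearMap.mem_ker, he, LinearEquiv.map_eq_zero_iff] at hz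
  obtain ⟨w, rfl⟩ := h hz
  exact ⟨e w, he w⟩

/-- With the fixed module on the left, the sign operator acts on `T` alone and the matrix entries
need not interact with it. The entries of odd degree, `a` and `e`, pick up the Koszul sign `s` when
moved past `T`; those of even degree do not. -/
theorem IsConeContraction.lTensor {d : V →ₗ[K] V} {d' : W →ₗ[K] W} {f : V →ₗ[K] W}
    {a : V →ₗ[K] V} {b : W →ₗ[K] V} {c : V →ₗ[K] W} {e : W →ₗ[K] W} {δ s : T →ₗ[K] T}
    (hs : ∀ y, s (δ y) = - δ (s y)) (hss : ∀ y, s (s y) = y)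
    (h : IsConeContraction d d' f a b c e) :
    IsConeContraction (tensorD δ s d) (tensorD δ s d') (TensorProduct.map LinearMap.id f)
      (TensorProduct.map s a) (TensorProduct.map LinearMap.id b) (TensorProduct.map LinearMap.id c)
      (TensorProduct.map s e) := by
  constructor
  · refine TensorProduct.ext' fun t y => ?_
    have := congrArg (t ⊗ₜ[K] ·) (LinearMap.congr_fun h.fst_left y)
    simp only [LinearMap.comp_apply, LinearMap.add_apply, tmul_add, LinearMap.id_apply] at this
    refine Eq.trans ?_ this
    simp [tensorD_tmul, hs, hss, neg_tmul]
    abel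
  · refine TensorProduct.ext' fun t y => ?_
    have := LinearMap.congr_fun h.fst_right y
    simp only [LinearMap.comp_apply] at this
    simp [tensorD_tmul, this]
  · refine TensorProduct.ext' fun t y => ?_
    have := congrArg (s t ⊗ₜ[K] ·) (LinearMap.congr_fun h.snd_left y)
    simp only [LinearMap.comp_apply, LinearMap.add_apply, LinearMap.sub_apply, tmul_add, tmul_sub,
      LinearMap.zero_apply, tmul_zero] at this
    simp only [tensorD_tmul, LinearMap.comp_apply, LinearMap.add_apply, LinearMap.sub_apply,
      LinearMap.zero_apply, TensorProduct.map_tmul, LinearMap.id_apply, map_add]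
    rw [← this]
    abel
  · refine TensorProduct.ext' fun t y => ?_
    have := congrArg (t ⊗ₜ[K] ·) (LinearMap.congr_fun h.snd_right y)
    simp only [LinearMap.comp_apply, LinearMap.sub_apply, tmul_sub, LinearMap.id_apply] at this
    refine Eq.trans ?_ this
    simp [tensorD_tmul, hs, hss, neg_tmul]
    abel

end tensor
end Cone

/-! ### Quasi-isomorphisms in terms of elements -/

section
variable {K : Type u} [Field K]

/-- Homology in `ModuleCat` has the concrete model `ker / range`. The two clauses are injectivity
and surjectivity of the induced map on that quotient. -/
theorem shortComplex_quasiIso_iff {S S' : ShortComplex (ModuleCat.{u} K)} (φ : S ⟶ S') :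
    ShortComplex.QuasiIso φ ↔
      (∀ y : S.X₂, S.g.hom y = 0 → (∃ x, φ.τ₂.hom y = S'.f.hom x) → ∃ y', S.f.hom y' = y) ∧
      (∀ x : S'.X₂, S'.g.hom x = 0 →
        ∃ (y : S.X₂) (x' : S'.X₁), S.g.hom y = 0 ∧ x = φ.τ₂.hom y + S'.f.hom x') := by
  have hg (y) : S'.g.hom (φ.τ₂.hom y) = φ.τ₃.hom (S.g.hom y) :=
    LinearMap.congr_fun (ModuleCat.hom_ext_iff.1 φ.comm₂₃) y
  have hf (y) : S'.f.hom (φ.τ₁.hom y) = φ.τ₂.hom (S.f.hom y) :=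
    LinearMap.congr_fun (ModuleCat.hom_ext_iff.1 φ.comm₁₂) y
  let φK : LinearMap.ker S.g.hom →ₗ[K] LinearMap.ker S'.g.hom := φ.τ₂.hom.restrict fun y hy => by
    rw [LinearMap.mem_ker] at hy ⊢
    rw [hg, hy, map_zero]
  let φH := Submodule.mapQ (LinearMap.range S.moduleCatToCycles)
    (LinearMap.range S'.moduleCatToCycles) φK (by
      rintro _ ⟨y, rfl⟩
      exact ⟨φ.τ₁.hom y, Subtype.ext (hf y)⟩)
  -- This identifies the abstract map on homology with `φH`, for the concrete kernel and quotient.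
  let γ : ShortComplex.LeftHomologyMapData φ S.moduleCatLeftHomologyData
      S'.moduleCatLeftHomologyData :=
    { φK := ModuleCat.ofHom φK
      φH := ModuleCat.ofHom φH
      commi := rfl
      commf' := ModuleCat.hom_ext (LinearMap.ext fun y => Subtype.ext (hf y).symm)
      commπ := rfl }
  rw [γ.quasiIso_iff, ConcreteCategory.isIso_iff_bijective]
  change Function.Bijective φH ↔ _
  refine and_congr ?_ ?_
  · rw [injective_iff_map_eq_zero]
    constructor
    · rintro h y hy ⟨x, hx⟩
      have h1 := h (Submodule.Quotient.mk ⟨y, hy⟩) <|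
        (Submodule.Quotient.mk_eq_zero _).2 ⟨x, Subtype.ext hx.symm⟩
      obtain ⟨y', hy'⟩ := (Submodule.Quotient.mk_eq_zero _).1 h1
      exact ⟨y', congrArg Subtype.val hy'⟩
    · intro h z hz
      obtain ⟨⟨y, hy⟩, rfl⟩ := Submodule.Quotient.mk_surjective _ z
      obtain ⟨x, hx⟩ := (Submodule.Quotient.mk_eq_zero _).1 hz
      obtain ⟨y', hy'⟩ := h y hy ⟨x, (congrArg Subtype.val hx).symm⟩
      exact (Submodule.Quotient.mk_eq_zero _).2 ⟨y', Subtype.ext hy'⟩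
  · constructor
    · intro h x hx
      obtain ⟨z, hz⟩ := h (Submodule.Quotient.mk ⟨x, hx⟩)
      obtain ⟨⟨y, hy⟩, rfl⟩ := Submodule.Quotient.mk_surjective _ z
      obtain ⟨x', hx'⟩ := (Submodule.Quotient.eq _).1 hz.symm
      exact ⟨y, x', hy, eq_add_of_sub_eq' (congrArg Subtype.val hx').symm⟩
    · intro h z
      obtain ⟨⟨x, hx⟩, rfl⟩ := Submodule.Quotient.mk_surjective _ z
      obtain ⟨y, x', hy, rfl⟩ := h x hx
      refine ⟨Submodule.Quotient.mk ⟨y, hy⟩, Eq.symm ((Submodule.Quotient.eq _).2 ⟨x', ?_⟩)⟩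
      exact Subtype.ext (add_sub_cancel_left _ _).symm

variable {A B : ChainComplex (ModuleCat.{u} K) ℤ}

/-- A chain map is a quasi-isomorphism if and only if its cone is acyclic. -/
theorem quasiIso_iff_forall (f : A ⟶ B) : QuasiIso f ↔
    ∀ (q : ℤ) (y : A.X q) (x : B.X (q + 1)), (A.d q (q - 1)).hom y = 0 →
      (f.f q).hom y = (B.d (q + 1) q).hom x → ∃ (y' : A.X (q + 1)) (x' : B.X (q + 1 + 1)),
        (A.d (q + 1) q).hom y' = y ∧ (f.f (q + 1)).hom y' - (B.d (q + 1 + 1) (q + 1)).hom x' = x := by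
  have hf (i j : ℤ) (y : A.X i) : (f.f j).hom ((A.d i j).hom y) = (B.d i j).hom ((f.f i).hom y) :=
    (LinearMap.congr_fun (ModuleCat.hom_ext_iff.1 (f.comm i j)) y).symm
  have hd (C : ChainComplex (ModuleCat.{u} K) ℤ) (i j k : ℤ) (x : C.X i) :
      (C.d j k).hom ((C.d i j).hom x) = 0 :=
    LinearMap.congr_fun (ModuleCat.hom_ext_iff.1 (C.d_comp_d i j k)) x
  have key (q : ℤ) : QuasiIsoAt f q ↔
      (∀ y : A.X q, (A.d q (q - 1)).hom y = 0 → (∃ x, (f.f q).hom y = (B.d (q + 1) q).hom x) →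
        ∃ y', (A.d (q + 1) q).hom y' = y) ∧
      (∀ x : B.X q, (B.d q (q - 1)).hom x = 0 →
        ∃ (y : A.X q) (x' : B.X (q + 1)), (A.d q (q - 1)).hom y = 0 ∧
          x = (f.f q).hom y + (B.d (q + 1) q).hom x') := by
    rw [quasiIsoAt_iff' f (q + 1) q (q - 1) (by simp) (by simp)]
    exact shortComplex_quasiIso_iff _
  rw [quasiIso_iff]
  constructor
  · intro h q y x hy hx
    -- Injectivity in degree `q` bounds `y` by some `y₀`. Then `x - f y₀` is a cycle in degree `q +
    -- 1`, and surjectivity there writes it as an image plus a boundary.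
    obtain ⟨y₀, rfl⟩ := ((key q).1 (h q)).1 y hy ⟨x, hx⟩
    have h2 := ((key (q + 1)).1 (h (q + 1))).2
    rw [add_sub_cancel_right] at h2
    obtain ⟨y₁, x₁, h3, h4⟩ := h2 (x - (f.f (q + 1)).hom y₀) (by
      rw [map_sub, ← hx, hf, sub_self])
    refine ⟨y₀ + y₁, -x₁, by rw [map_add, h3, add_zero], ?_⟩
    rw [map_add, map_neg, sub_neg_eq_add, add_assoc, ← h4]
    abel
  · intro h q
    rw [key]
    constructor
    · rintro y hy ⟨x, hx⟩
      obtain ⟨y', -, h1, -⟩ := h q y x hy hx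
      exact ⟨y', h1⟩
    · intro x hx
      -- Surjectivity in degree `q + 1` is the cone condition in degree `q` with first component
      -- `0`.
      obtain ⟨q, rfl⟩ : ∃ r, q = r + 1 := ⟨q - 1, by ring⟩
      rw [add_sub_cancel_right] at hx ⊢
      obtain ⟨y', x', h1, h2⟩ := h q 0 x (map_zero _) (by rw [map_zero, hx])
      exact ⟨y', -x', h1, by rw [← h2, map_neg, sub_eq_add_neg]⟩

/-- Removes the index `q + 1 - 1`, which equals `q` only propositionally and so cannot be rewritten
directly inside a dependent summand. -/
theorem totD_lof_succ (q : ℤ) (x : A.X (q + 1)) : totD A (lof K ℤ (fun i => A.X i) (q + 1) x) =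
    lof K ℤ (fun i => A.X i) q ((A.d (q + 1) q).hom x) := by
  rw [totD_lof]
  generalize hr : q + 1 - 1 = r
  obtain rfl : r = q := by omega
  rfl

/-- The cone of the total map is the direct sum of its homogeneous parts, and a cycle is a finite
sum of pairs `(y_q, x_{q+1})`. Each of these is a cycle, to which the degreewise criterion applies.
-/
theorem isQI_totMap (f : A ⟶ B) (hf : QuasiIso f) : IsQI (totD A) (totD B) (totMap f) := by
  classical
  rw [quasiIso_iff_forall] at hf
  have hD (C : ChainComplex (ModuleCat.{u} K) ℤ) (x : Tot C) (q : ℤ) :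
      totD C x q = (C.d (q + 1) q).hom (x (q + 1)) := by
    induction x using DirectSum.induction_on with
    | zero => simp
    | add x y hx hy => simp [hx, hy]
    | of i x =>
      change totD C (lof K ℤ (fun i => C.X i) i x) q = _
      change _ = (C.d (q + 1) q).hom (lof K ℤ (fun i => C.X i) i x (q + 1))
      by_cases h : i = q + 1
      · subst h
        rw [totD_lof_succ, lof_apply, lof_apply]
      · rw [totD_lof, lof_eq_of, lof_eq_of, of_eq_of_ne _ _ _ (by omega), of_eq_of_ne _ _ _ (Ne.symm h),
          map_zero]
  intro z hz
  rw [LinearMap.mem_ker, coneD_apply, Prod.mk_eq_zero, sub_eq_zero] at hz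
  obtain ⟨y, x⟩ := z
  obtain ⟨hy, hx⟩ := hz
  have hsum : ∀ C : ChainComplex (ModuleCat.{u} K) ℤ, ∀ w : Tot C, ∀ s : Finset ℤ,
      (∀ i, w i ≠ 0 → i ∈ s) → w = ∑ i ∈ s, lof K ℤ (fun i => C.X i) i (w i) := by
    intro C w s hs
    conv_lhs => rw [← DirectSum.sum_support_of w]
    refine Finset.sum_subset (fun i hi => hs i (by simpa using hi)) fun i _ hi => ?_
    rw [DFinsupp.mem_support_iff, not_not] at hi
    rw [hi, map_zero]
  -- All `q` with `y_q` or `x_{q+1}` nonzero: the support of `x` is shifted down by one to be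
  -- indexed by the degree of the first component.
  let S := DFinsupp.support y ∪ (DFinsupp.support x).image (· - 1)
  have h1 := hsum A y S fun i hi => Finset.mem_union_left _ (by simpa using hi)
  have h2 := hsum B x (S.image (· + 1)) fun i hi => Finset.mem_image.2 ⟨i - 1,
    Finset.mem_union_right _ (Finset.mem_image.2 ⟨i, by simpa using hi, rfl⟩), by ring⟩
  rw [Finset.sum_image (by simp)] at h2
  have h3 : ((y, x) : Tot A × Tot B) = ∑ q ∈ S, (lof K ℤ (fun i => A.X i) q (y q),
      lof K ℤ (fun i => B.X i) (q + 1) (x (q + 1))) := by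
    exact Prod.ext (by rw [Prod.fst_sum, ← h1]) (by rw [Prod.snd_sum, ← h2])
  rw [h3]
  refine Submodule.sum_mem _ fun q _ => ?_
  obtain ⟨y', x', h4, h5⟩ := hf q (y q) (x (q + 1)) (by
      have := hD A y (q - 1)
      rw [hy, sub_add_cancel] at this
      exact this.symm)
    (by
      rw [← hD, ← hx]
      exact (lmap_apply (fun i => (f.f i).hom) y q).symm)
  refine ⟨(lof K ℤ (fun i => A.X i) (q + 1) y', lof K ℤ (fun i => B.X i) (q + 1 + 1) x'), ?_⟩
  rw [coneD_apply, totD_lof_succ, totMap_lof, totD_lof_succ, ← h4, ← h5, map_sub]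

end

/-! ### Tensor powers of quasi-isomorphisms -/

section
variable {K : Type u} [Field K] {A B : ChainComplex (ModuleCat.{u} K) ℤ}

theorem consMap_bijective (n : ℕ) : Function.Bijective (consMap A n) := by
  let g : TPow A (n + 1) →ₗ[K] Tot A ⊗[K] TPow A n :=
    PiTensorProduct.lift (LinearMap.uncurryLeft (M := fun _ : Fin (n + 1) => Tot A)
      (PiTensorProduct.lift.symm.toLinearMap ∘ₗ TensorProduct.mk K (Tot A) (TPow A n)))
  have hg (x : Tot A) (a : Fin n → Tot A) :
      g (PiTensorProduct.tprod K (Fin.cons x a)) = x ⊗ₜ PiTensorProduct.tprod K a := by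
    simp [g]
  have h1 : g ∘ₗ consMap A n = LinearMap.id := by
    refine TensorProduct.ext (LinearMap.ext fun x => PiTensorProduct.ext (MultilinearMap.ext fun a => ?_))
    simp [consMap_tprod, hg]
  have h2 : consMap A n ∘ₗ g = LinearMap.id := by
    refine PiTensorProduct.ext (MultilinearMap.ext fun a => ?_)
    simp only [LinearMap.compMultilinearMap_apply, LinearMap.comp_apply, LinearMap.id_apply]
    rw [← Fin.cons_self_tail a, hg, consMap_tprod]
  exact ⟨Function.LeftInverse.injective (g := g) (LinearMap.congr_fun h1),
    Function.RightInverse.surjective (g := g) (LinearMap.congr_fun h2)⟩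

/-- The isomorphism `A ⊗ A^{⊗n} ≃ A^{⊗(n+1)}`. -/
def consEquiv (A : ChainComplex (ModuleCat.{u} K) ℤ) (n : ℕ) :
    Tot A ⊗[K] TPow A n ≃ₗ[K] TPow A (n + 1) :=
  LinearEquiv.ofBijective (consMap A n) (consMap_bijective n)

theorem tpowD_consMap' {n : ℕ} (z : Tot A ⊗[K] TPow A n) :
    tpowD A (n + 1) (consMap A n z) = consMap A n (tensorD (totD A) (sgn A) (tpowD A n) z) := by
  induction z using TensorProduct.induction_on with
  | zero => simp
  | add z z' h h' => simp only [map_add, h, h']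
  | tmul x v => rw [tpowD_consMap, tensorD_tmul, map_add]

theorem tpowMap_consMap' (f : A ⟶ B) {n : ℕ} (z : Tot A ⊗[K] TPow A n) :
    tpowMap f (n + 1) (consMap A n z) =
      consMap B n (TensorProduct.map (totMap f) (tpowMap f n) z) := by
  induction z using TensorProduct.induction_on with
  | zero => simp
  | add z z' h h' => simp only [map_add, h, h']
  | tmul x v => rw [tpowMap_consMap, TensorProduct.map_tmul]

/-- The tensor powers of a quasi-isomorphism are quasi-isomorphisms. -/
theorem isQI_tpowMap (f : A ⟶ B) (hf : IsQI (totD A) (totD B) (totMap f)) (n : ℕ) :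
    IsQI (tpowD A n) (tpowD B n) (tpowMap f n) := by
  induction n with
  | zero =>
    -- The empty tensor power does not depend on the complex: the inverse is induced by the empty
    -- family of maps.
    have hid : tpowMap f 0 ∘ₗ PiTensorProduct.map (fun i => i.elim0) = LinearMap.id := by
      refine PiTensorProduct.ext (MultilinearMap.ext fun a => ?_)
      simp only [LinearMap.compMultilinearMap_apply, LinearMap.comp_apply, LinearMap.id_apply,
        PiTensorProduct.map_tprod, tpowMap_tprod]
      exact congrArg _ (Subsingleton.elim _ _)
    have hid' : PiTensorProduct.map (fun i => i.elim0) ∘ₗ tpowMap f 0 = LinearMap.id := by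
      refine PiTensorProduct.ext (MultilinearMap.ext fun a => ?_)
      simp only [LinearMap.compMultilinearMap_apply, LinearMap.comp_apply, LinearMap.id_apply,
        PiTensorProduct.map_tprod, tpowMap_tprod]
      exact congrArg _ (Subsingleton.elim _ _)
    exact IsQI.of_bijective (tpowMap_tpowD f)
      ⟨Function.LeftInverse.injective (LinearMap.congr_fun hid'),
        Function.RightInverse.surjective (LinearMap.congr_fun hid)⟩
  | succ n ih =>
    -- Under `A^{⊗(n+1)} ≃ A ⊗ A^{⊗n}`, the power of `f` factors as `f ⊗ id` followed by `id ⊗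
    -- f^{⊗n}`. The first factor is handled by tensoring an acyclic cone, the second by tensoring a
    -- contraction.
    have h1 := IsQI.rTensor totD_totD sgn_totD totD_totD sgn_totD (totMap_totD f) (totMap_sgn f)
      (tpowD_tpowD (A := A) (n := n)) hf
    obtain ⟨a, b, c, e, h⟩ := ih.exists_contraction tpowD_tpowD tpowD_tpowD (tpowMap_tpowD f)
    have h2 := (h.lTensor (sgn_totD (A := B)) sgn_sgn).isQI
    have h3 := h2.comp (fun z => ?_) (fun z => ?_) h1
    · rw [← TensorProduct.map_comp, LinearMap.id_comp, LinearMap.comp_id] at h3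
      exact h3.of_equiv (consEquiv A n) (consEquiv B n) tpowD_consMap' tpowD_consMap'
        (tpowMap_consMap' f)
    · induction z using TensorProduct.induction_on with
      | zero => simp
      | add z z' h h' => simp only [map_add, h, h']
      | tmul x v => simp [tensorD_tmul, tpowMap_tpowD]
    · induction z using TensorProduct.induction_on with
      | zero => simp
      | add z z' h h' => simp only [map_add, h, h']
      | tmul x v => simp [tensorD_tmul, totMap_totD, totMap_sgn]

/-! ### The action of the symmetric groups on tensor powers -/

/-- Sorting by `τ` and then by `σ` is the passage through an intermediate ordering, so this is an
instance of `koszulSign_trans`. It makes the signed permutations of tensors a group action,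
`permMap_mul`. -/
theorem permSign_mul {n : ℕ} (σ τ : Equiv.Perm (Fin n)) (p : Fin n → ℤ) :
    permSign (σ * τ) p = permSign τ p * permSign σ fun i => p (τ.symm i) := by
  have h : permSign σ (fun i => p (τ.symm i)) =
      koszulSign (fun i => (τ i : ℕ)) (fun i => (σ (τ i) : ℕ)) p := by
    unfold permSign
    rw [← koszulSign_equiv τ]
    simp
  rw [h]
  exact (koszulSign_trans Fin.val_injective (Fin.val_injective.comp τ.injective)
    (Fin.val_injective.comp (σ.injective.comp τ.injective)) p).symm

theorem permMap_mul {n : ℕ} (σ τ : Equiv.Perm (Fin n)) :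
    permMap A (σ * τ) = permMap A σ ∘ₗ permMap A τ := by
  refine tpow_ext fun p a ha => ?_
  rw [LinearMap.comp_apply, permMap_tprod _ ha, permMap_tprod _ ha, map_smul,
    permMap_tprod σ (p := fun i => p (τ.symm i)) fun i => ha _, smul_smul, ← map_mul, permSign_mul]
  rfl

theorem SModule.act_mul (M : SModule K) {n : ℕ} (σ τ : Equiv.Perm (Fin n)) :
    M.act (σ * τ) = M.act σ ∘ₗ M.act τ := by
  rw [SModule.act, map_mul]
  exact totMap_comp _ _

theorem diagAct_mul (M : SModule K) {n : ℕ} (σ τ : Equiv.Perm (Fin n)) :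
    diagAct M A (σ * τ) = diagAct M A σ ∘ₗ diagAct M A τ := by
  rw [diagAct, SModule.act_mul, permMap_mul, TensorProduct.map_comp]
  rfl

end

/-! ### Coinvariants of projective modules -/

/-- One direction of Higman's criterion. -/
theorem exists_sum_conj_eq {K G V : Type*} [Field K] [Group G] [Fintype G] [AddCommGroup V]
    [Module K V] (ρ : Representation K G V) (h : Module.Projective (MonoidAlgebra K G) ρ.asModule) :
    ∃ θ : V →ₗ[K] V, ∀ x, ∑ g, ρ g⁻¹ (θ (ρ g x)) = x := by
  obtain ⟨s, hs⟩ := Module.projective_def'.1 h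
  -- The coefficient at the identity, which splits the averaging map on a free module. Composing it
  -- with a section `s` of the free cover gives `θ`.
  let c : MonoidAlgebra K G →ₗ[K] K :=
    { toFun r := r.coeff 1, map_add' _ _ := rfl, map_smul' _ _ := rfl }
  let L : (ρ.asModule →₀ MonoidAlgebra K G) →ₗ[K] V :=
    Finsupp.lsum K fun m => c.smulRight (ρ.asModuleEquiv m)
  -- For one basis element this reads `∑ g⁻¹ r(g⁻¹) m = r m`: averaging `L` recovers the canonical
  -- map from the free module.
  have hL (w : ρ.asModule →₀ MonoidAlgebra K G) :
      ∑ g, ρ g⁻¹ (L (MonoidAlgebra.of K G g • w)) =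
        ρ.asModuleEquiv (Finsupp.linearCombination (MonoidAlgebra K G) id w) := by
    induction w using Finsupp.induction_linear with
    | zero => simp
    | add w w' h h' => simp only [smul_add, map_add, Finset.sum_add_distrib, h, h']
    | single m r =>
      have hc (g : G) : c (MonoidAlgebra.of K G g * r) = r.coeff g⁻¹ := by
        have := MonoidAlgebra.coeff_single_mul_mul r (1 : K) g g⁻¹
        rw [mul_inv_cancel, one_mul] at this
        exact this
      simp only [L, Finsupp.smul_single, smul_eq_mul, Finsupp.lsum_single,
        LinearMap.smulRight_apply, hc, map_smul, Finsupp.linearCombination_single, id_eq,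
        Representation.asModuleEquiv_map_smul, Representation.asAlgebraHom_def,
        MonoidAlgebra.lift_apply]
      rw [← Equiv.sum_comp (Equiv.inv G), Finsupp.sum_fintype _ _ (by simp),
        LinearMap.sum_apply]
      simp
  refine ⟨L ∘ₗ s.restrictScalars K ∘ₗ ρ.asModuleEquiv.symm.toLinearMap, fun x => ?_⟩
  -- Equivariance of `s` turns the average of `L ∘ s` into the average of `L` at `s x`; then `s` is
  -- a section of the canonical map.
  have h1 (g : G) : s (ρ.asModuleEquiv.symm (ρ g x)) =
      MonoidAlgebra.of K G g • s (ρ.asModuleEquiv.symm x) := by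
    rw [Representation.asModuleEquiv_symm_map_rho, map_smul]
  have h2 := hL (s (ρ.asModuleEquiv.symm x))
  simp only [← h1] at h2
  refine h2.trans ?_
  rw [← LinearMap.comp_apply, hs, LinearMap.id_apply, LinearEquiv.apply_symm_apply]

/-! ### Averaged operators on `M ∘ A` -/

section
variable {K : Type u} [Field K] {M : SModule K} {A B D : ChainComplex (ModuleCat.{u} K) ℤ}

/-- Higman's criterion is applied in each degree separately, so that `θ` preserves degrees. This is
needed both for the signs and for the filtration. -/
theorem SModule.IsProjective.exists_sum_conj_eq (hM : M.IsProjective) :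
    ∃ θ : ∀ n, Tot (M.X n) →ₗ[K] Tot (M.X n), (∀ n q, ∀ x ∈ gr (M.X n) q, θ n x ∈ gr (M.X n) q) ∧
      ∀ n x, ∑ g : Equiv.Perm (Fin n), M.act g⁻¹ (θ n (M.act g x)) = x := by
  choose θ hθ using fun n d => OperadicBar.exists_sum_conj_eq (M.rep n d) (hM n d)
  refine ⟨fun n => DirectSum.lmap (θ n), ?_, fun n x => ?_⟩
  · rintro n q _ ⟨x, rfl⟩
    exact ⟨θ n q x, (lmap_lof ..).symm⟩
  · induction x using Tot.induction with
    | hadd x y hx hy => simp only [map_add, Finset.sum_add_distrib, hx, hy]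
    | h q x hx =>
      obtain ⟨x, rfl⟩ := hx
      conv_rhs => rw [← hθ n q x, map_sum]
      refine Finset.sum_congr rfl fun g _ => ?_
      change totMap (M.ρ n g⁻¹) (lmap (θ n) (totMap (M.ρ n g) _)) = _
      rw [totMap_lof, lmap_lof, totMap_lof]
      rfl

theorem commute_sgn {φ : Tot A →ₗ[K] Tot A} (hφ : ∀ q, ∀ x ∈ gr A q, φ x ∈ gr A q) (x : Tot A) :
    φ (sgn A x) = sgn A (φ x) := by
  induction x using Tot.induction with
  | hadd x y hx hy => simp only [map_add, hx, hy]
  | h q x hx => rw [sgn_of_mem hx, sgn_of_mem (hφ q x hx), map_smul]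

/-- The map `M ∘ A → M ∘ B` induced by the maps
`z ↦ ∑_g (ψ ⊗ φ) (g z)` from `M(n) ⊗ A^{⊗n}` to `M(n) ⊗ B^{⊗n}`. -/
def transfer (ψ : ∀ n, Tot (M.X n) →ₗ[K] Tot (M.X n)) (φ : ∀ n, TPow A n →ₗ[K] TPow B n) :
    Comp M A →ₗ[K] Comp M B :=
  toModule K ℕ _ fun n => (coinvRel M A n).liftQ
    (∑ g, Comp.mk M B n ∘ₗ TensorProduct.map (ψ n) (φ n) ∘ₗ diagAct M A g) <| by
      refine Submodule.span_le.2 ?_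
      rintro _ ⟨σ, z, rfl⟩
      rw [SetLike.mem_coe, LinearMap.mem_ker, map_sub, sub_eq_zero, LinearMap.sum_apply,
        LinearMap.sum_apply]
      -- Acting by `σ` first only reindexes the sum by `g ↦ g σ`; this is what makes a
      -- non-equivariant map descend to coinvariants.
      refine Fintype.sum_equiv (Equiv.mulRight σ) _ _ fun g => ?_
      rw [Equiv.coe_mulRight, diagAct_mul]
      rfl

variable (ψ : ∀ n, Tot (M.X n) →ₗ[K] Tot (M.X n)) (φ : ∀ n, TPow A n →ₗ[K] TPow B n)

theorem transfer_mk {n : ℕ} (z : Tot (M.X n) ⊗[K] TPow A n) : transfer ψ φ (Comp.mk M A n z) =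
    ∑ g, Comp.mk M B n (TensorProduct.map (ψ n) (φ n) (diagAct M A g z)) := by
  refine ((toModule_lof ..).trans (Submodule.liftQ_apply ..)).trans ?_
  rw [LinearMap.sum_apply]
  rfl

theorem Comp.hom_ext {V : Type*} [AddCommGroup V] [Module K V] {f g : Comp M A →ₗ[K] V}
    (h : ∀ n z, f (Comp.mk M A n z) = g (Comp.mk M A n z)) : f = g := by
  refine LinearMap.ext fun x => ?_
  induction x using Comp.induction with
  | h n z => exact h n z
  | hadd x y hx hy => rw [map_add, map_add, hx, hy]

theorem transfer_add (φ' : ∀ n, TPow A n →ₗ[K] TPow B n) :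
    transfer ψ (φ + φ') = transfer ψ φ + transfer ψ φ' :=
  Comp.hom_ext fun n z => by
    simp only [LinearMap.add_apply, transfer_mk, Pi.add_apply, TensorProduct.map_add_right, map_add,
      Finset.sum_add_distrib]

theorem transfer_zero : transfer ψ (0 : ∀ n, TPow A n →ₗ[K] TPow B n) = 0 :=
  Comp.hom_ext fun n z => by simp [transfer_mk]

theorem transfer_sub (φ' : ∀ n, TPow A n →ₗ[K] TPow B n) :
    transfer ψ (φ - φ') = transfer ψ φ - transfer ψ φ' := by
  rw [eq_sub_iff_add_eq, ← transfer_add]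
  exact congrArg (transfer ψ) (funext fun n => LinearMap.ext fun v =>
    sub_add_cancel (φ n v) (φ' n v))

/-- In the coinvariants the term `ψ(g x) ⊗ g v` equals `g⁻¹ ψ(g x) ⊗ v`. The sum over `g` is then `x
⊗ v` by the averaging identity. -/
theorem transfer_id (hψ : ∀ n x, ∑ g : Equiv.Perm (Fin n), M.act g⁻¹ (ψ n (M.act g x)) = x) :
    transfer (A := A) ψ (fun _ => LinearMap.id) = LinearMap.id :=
  Comp.hom_ext fun n z => by
    rw [transfer_mk, LinearMap.id_apply]
    induction z using TensorProduct.induction_on with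
    | zero => simp
    | add z z' h h' => simp only [map_add, Finset.sum_add_distrib, h, h']
    | tmul x v =>
      conv_rhs => rw [← hψ n x, sum_tmul, map_sum]
      refine Finset.sum_congr rfl fun g _ => ?_
      rw [← mk_diagAct M A g⁻¹, diagAct, diagAct, TensorProduct.map_tmul, TensorProduct.map_tmul,
        TensorProduct.map_tmul, LinearMap.id_apply, ← LinearMap.comp_apply (permMap A g⁻¹),
        ← permMap_mul, inv_mul_cancel, permMap_one, LinearMap.id_apply]

theorem compMap_transfer (f : B ⟶ D) :
    compMap f M ∘ₗ transfer ψ φ = transfer ψ fun n => tpowMap f n ∘ₗ φ n :=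
  Comp.hom_ext fun n z => by
    simp only [LinearMap.comp_apply, transfer_mk, map_sum, compMap_mk]
    refine Finset.sum_congr rfl fun g _ => ?_
    rw [← LinearMap.comp_apply (TensorProduct.map _ _), ← TensorProduct.map_comp,
      LinearMap.id_comp]

/-- Composition on this side has to commute with every `g`, so it rests on the equivariance of
`f^{⊗n}`; composition on the other side does not. -/
theorem transfer_compMap (f : D ⟶ A) :
    transfer ψ φ ∘ₗ compMap f M = transfer ψ fun n => φ n ∘ₗ tpowMap f n :=
  Comp.hom_ext fun n z => by
    simp only [LinearMap.comp_apply, transfer_mk, compMap_mk]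
    refine Finset.sum_congr rfl fun g _ => ?_
    congr 1
    induction z using TensorProduct.induction_on with
    | zero => simp only [map_zero]
    | add z z' h h' => simp only [map_add, h, h']
    | tmul x v => simp [diagAct, tpowMap_permMap]

/-- The differential of `M ∘ A` induced by the differential of `A`. -/
def compD (M : SModule K) (A : ChainComplex (ModuleCat.{u} K) ℤ) : Comp M A →ₗ[K] Comp M A :=
  toModule K ℕ _ fun n => (coinvRel M A n).liftQ
    (Comp.mk M A n ∘ₗ TensorProduct.map (sgn (M.X n)) (tpowD A n)) <| by
      refine Submodule.span_le.2 ?_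
      rintro _ ⟨σ, z, rfl⟩
      rw [SetLike.mem_coe, LinearMap.mem_ker, map_sub, sub_eq_zero, LinearMap.comp_apply,
        LinearMap.comp_apply, ← mk_diagAct M A σ (TensorProduct.map _ (tpowD A n) z)]
      congr 1
      induction z using TensorProduct.induction_on with
      | zero => simp only [map_zero]
      | add z z' h h' => simp only [map_add, h, h']
      | tmul x v => simp [diagAct, tpowD_permMap, SModule.act_sgn]

theorem compD_mk {n : ℕ} (z : Tot (M.X n) ⊗[K] TPow A n) :
    compD M A (Comp.mk M A n z) =
      Comp.mk M A n (TensorProduct.map (sgn (M.X n)) (tpowD A n) z) :=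
  (toModule_lof ..).trans (Submodule.liftQ_apply ..)

/-- The differential carries the Koszul sign of the factor in `M`, which is why a sign operator
appears next to `ψ`. -/
theorem compD_transfer : compD M B ∘ₗ transfer ψ φ =
    transfer (fun n => sgn (M.X n) ∘ₗ ψ n) fun n => tpowD B n ∘ₗ φ n :=
  Comp.hom_ext fun n z => by
    simp only [LinearMap.comp_apply, transfer_mk, map_sum, compD_mk]
    refine Finset.sum_congr rfl fun g _ => ?_
    rw [← LinearMap.comp_apply (TensorProduct.map _ _), ← TensorProduct.map_comp]

theorem transfer_compD : transfer ψ φ ∘ₗ compD M A =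
    transfer (fun n => ψ n ∘ₗ sgn (M.X n)) fun n => φ n ∘ₗ tpowD A n :=
  Comp.hom_ext fun n z => by
    simp only [LinearMap.comp_apply, transfer_mk, compD_mk]
    refine Finset.sum_congr rfl fun g _ => ?_
    congr 1
    induction z using TensorProduct.induction_on with
    | zero => simp only [map_zero]
    | add z z' h h' => simp only [map_add, h, h']
    | tmul x v => simp [diagAct, tpowD_permMap, SModule.act_sgn]

/-- A contraction of the cones of the tensor powers of `f` induces a contraction of the cone of
`M ∘ f`. -/
theorem isConeContraction_transfer {f : A ⟶ B}
    (hψ : ∀ n x, ∑ g : Equiv.Perm (Fin n), M.act g⁻¹ (ψ n (M.act g x)) = x)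
    (hψ' : ∀ n x, ψ n (sgn (M.X n) x) = sgn (M.X n) (ψ n x))
    {a : ∀ n, TPow A n →ₗ[K] TPow A n} {b : ∀ n, TPow B n →ₗ[K] TPow A n}
    {c : ∀ n, TPow A n →ₗ[K] TPow B n} {e : ∀ n, TPow B n →ₗ[K] TPow B n}
    (h : ∀ n, IsConeContraction (tpowD A n) (tpowD B n) (tpowMap f n) (a n) (b n) (c n) (e n)) :
    IsConeContraction (compD M A) (compD M B) (compMap f M)
      (transfer (fun n => ψ n ∘ₗ sgn (M.X n)) a) (transfer ψ b) (transfer ψ c)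
      (transfer (fun n => ψ n ∘ₗ sgn (M.X n)) e) := by
  -- Each composition with `compD` contributes one sign operator next to `ψ`. The odd entries `a`
  -- and `e` are transferred with `ψ ∘ sgn`, so in every contraction identity all terms end up with
  -- the same operator, `ψ` or `ψ ∘ sgn`, and additivity of `transfer` applies.
  have h1 (n) : sgn (M.X n) ∘ₗ ψ n = ψ n ∘ₗ sgn (M.X n) := LinearMap.ext fun x => (hψ' n x).symm
  have h2 (n) : (ψ n ∘ₗ sgn (M.X n)) ∘ₗ sgn (M.X n) = ψ n :=
    LinearMap.ext fun x => congrArg (ψ n) (sgn_sgn x)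
  have h3 (n) : sgn (M.X n) ∘ₗ ψ n ∘ₗ sgn (M.X n) = ψ n :=
    (LinearMap.comp_assoc ..).symm.trans ((congrArg (· ∘ₗ sgn (M.X n)) (h1 n)).trans (h2 n))
  constructor
  · rw [compD_transfer, transfer_compD, transfer_compMap]
    simp only [h2, h3]
    rw [← transfer_add, ← transfer_add, ← transfer_id (A := A) ψ hψ]
    exact congrArg _ (funext fun n => (h n).fst_left)
  · rw [compD_transfer, transfer_compD]
    simp only [h1]
    exact congrArg _ (funext fun n => (h n).fst_right)
  · rw [compD_transfer, transfer_compD, transfer_compMap, compMap_transfer]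
    simp only [h1]
    rw [← transfer_sub, ← transfer_add, ← transfer_add, ← transfer_zero (A := A) (B := B)]
    exact congrArg _ (funext fun n => (h n).snd_left)
  · rw [compD_transfer, transfer_compD, compMap_transfer]
    simp only [h2, h3]
    rw [← transfer_sub, ← transfer_sub, ← transfer_id (A := B) ψ hψ]
    exact congrArg _ (funext fun n => (h n).snd_right)

/-! ### The filtration by the degree in the cooperad -/

/-- The part of `M ∘ A` in which the degree of the factor in `M` is less than `r`. -/
def Comp.filt (M : SModule K) (A : ChainComplex (ModuleCat.{u} K) ℤ) (r : ℕ) :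
    Submodule K (Comp M A) :=
  Submodule.span K {z | ∃ (n : ℕ) (q : ℤ) (x : Tot (M.X n)) (v : TPow A n),
    x ∈ OperadicBar.gr (M.X n) q ∧ q < r ∧ z = Comp.mk M A n (x ⊗ₜ[K] v)}

theorem Comp.mk_mem_filt {n r : ℕ} {q : ℤ} {x : Tot (M.X n)} (hx : x ∈ OperadicBar.gr (M.X n) q)
    (hq : q < r) (v : TPow A n) : Comp.mk M A n (x ⊗ₜ[K] v) ∈ Comp.filt M A r :=
  Submodule.subset_span ⟨n, q, x, v, hx, hq, rfl⟩

theorem Comp.filt_mono : Monotone (Comp.filt M A) := by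
  refine fun r s hrs => Submodule.span_mono ?_
  rintro _ ⟨n, q, x, v, hx, hq, rfl⟩
  exact ⟨n, q, x, v, hx, hq.trans_le (by exact_mod_cast hrs), rfl⟩

/-- The bound defining the filtration is strict, so at `r = 0` only negative degrees of `M` occur,
and these vanish. This is where the induction stops. -/
theorem Comp.filt_zero (hM : M.IsNonneg) : Comp.filt M A 0 = ⊥ := by
  rw [eq_bot_iff]
  refine Submodule.span_le.2 ?_
  rintro _ ⟨n, q, _, v, ⟨x, rfl⟩, hq, rfl⟩
  have := hM n q hq
  rw [Subsingleton.elim x 0, map_zero, zero_tmul, map_zero]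
  exact Submodule.zero_mem _

theorem Comp.exists_mem_filt (x : Comp M A) : ∃ r, x ∈ Comp.filt M A r := by
  have hadd : ∀ x y : Comp M A, (∃ r, x ∈ Comp.filt M A r) → (∃ r, y ∈ Comp.filt M A r) →
      ∃ r, x + y ∈ Comp.filt M A r := by
    rintro x y ⟨r, hx⟩ ⟨s, hy⟩
    exact ⟨max r s, Submodule.add_mem _ (Comp.filt_mono (le_max_left r s) hx)
      (Comp.filt_mono (le_max_right r s) hy)⟩
  induction x using Comp.induction with
  | hadd x y hx hy => exact hadd x y hx hy
  | h n z =>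
    induction z using TensorProduct.induction_on with
    | zero => exact ⟨0, by rw [map_zero]; exact Submodule.zero_mem _⟩
    | add z z' h h' => rw [map_add]; exact hadd _ _ h h'
    | tmul x v =>
      induction x using Tot.induction with
      | hadd x y hx hy => rw [add_tmul, map_add]; exact hadd _ _ hx hy
      -- The strict bound calls for `q + 1`; when it is negative, truncation to `0` is still large
      -- enough.
      | h q x hx => exact ⟨(q + 1).toNat, Comp.mk_mem_filt hx (by omega) v⟩

/-- Only the degree of the factor in `M` matters, and both `ψ` and the group action preserve it; `φ`
is arbitrary. -/
theorem transfer_mem_filt {ψ : ∀ n, Tot (M.X n) →ₗ[K] Tot (M.X n)}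
    (hψ : ∀ n q, ∀ x ∈ gr (M.X n) q, ψ n x ∈ gr (M.X n) q) {r : ℕ} {x : Comp M A}
    (hx : x ∈ Comp.filt M A r) : transfer ψ φ x ∈ Comp.filt M B r := by
  induction hx using Submodule.span_induction with
  | zero => rw [map_zero]; exact Submodule.zero_mem _
  | add x y _ _ hx hy => rw [map_add]; exact Submodule.add_mem _ hx hy
  | smul c x _ hx => rw [map_smul]; exact Submodule.smul_mem _ _ hx
  | mem x hx =>
    obtain ⟨n, q, x, v, hx, hq, rfl⟩ := hx
    rw [transfer_mk]
    refine Submodule.sum_mem _ fun g _ => ?_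
    rw [diagAct, TensorProduct.map_tmul, TensorProduct.map_tmul]
    exact Comp.mk_mem_filt (hψ n q _ (totMap_mem _ hx)) hq _

end

/-! ### The bar differential as a perturbation of `compD` -/

section
variable {K : Type u} [Field K] {C : Cooperad K} {P : Operad K} (α : Twisting C P)

/-- The terms of the bar differential other than the one induced by the differential of the
algebra lower the degree in the cooperad. -/
theorem barD_sub_compD_mem_filt (A : Algebra P) (hP : P.IsNonneg) {r : ℕ}
    {x : Comp C.toSModule A.X} (hx : x ∈ Comp.filt C.toSModule A.X (r + 1)) :
    barD α A x - compD C.toSModule A.X x ∈ Comp.filt C.toSModule A.X r := by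
  induction hx using Submodule.span_induction with
  | zero => rw [map_zero, map_zero, sub_zero]; exact Submodule.zero_mem _
  | add x y _ _ hx hy =>
    rw [map_add, map_add, add_sub_add_comm]; exact Submodule.add_mem _ hx hy
  | smul c x _ hx => rw [map_smul, map_smul, ← smul_sub]; exact Submodule.smul_mem _ _ hx
  | mem x hx =>
    obtain ⟨n, q, x, v, hx, hq, rfl⟩ := hx
    rw [barD_mk, barPre, LinearMap.add_apply, LinearMap.comp_apply, LinearMap.sum_apply,
      LinearMap.add_apply, map_add, compD_mk, barD₁, add_assoc, add_sub_cancel_left]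
    refine Submodule.add_mem _ ?_ (Submodule.sum_mem _ fun T _ => ?_)
    · rw [barD₃, TensorProduct.map_tmul]
      exact Comp.mk_mem_filt (totD_mem hx) (by push_cast at hq; omega) _
    · rw [LinearMap.comp_apply, barTerm, LinearMap.comp_apply, TensorProduct.map_tmul]
      have h := C.cocirc_mem (Graft.ofEquiv (splitEquiv T)) hx
      generalize C.cocirc (Graft.ofEquiv (splitEquiv T)) x = z at h
      generalize unshuffle A.X (splitEquiv T) v = w
      induction h using Submodule.span_induction with
      | zero => rw [zero_tmul, map_zero, map_zero]; exact Submodule.zero_mem _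
      | add x y _ _ hx hy => rw [add_tmul, map_add, map_add]; exact Submodule.add_mem _ hx hy
      | smul c x _ hx => rw [← smul_tmul', map_smul, map_smul]; exact Submodule.smul_mem _ _ hx
      | mem z hz =>
        obtain ⟨i, j, x', x'', hij, hx', hx'', rfl⟩ := hz
        induction w using TensorProduct.induction_on with
        | zero => rw [tmul_zero, map_zero, map_zero]; exact Submodule.zero_mem _
        | add w w' h h' => rw [tmul_add, map_add, map_add]; exact Submodule.add_mem _ h h'
        | tmul v w =>
          rw [barApply_tmul]
          -- If `j < 1`, then `α(x'')` lies in a negative degree of the operad and the term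
          -- vanishes. Otherwise the surviving factor `x'` has degree `q - j ≤ q - 1`.
          by_cases hj : j - 1 < 0
          · obtain ⟨y, hy⟩ := α.map_mem hx''
            have := hP T.card _ hj
            rw [Subsingleton.elim y 0, map_zero] at hy
            rw [← hy, map_zero, LinearMap.zero_apply, zero_tmul, map_zero, tmul_zero, map_zero]
            exact Submodule.zero_mem _
          · exact Comp.mk_mem_filt (sgn_mem hx') (by push_cast at hq; omega) _

/-- If `f` is a quasi-isomorphism, then the cone of `C ∘ f` is acyclic. -/
theorem isQI_compMap (hC : C.IsProjective) (hC₀ : C.IsNonneg) (hP₀ : P.IsNonneg) {A B : Algebra P}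
    (f : A.Hom B) (hf : QuasiIso f.hom) :
    IsQI (barD α A) (barD α B) (compMap f.hom C.toSModule) := by
  obtain ⟨θ, hθ, hθ'⟩ := SModule.IsProjective.exists_sum_conj_eq hC
  have h n := (isQI_tpowMap f.hom (isQI_totMap f.hom hf) n).exists_contraction tpowD_tpowD
    tpowD_tpowD (tpowMap_tpowD f.hom)
  choose a b c e h using h
  -- The odd entries of the contraction are transferred with `θ ∘ sgn`, which must preserve degrees
  -- as well for the filtration to be respected.
  have hθs : ∀ n q, ∀ x ∈ gr (C.X n) q, (θ n ∘ₗ sgn (C.X n)) x ∈ gr (C.X n) q :=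
    fun n q x hx => hθ n q _ (sgn_mem hx)
  exact (isConeContraction_transfer θ hθ' (fun n => commute_sgn (hθ n)) h).isQI_of_filtration
    (barD_barD α A) (barD_barD α B) (compMap_barD α f) Comp.filt_mono Comp.filt_mono
    (Comp.filt_zero hC₀) (Comp.filt_zero hC₀) Comp.exists_mem_filt Comp.exists_mem_filt
    (fun _ _ => barD_sub_compD_mem_filt α A hP₀) (fun _ _ => barD_sub_compD_mem_filt α B hP₀)
    (fun _ _ => transfer_mem_filt _ hθs) (fun _ _ => transfer_mem_filt _ hθ)
    (fun _ _ => transfer_mem_filt _ hθ) (fun _ _ => transfer_mem_filt _ hθs)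

end

/-! ### Homogeneous components -/

section
variable {K : Type u} [Field K] {A : ChainComplex (ModuleCat.{u} K) ℤ}

/-- The projection of `A^{⊗n}` onto its part of degree `q`. -/
def tpowProj (A : ChainComplex (ModuleCat.{u} K) ℤ) (n : ℕ) (q : ℤ) : TPow A n →ₗ[K] TPow A n :=
  PiTensorProduct.lift <| MultilinearMap.fromDirectSumEquiv fun p : Fin n → ℤ =>
    (if ∑ i, p i = q then (1 : K) else 0) •
      (PiTensorProduct.tprod K (s := fun _ : Fin n => Tot A)).compLinearMap
        fun i => lof K ℤ (fun q => A.X q) (p i)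

theorem tpowProj_tprod {n : ℕ} (q : ℤ) {p : Fin n → ℤ} {a : Fin n → Tot A}
    (ha : ∀ i, a i ∈ gr A (p i)) : tpowProj A n q (PiTensorProduct.tprod K a) =
      (if ∑ i, p i = q then (1 : K) else 0) • PiTensorProduct.tprod K a := by
  choose b hb using ha
  obtain rfl : (fun i => lof K ℤ (fun q => A.X q) (p i) (b i)) = a := funext hb
  rw [tpowProj, PiTensorProduct.lift.tprod, MultilinearMap.fromDirectSumEquiv_lof,
    _root_.smul_apply]
  rfl

variable {M : SModule K}

/-- The projection of `M(n) ⊗ A^{⊗n}` onto its part of degree `q`. -/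
def tensorProj (M : SModule K) (A : ChainComplex (ModuleCat.{u} K) ℤ) (n : ℕ) (q : ℤ) :
    Tot (M.X n) ⊗[K] TPow A n →ₗ[K] Tot (M.X n) ⊗[K] TPow A n :=
  -- On elements whose first factor has degree `r`, the second factor must be projected to degree `q
  -- - r`.
  TensorProduct.lift <| toModule K ℤ _ fun r =>
    (TensorProduct.mk K (Tot (M.X n)) (TPow A n)).compl₂ (tpowProj A n (q - r)) ∘ₗ
      lof K ℤ (fun i => (M.X n).X i) r

theorem tensorProj_tmul {n : ℕ} (q : ℤ) {r : ℤ} {x : Tot (M.X n)} (hx : x ∈ gr (M.X n) r)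
    {p : Fin n → ℤ} {a : Fin n → Tot A} (ha : ∀ i, a i ∈ gr A (p i)) :
    tensorProj M A n q (x ⊗ₜ PiTensorProduct.tprod K a) =
      (if r + ∑ i, p i = q then (1 : K) else 0) • x ⊗ₜ PiTensorProduct.tprod K a := by
  obtain ⟨x, rfl⟩ := hx
  rw [tensorProj, TensorProduct.lift.tmul, toModule_lof, LinearMap.comp_apply,
    LinearMap.compl₂_apply, TensorProduct.mk_apply, tpowProj_tprod _ ha, tmul_smul]
  simp only [eq_sub_iff_add_eq, add_comm r]

/-- Permuting tensor factors does not change the sum of their degrees; hence the projections pass to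
coinvariants. -/
theorem diagAct_tensorProj {n : ℕ} (q : ℤ) (σ : Equiv.Perm (Fin n))
    (z : Tot (M.X n) ⊗[K] TPow A n) :
    diagAct M A σ (tensorProj M A n q z) = tensorProj M A n q (diagAct M A σ z) := by
  induction z using TensorProduct.induction_on with
  | zero => simp only [map_zero]
  | add z z' h h' => simp only [map_add, h, h']
  | tmul x v =>
    induction x using Tot.induction with
    | hadd x y hx hy => simp only [add_tmul, map_add, hx, hy]
    | h r x hx =>
      suffices h : (diagAct M A σ ∘ₗ tensorProj M A n q) ∘ₗ TensorProduct.mk K _ _ x =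
          (tensorProj M A n q ∘ₗ diagAct M A σ) ∘ₗ TensorProduct.mk K _ _ x from
        LinearMap.congr_fun h v
      refine tpow_ext fun p a ha => ?_
      simp only [LinearMap.comp_apply, TensorProduct.mk_apply]
      rw [tensorProj_tmul q hx ha, map_smul, diagAct, TensorProduct.map_tmul, permMap_tprod σ ha,
        tmul_smul, map_smul, tensorProj_tmul q (show M.act σ x ∈ _ from totMap_mem _ hx)
        (p := fun i => p (σ.symm i)) fun i => ha _, Equiv.sum_comp σ.symm p, smul_comm]

/-- The projection of `M ∘ A` onto its part of degree `q`. -/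
def Comp.proj (M : SModule K) (A : ChainComplex (ModuleCat.{u} K) ℤ) (q : ℤ) :
    Comp M A →ₗ[K] Comp M A :=
  toModule K ℕ _ fun n => (coinvRel M A n).liftQ (Comp.mk M A n ∘ₗ tensorProj M A n q) <| by
    refine Submodule.span_le.2 ?_
    rintro _ ⟨σ, z, rfl⟩
    rw [SetLike.mem_coe, LinearMap.mem_ker, map_sub, sub_eq_zero, LinearMap.comp_apply,
      LinearMap.comp_apply, ← diagAct_tensorProj, mk_diagAct]

theorem Comp.proj_mk {n : ℕ} (q : ℤ) (z : Tot (M.X n) ⊗[K] TPow A n) :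
    Comp.proj M A q (Comp.mk M A n z) = Comp.mk M A n (tensorProj M A n q z) :=
  (toModule_lof ..).trans (Submodule.liftQ_apply ..)

/-- `Comp.gr` is only defined as a span; this shows that the projections really separate the
homogeneous parts. -/
theorem Comp.proj_of_mem (q : ℤ) {r : ℤ} {x : Comp M A} (hx : x ∈ Comp.gr M A r) :
    Comp.proj M A q x = (if r = q then (1 : K) else 0) • x := by
  induction hx using Submodule.span_induction with
  | zero => rw [map_zero, smul_zero]
  | add x y _ _ hx hy => rw [map_add, smul_add, hx, hy]
  | smul c x _ hx => rw [map_smul, hx, smul_comm]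
  | mem x hx =>
    obtain ⟨n, s, p, x, a, hx, ha, rfl, rfl⟩ := hx
    rw [Comp.proj_mk, tensorProj_tmul q hx ha, map_smul]

/-- Homogeneous tensors generate, so the homogeneous parts together span `M ∘ A`. -/
theorem Comp.induction_gr {motive : Comp M A → Prop} (x : Comp M A)
    (h : ∀ q, ∀ x ∈ Comp.gr M A q, motive x)
    (hadd : ∀ x y, motive x → motive y → motive (x + y)) : motive x := by
  have htop : (⨆ q, Comp.gr M A q) = ⊤ := by
    rw [eq_top_iff]
    rintro x -
    induction x using Comp.induction with
    | hadd x y hx hy => exact Submodule.add_mem _ hx hy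
    | h n z =>
      induction z using TensorProduct.induction_on with
      | zero => rw [map_zero]; exact Submodule.zero_mem _
      | add z z' h h' => rw [map_add]; exact Submodule.add_mem _ h h'
      | tmul x v =>
        induction x using Tot.induction with
        | hadd x y hx hy => rw [add_tmul, map_add]; exact Submodule.add_mem _ hx hy
        | h r x hx =>
          -- Membership in the span is restated as vanishing of a linear map to the quotient, so
          -- that it can be tested on tensors of homogeneous elements.
          have h0 : ((⨆ q, Comp.gr M A q).mkQ ∘ₗ Comp.mk M A n) ∘ₗ TensorProduct.mk K _ _ x = 0 :=
            tpow_ext fun p a ha => (Submodule.Quotient.mk_eq_zero _).2 <|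
              Submodule.mem_iSup_of_mem _ (mk_mem hx ha rfl)
          exact (Submodule.Quotient.mk_eq_zero _).1 (LinearMap.congr_fun h0 v)
  have hx : x ∈ ⨆ q, Comp.gr M A q := htop ▸ Submodule.mem_top
  induction hx using Submodule.iSup_induction' with
  | mem q x hx => exact h q x hx
  | zero => exact h 0 0 (Submodule.zero_mem _)
  | add x y _ _ hx hy => exact hadd x y hx hy

theorem Comp.proj_mem (q : ℤ) (x : Comp M A) : Comp.proj M A q x ∈ Comp.gr M A q := by
  induction x using Comp.induction_gr with
  | hadd x y hx hy => rw [map_add]; exact Submodule.add_mem _ hx hy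
  | h r x hx =>
    rw [Comp.proj_of_mem q hx]
    split_ifs with h
    · exact Submodule.smul_mem _ _ (h ▸ hx)
    · rw [zero_smul]; exact Submodule.zero_mem _

/-- A map that shifts degrees by `s` intertwines the projections up to that shift. It is used with
`s = -1` for the differential and `s = 0` for `C ∘ f`. -/
theorem Comp.proj_comm {B : ChainComplex (ModuleCat.{u} K) ℤ} {F : Comp M A →ₗ[K] Comp M B} {s : ℤ}
    (hF : ∀ q, ∀ x ∈ Comp.gr M A q, F x ∈ Comp.gr M B (q + s)) {q r : ℤ} (hqr : q + s = r)
    (x : Comp M A) : F (Comp.proj M A q x) = Comp.proj M B r (F x) := by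
  induction x using Comp.induction_gr with
  | hadd x y hx hy => simp only [map_add, hx, hy]
  | h t x hx =>
    rw [Comp.proj_of_mem q hx, Comp.proj_of_mem r (hF t x hx), map_smul, ← hqr]
    simp only [add_left_inj]

end

/-! ### From total spaces back to chain complexes -/

section
variable {K : Type u} [Field K] {C : Cooperad K} {P : Operad K} (α : Twisting C P)

/-- The inclusion of the part of degree `i` of the bar construction into `C ∘ A`. -/
def barVal (A : Algebra P) (i : ℤ) : (bar α A).X i →ₗ[K] Comp C.toSModule A.X :=
  (Comp.gr C.toSModule A.X i).subtype

theorem barVal_mem {A : Algebra P} {i : ℤ} (x : (bar α A).X i) :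
    barVal α A i x ∈ Comp.gr C.toSModule A.X i :=
  Subtype.prop (p := (· ∈ Comp.gr C.toSModule A.X i)) x

theorem barVal_d {A : Algebra P} {i j : ℤ} (h : i - 1 = j) (x : (bar α A).X i) :
    barVal α A j (((bar α A).d i j).hom x) = barD α A (barVal α A i x) := by
  simp only [bar, dif_pos h]
  rfl

/-- The morphism `B_α f` is a quasi-isomorphism if the cone of `C ∘ f` is acyclic. -/
theorem quasiIso_barMap {A B : Algebra P} (f : A.Hom B)
    (hf : IsQI (barD α A) (barD α B) (compMap f.hom C.toSModule)) : QuasiIso (barMap α f) := by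
  rw [isQI_iff] at hf
  rw [quasiIso_iff_forall]
  intro q y x hy hx
  have hy' : barD α A (barVal α A q y) = 0 := by rw [← barVal_d α rfl, hy, map_zero]
  have hx' : compMap f.hom C.toSModule (barVal α A q y) = barD α B (barVal α B (q + 1) x) :=
    (congrArg Subtype.val hx).trans (barVal_d α (add_sub_cancel_right q 1) x)
  -- The primitive found in the total spaces need not be homogeneous. Its components of degrees `q +
  -- 1` and `q + 2` solve the same equations, because the projections commute with the maps and fix
  -- the homogeneous data `y` and `x`.
  obtain ⟨w, z, hw, hz⟩ := hf _ _ hy' hx'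
  have hD {A : Algebra P} (q : ℤ) (x : Comp C.toSModule A.X) :
      barD α A (Comp.proj C.toSModule A.X (q + 1) x) = Comp.proj C.toSModule A.X q (barD α A x) :=
    Comp.proj_comm (s := -1) (fun _ _ => barD_mem α A) (by ring) x
  have hf' (q : ℤ) (x : Comp C.toSModule A.X) :
      compMap f.hom C.toSModule (Comp.proj C.toSModule A.X q x) =
        Comp.proj C.toSModule B.X q (compMap f.hom C.toSModule x) :=
    Comp.proj_comm (s := 0) (fun q x hx => by rw [add_zero]; exact compMap_mem _ _ hx)
      (add_zero q) x
  have h1 : barD α A (Comp.proj C.toSModule A.X (q + 1) w) = barVal α A q y := by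
    rw [hD, hw, Comp.proj_of_mem q (barVal_mem α y), if_pos rfl, one_smul]
  have h2 : compMap f.hom C.toSModule (Comp.proj C.toSModule A.X (q + 1) w) -
      barD α B (Comp.proj C.toSModule B.X (q + 1 + 1) z) = barVal α B (q + 1) x := by
    rw [hD, hf', ← map_sub, hz, Comp.proj_of_mem (q + 1) (barVal_mem α x), if_pos rfl, one_smul]
  exact ⟨⟨_, Comp.proj_mem (q + 1) w⟩, ⟨_, Comp.proj_mem (q + 1 + 1) z⟩,
    Subtype.ext ((barVal_d α (add_sub_cancel_right q 1) _).trans h1),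
    Subtype.ext ((congrArg (compMap f.hom C.toSModule (Comp.proj C.toSModule A.X (q + 1) w) - ·)
      (barVal_d α (add_sub_cancel_right (q + 1) 1) _)).trans h2)⟩

end

end OperadicBar

end

theorem mainTheorem8 {K : Type u} [Field K] {C : OperadicBar.Cooperad K}
    {P : OperadicBar.Operad K} (α : OperadicBar.Twisting C P)
    (hC : C.IsProjective) (hP : P.IsProjective) (hC₀ : C.IsNonneg) (hP₀ : P.IsNonneg)
    {A B : OperadicBar.Algebra P} (f : A.Hom B) (hf : QuasiIso f.hom) :
    QuasiIso (OperadicBar.barMap α f) :=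
  OperadicBar.quasiIso_barMap α f (OperadicBar.isQI_compMap α hC hC₀ hP₀ f hf)
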